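/- \textbf{Setting.} Let $\beta>0$, $\mathcal D=\mathbb R/2\pi\mathbb Z$, $V(q)=1-\cos q$, and let $\mu=\nu\otimes\kappa$ on $\mathcal D\times\mathbb R$ with $\nu(dq)=Z_{\beta,\nu}^{-1}e^{-\beta V(q)}dq$ and $\kappa=\mathcal N(0,\beta^{-1})$. All norms and scalar products are those of the real spaces $L^2(\mu)$ or $L^2(\nu)$. For $\gamma>0$ let $$\mathcal L=\mathcal L_{\rm ham}+\gamma\mathcal L_{\rm FD},\qquad \mathcal L_{\rm ham}=p\,\partial_q-V'(q)\partial_p,\qquad \mathcal L_{\rm FD}=-p\,\partial_p+\beta^{-1}\partial_p^2,$$ regarded as (closed) operators on $L^2(\mu)$ with core $\mathscr C=C_c^\infty(\mathcal D\times\mathbb R)$; $\mathcal L^*=-\mathcal L_{\rm ham}+\gamma\mathcal L_{\rm FD}$. Let $\Pi_p$ be the orthogonal projector onto the functions of $q$ only, $\Pi_0\varphi=\varphi-\int\varphi\,d\mu$, $L^2_0(\mu)=\Pi_0L^2(\mu)$, and $$A=\big(1+(\mathcal L_{\rm ham}\Pi_p)^*(\mathcal L_{\rm ham}\Pi_p)\big)^{-1}(\mathcal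 L_{\rm ham}\Pi_p)^*,\qquad \langle\langle\varphi,\psi\rangle\rangle_\varepsilon=\langle\varphi,\psi\rangle-\varepsilon\langle A\varphi,\psi\rangle-\varepsilon\langle A\psi,\varphi\rangle .$$ Call $(\overline\varepsilon,\overline\lambda,(\widetilde\lambda_\gamma)_{\gamma>0})$ \emph{admissible} if $\overline\varepsilon\in(0,1)$, $\overline\lambda>0$ and, for every $\gamma>0$, with $\varepsilon=\overline\varepsilon\min(\gamma,\gamma^{-1})$, one has $\widetilde\lambda_\gamma\ge\overline\lambda\min(\gamma,\gamma^{-1})$ and $\langle\langle-\mathcal L\varphi,\varphi\rangle\rangle_\varepsilon\ge\widetilde\lambda_\gamma\|\varphi\|^2$ for all $\varphi\in\Pi_0\mathscr C$. Put $\lambda_\gamma=\widetilde\lambda_\gamma/(1+\varepsilon)$. Let $H_\ell(p)=(\ell!)^{-1/2}\mathrm{He}_\ell(\sqrt\beta p)$ (probabilists' Hermite polynomials), $G_0=\sqrt{Z_{\beta,\nu}/2\pi}\,e^{\beta V/2}$ and, for $k\ge1$, $G_{2k}=\sqrt{Z_{\beta,\nu}/\pi}\,\cos(kq)e^{\beta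 V/2}$, $G_{2k-1}=\sqrt{Z_{\beta,\nu}/\pi}\,\sin(kq)e^{\beta V/2}$. Let $V_{KL}$ be the span of $e_{k\ell}=G_kH_\ell$, $0\le k<2K-1$, $0\le\ell<L$, with orthogonal projector $\Pi_{KL}$; let $\Pi_{KL,0}$ be the orthogonal projector onto $V_{KL,0}=V_{KL}\cap L_0^2(\mu)$; let $\Pi^q_K\varphi=\sum_{k<2K-1}\langle\varphi,G_k\rangle G_k$ on $L^2(\nu)$, and $u_{KL}=\Pi_{KL}\mathbf 1/\|\Pi_{KL}\mathbf 1\|$. Define the saddle-point matrix $$\widehat{\mathbf L}_{KL}=\begin{pmatrix}\mathbf L&\mathbf U\\ \mathbf U^\top&0\end{pmatrix},\qquad \mathbf L_{k\ell,k'\ell'}=\langle e_{k\ell},-\mathcal L e_{k'\ell'}\rangle,\qquad \mathbf U_{k\ell}=\langle u_{KL},e_{k\ell}\rangle,$$ and the discrete rate $$\widehat\lambda_{\gamma,KL}=\lambda_\gamma-\frac{\varepsilon}{1+\varepsilon}\Big(\|(A+A^*)(1-\Pi_{KL})\mathcal L\Pi_{KL}\|+\|\mathcal L^*u_{KL}\|\Big).$$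 \textbf{Proposition.} For every $\beta>0$ there are $K_1,L_1\in\mathbb N$ such that: (1) for all $\gamma>0$, $K\ge K_1$, $L\ge L_1$, the matrix $\widehat{\mathbf L}_{KL}$ is invertible; (2) admissible triples exist; (3) for every admissible triple there is $C\ge1$, independent of $\gamma,K,L$, such that: (3a) for every $\gamma>0$, $\|e^{t\mathcal L}\varphi\|\le Ce^{-\lambda_\gamma t}\|\varphi\|$ for all $\varphi\in L^2_0(\mu)$, $t\ge0$, where $(e^{t\mathcal L})_{t\ge0}$ is any strongly continuous semigroup on $L^2(\mu)$ whose generator is the closure of $\mathcal L|_{\mathscr C}$; (3b) there are $K_0,L_0$ such that, for all $\gamma>0$, $K\ge K_0$, $L\ge L_0$, one has $\widehat\lambda_{\gamma,KL}>0$, the operator $\Pi_{KL,0}\mathcal L\Pi_{KL,0}$ is invertible on $V_{KL,0}$, and $\|(\Pi_{KL,0}\mathcal L\Pi_{KL,0})^{-1}\|\le C/\widehat\lambda_{\gamma,KL}$; (4) for every admissible triple and all $\gamma>0$, $K\ge K_1$, $L\ge L_1$, with $\varepsilon=\overline\varepsilon\min(\gamma,\gamma^{-1})$, $$\widehat\lambda_{\gamma,KL}\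 \ge\ \lambda_\gamma-\frac{\varepsilon}{1+\varepsilon}\left[\frac{(1+\sqrt2)\beta}{2K}+\frac{\beta^3}{16}\,\frac{\|(1-\Pi^q_{K-1})\mathbf 1\|^2}{1-\|(1-\Pi^q_K)\mathbf 1\|^2}\right].$$ -/

import Mathlib

open MeasureTheory ProbabilityTheory

namespace Langevin

open scoped Real ContDiff InnerProductSpace

noncomputable section

/-! ## The model: one particle of mass one on the torus of length 2π, with a cosine potential -/

/-- The position space `ℝ / 2πℤ`. -/
abbrev Torus : Type := AddCircle (2 * π)

/-- The phase space: positions on the torus and real momenta. -/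
abbrev Phase : Type := Torus × ℝ

instance factTwoPiPos : Fact (0 < 2 * π) := ⟨Real.two_pi_pos⟩

theorem periodic_cos_nat (k : ℕ) :
    Function.Periodic (fun x : ℝ => Real.cos (k * x)) (2 * π) := by
  intro x
  simp only [mul_add]
  exact Real.cos_add_nat_mul_two_pi (k * x) k

theorem periodic_sin_nat (k : ℕ) :
    Function.Periodic (fun x : ℝ => Real.sin (k * x)) (2 * π) := by
  intro x
  simp only [mul_add]
  exact Real.sin_add_nat_mul_two_pi (k * x) k

/-- `q ↦ cos (k q)` on the torus. -/
def cosMode (k : ℕ) : Torus → ℝ := (periodic_cos_nat k).lift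

/-- `q ↦ sin (k q)` on the torus. -/
def sinMode (k : ℕ) : Torus → ℝ := (periodic_sin_nat k).lift

@[simp] theorem cosMode_coe (k : ℕ) (x : ℝ) : cosMode k (x : Torus) = Real.cos (k * x) := rfl

@[simp] theorem sinMode_coe (k : ℕ) (x : ℝ) : sinMode k (x : Torus) = Real.sin (k * x) := rfl

/-- The potential `V(q) = 1 - cos q`. -/
def V (q : Torus) : ℝ := 1 - cosMode 1 q

/-- The derivative of a function on the torus. -/
def torusDeriv (h : Torus → ℝ) (q : Torus) : ℝ := deriv (fun s : ℝ => h (q + (s : Torus))) 0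

/-- The normalisation constant `∫ exp (-β V) dq`, for the length measure `dq` on the torus. -/
def Z (β : ℝ) : ℝ := ∫ q : Torus, Real.exp (-β * V q)

/-- The position marginal `ν(dq) = Z⁻¹ exp (-β V(q)) dq`. -/
def nu (β : ℝ) : Measure Torus := (volume : Measure Torus).tilted (fun q => -β * V q)

/-- The momentum marginal: the centred Gaussian law of variance `β⁻¹`. -/
def kappa (β : ℝ) : Measure ℝ := gaussianReal 0 (β⁻¹).toNNReal

/-- The canonical measure `μ(dq dp)`, proportional to `exp (-β (V(q) + p² / 2)) dq dp`. -/
def mu (β : ℝ) : Measure Phase := (nu β).prod (kappa β)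

theorem continuous_cosMode (k : ℕ) : Continuous (cosMode k) :=
  continuous_quot_lift _ (by fun_prop)

theorem continuous_sinMode (k : ℕ) : Continuous (sinMode k) :=
  continuous_quot_lift _ (by fun_prop)

theorem continuous_V : Continuous V := continuous_const.sub (continuous_cosMode 1)

instance isProbabilityMeasure_nu (β : ℝ) : IsProbabilityMeasure (nu β) := by
  have hc : Continuous (fun q : Torus => Real.exp (-β * V q)) :=
    Real.continuous_exp.comp (continuous_const.mul continuous_V)
  have : NeZero (volume : Measure Torus) := ⟨by
    intro h
    have h1 := AddCircle.measure_univ (2 * π)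
    rw [h] at h1
    simp at h1
    linarith [Real.pi_pos]⟩
  exact isProbabilityMeasure_tilted
    (hc.integrable_of_hasCompactSupport (HasCompactSupport.of_compactSpace _))

instance isProbabilityMeasure_kappa (β : ℝ) : IsProbabilityMeasure (kappa β) := by
  unfold kappa; infer_instance

instance isProbabilityMeasure_mu (β : ℝ) : IsProbabilityMeasure (mu β) := by
  unfold mu; infer_instance

/-- The real Hilbert space `L²(ν)`. -/
abbrev L2nu (β : ℝ) : Type := Lp ℝ 2 (nu β)

/-- The real Hilbert space `L²(μ)`. -/
abbrev L2 (β : ℝ) : Type := Lp ℝ 2 (mu β)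

/-- The constant function `1` in `L²(μ)`. -/
def one (β : ℝ) : L2 β := Lp.const 2 (mu β) (1 : ℝ)

/-- The constant function `1` in `L²(ν)`. -/
def oneNu (β : ℝ) : L2nu β := Lp.const 2 (nu β) (1 : ℝ)

/-! ## The generator as a differential operator -/

/-- The partial derivative in the position. -/
def dq (f : Phase → ℝ) (x : Phase) : ℝ := deriv (fun s : ℝ => f (x.1 + (s : Torus), x.2)) 0

/-- The partial derivative in the momentum. -/
def dp (f : Phase → ℝ) (x : Phase) : ℝ := deriv (fun y : ℝ => f (x.1, y)) x.2

/-- The Hamiltonian part `p ∂_q - V'(q) ∂_p`. -/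
def ham (f : Phase → ℝ) (x : Phase) : ℝ := x.2 * dq f x - torusDeriv V x.1 * dp f x

/-- The fluctuation-dissipation part `-p ∂_p + β⁻¹ ∂_p²`. -/
def fd (β : ℝ) (f : Phase → ℝ) (x : Phase) : ℝ := -x.2 * dp f x + β⁻¹ * dp (dp f) x

/-- The generator of the Langevin dynamics with friction `γ`. -/
def gen (β γ : ℝ) (f : Phase → ℝ) (x : Phase) : ℝ := ham f x + γ * fd β f x

/-- The adjoint of the generator in `L²(μ)`. -/
def genAdj (β γ : ℝ) (f : Phase → ℝ) (x : Phase) : ℝ := -ham f x + γ * fd β f x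

/-- The core: smooth functions with compact support on the phase space. -/
structure IsTest (f : Phase → ℝ) : Prop where
  smooth : ContDiff ℝ ∞ (fun x : ℝ × ℝ => f ((x.1 : Torus), x.2))
  compact : HasCompactSupport f

/-- The graph of the closure in `L²(μ)` of the Hamiltonian part, defined first on the core. -/
def hamGraph (β : ℝ) : Submodule ℝ (WithLp 2 (L2 β × L2 β)) :=
  (Submodule.span ℝ {z | ∃ f, IsTest f ∧ z.fst =ᵐ[mu β] f ∧
    z.snd =ᵐ[mu β] ham f}).topologicalClosure

/-- The graph of the closure in `L²(μ)` of the generator, defined first on the core. -/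
def genGraph (β γ : ℝ) : Submodule ℝ (WithLp 2 (L2 β × L2 β)) :=
  (Submodule.span ℝ {z | ∃ f, IsTest f ∧ z.fst =ᵐ[mu β] f ∧
    z.snd =ᵐ[mu β] gen β γ f}).topologicalClosure

/-- `S` is the strongly continuous semigroup whose generator is the closed operator with
graph `Γ`. -/
structure IsSemigroupOf {E : Type*} [NormedAddCommGroup E] [InnerProductSpace ℝ E]
    (Γ : Submodule ℝ (WithLp 2 (E × E))) (S : ℝ → E →L[ℝ] E) : Prop where
  zero : S 0 = ContinuousLinearMap.id ℝ E
  add : ∀ s t : ℝ, 0 ≤ s → 0 ≤ t → S (s + t) = S s ∘L S t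
  cont : ∀ φ : E, ContinuousOn (fun t => S t φ) (Set.Ici 0)
  generator : ∀ φ g : E,
    WithLp.toLp 2 (φ, g) ∈ Γ ↔ HasDerivWithinAt (fun t => S t φ) g (Set.Ici 0) 0

/-! ## The modified scalar product -/

/-- The isometry which regards a function of the position as a function on the phase space. -/
def posEmb (β : ℝ) : L2nu β →ₗᵢ[ℝ] L2 β :=
  Lp.compMeasurePreservingₗᵢ ℝ Prod.fst
    (measurePreserving_fst (μ := nu β) (ν := kappa β))

/-- The orthogonal projector `Π_p` of `L²(μ)` onto the functions of the position only. -/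
def PiP (β : ℝ) : L2 β →L[ℝ] L2 β :=
  (posEmb β).toContinuousLinearMap ∘L
    ContinuousLinearMap.adjoint (posEmb β).toContinuousLinearMap

/-- The graph of the closed operator `T = L_ham Π_p`. -/
def hamPiGraph (β : ℝ) : Submodule ℝ (WithLp 2 (L2 β × L2 β)) :=
  (hamGraph β).comap
    ((WithLp.prodContinuousLinearEquiv 2 ℝ (L2 β) (L2 β)).symm.toContinuousLinearMap ∘L
      ((PiP β).prodMap (ContinuousLinearMap.id ℝ (L2 β))) ∘L
      (WithLp.prodContinuousLinearEquiv 2 ℝ (L2 β) (L2 β)).toContinuousLinearMap).toLinearMap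

theorem mem_hamPiGraph (β : ℝ) (φ g : L2 β) :
    WithLp.toLp 2 (φ, g) ∈ hamPiGraph β ↔ WithLp.toLp 2 (PiP β φ, g) ∈ hamGraph β :=
  Iff.rfl

theorem isClosed_hamPiGraph (β : ℝ) :
    IsClosed (hamPiGraph β : Set (WithLp 2 (L2 β × L2 β))) :=
  (Submodule.isClosed_topologicalClosure _).preimage (ContinuousLinearMap.continuous _)

instance completeSpace_hamPiGraph (β : ℝ) : CompleteSpace (hamPiGraph β) :=
  (isClosed_hamPiGraph β).completeSpace_coe

/-- The bounded operator `A = (1 + T* T)⁻¹ T*`, where `T = L_ham Π_p`. The orthogonal projection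
of `(0, φ)` onto the graph of a closed operator `T` is `(u, T u)`, where `u + T* T u = T* φ` in
the weak sense of `A_spec` below. -/
def A (β : ℝ) : L2 β →L[ℝ] L2 β :=
  (WithLp.fstL 2 ℝ (L2 β) (L2 β)) ∘L (hamPiGraph β).starProjection ∘L
    (WithLp.prodContinuousLinearEquiv 2 ℝ (L2 β) (L2 β)).symm.toContinuousLinearMap ∘L
    (ContinuousLinearMap.inr ℝ (L2 β) (L2 β))

/-- `A φ` is the element `u` of the domain of `T` such that
`⟪u, ψ⟫ + ⟪T u, T ψ⟫ = ⟪φ, T ψ⟫` for all `ψ` in the domain of `T`. -/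
theorem A_spec (β : ℝ) (φ : L2 β) :
    ∃ v : L2 β, WithLp.toLp 2 (A β φ, v) ∈ hamPiGraph β ∧
      ∀ ψ w : L2 β, WithLp.toLp 2 (ψ, w) ∈ hamPiGraph β →
        ⟪A β φ, ψ⟫_ℝ + ⟪v, w⟫_ℝ = ⟪φ, w⟫_ℝ := by
  refine ⟨((hamPiGraph β).starProjection (WithLp.toLp 2 (0, φ))).snd,
    (hamPiGraph β).starProjection_apply_mem (WithLp.toLp 2 (0, φ)), fun ψ w h => ?_⟩
  have := (hamPiGraph β).starProjection_inner_eq_zero (WithLp.toLp 2 ((0 : L2 β), φ)) _ h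
  simp only [WithLp.prod_inner_apply] at this
  have h2 : A β φ = ((hamPiGraph β).starProjection (WithLp.toLp 2 (0, φ))).fst := rfl
  rw [h2]
  simp [inner_sub_left] at this
  linarith

/-- The scalar product obtained by polarization from
`H[φ] = ‖φ‖² / 2 - ε ⟪A φ, φ⟫`; its quadratic form is `2 H`. -/
def modInner (β ε : ℝ) (φ ψ : L2 β) : ℝ :=
  ⟪φ, ψ⟫_ℝ - ε * ⟪A β φ, ψ⟫_ℝ - ε * ⟪A β ψ, φ⟫_ℝ

/-- The coercivity of `-L` with constant `lam` for the modified scalar product, on the functions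
`φ = f - ∫ f dμ` with `f` in the core. -/
def Coercive (β γ ε lam : ℝ) : Prop :=
  ∀ f : Phase → ℝ, IsTest f → ∀ φ g : L2 β,
    φ =ᵐ[mu β] (fun x => f x - ∫ y, f y ∂(mu β)) →
    g =ᵐ[mu β] gen β γ (fun x => f x - ∫ y, f y ∂(mu β)) →
    lam * ‖φ‖ ^ 2 ≤ modInner β ε (-g) φ

/-- The parameters `ε = εbar min(γ, 1/γ)` and `ltil γ` of the hypocoercivity argument: the
generator is coercive with a constant `ltil γ` of order `min(γ, 1/γ)`, for every friction. -/
structure Admissible (β εbar lbar : ℝ) (ltil : ℝ → ℝ) : Prop where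
  eps_pos : 0 < εbar
  eps_lt_one : εbar < 1
  lbar_pos : 0 < lbar
  lower : ∀ γ : ℝ, 0 < γ → lbar * min γ γ⁻¹ ≤ ltil γ
  coercive : ∀ γ : ℝ, 0 < γ → Coercive β γ (εbar * min γ γ⁻¹) (ltil γ)

/-- The exponential decay rate of the Langevin semigroup given by the coercivity constant `lt`
and the norm equivalence. -/
def rate (ε lt : ℝ) : ℝ := lt / (1 + ε)

/-! ## The tensor basis -/

/-- The weighted Fourier modes: `G 0 = √(Z/2π) exp(βV/2)`,
`G (2k) = √(Z/π) cos(kq) exp(βV/2)` and `G (2k-1) = √(Z/π) sin(kq) exp(βV/2)` for `k ≥ 1`. -/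
def G (β : ℝ) (n : ℕ) (q : Torus) : ℝ :=
  if n = 0 then √(Z β / (2 * π)) * Real.exp (β * V q / 2)
  else if Even n then √(Z β / π) * cosMode (n / 2) q * Real.exp (β * V q / 2)
  else √(Z β / π) * sinMode ((n + 1) / 2) q * Real.exp (β * V q / 2)

/-- The Hermite modes, `He_l (√β p) / √(l!)` with the probabilists' Hermite polynomials. -/
def H (β : ℝ) (l : ℕ) (p : ℝ) : ℝ :=
  Polynomial.aeval (√β * p) (Polynomial.hermite l) / √(Nat.factorial l : ℝ)

/-- The tensor basis functions `e_{k l}(q, p) = G_k(q) H_l(p)`. -/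
def e (β : ℝ) (k l : ℕ) (x : Phase) : ℝ := G β k x.1 * H β l x.2

/-! ### The basis functions and their images lie in `L²(μ)` -/

theorem torusDeriv_of_hasDerivAt {h : Torus → ℝ} {h' : Torus → ℝ}
    (hh : ∀ x : ℝ, HasDerivAt (fun y : ℝ => h (y : Torus)) (h' (x : Torus)) x) :
    torusDeriv h = h' := by
  funext q
  induction q using QuotientAddGroup.induction_on with
  | H x =>
    have h1 : HasDerivAt (fun s : ℝ => h ((x : Torus) + (s : Torus))) (h' (x : Torus)) 0 := by
      have h2 := HasDerivAt.comp_const_add x 0 (by simpa using hh x)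
      simpa using h2
    exact h1.deriv

/-- A function on the torus with a continuous derivative. -/
def IsC1 (h : Torus → ℝ) : Prop := Continuous h ∧ Continuous (torusDeriv h)

theorem isC1_of_hasDerivAt {h h' : Torus → ℝ} (hc : Continuous h) (hc' : Continuous h')
    (hh : ∀ x : ℝ, HasDerivAt (fun y : ℝ => h (y : Torus)) (h' (x : Torus)) x) : IsC1 h :=
  ⟨hc, by rw [torusDeriv_of_hasDerivAt hh]; exact hc'⟩

theorem hasDerivAt_cosMode (k : ℕ) (x : ℝ) :
    HasDerivAt (fun y : ℝ => cosMode k (y : Torus)) (-(k * sinMode k (x : Torus))) x := by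
  simp only [cosMode_coe, sinMode_coe]
  exact ((hasDerivAt_id' x).const_mul (k : ℝ)).cos.congr_deriv (by ring)

theorem hasDerivAt_sinMode (k : ℕ) (x : ℝ) :
    HasDerivAt (fun y : ℝ => sinMode k (y : Torus)) (k * cosMode k (x : Torus)) x := by
  simp only [cosMode_coe, sinMode_coe]
  exact ((hasDerivAt_id' x).const_mul (k : ℝ)).sin.congr_deriv (by ring)

theorem hasDerivAt_V (x : ℝ) :
    HasDerivAt (fun y : ℝ => V (y : Torus)) (sinMode 1 (x : Torus)) x := by
  exact ((hasDerivAt_const x (1 : ℝ)).sub (hasDerivAt_cosMode 1 x)).congr_deriv (by norm_num)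

theorem torusDeriv_V : torusDeriv V = sinMode 1 := torusDeriv_of_hasDerivAt hasDerivAt_V

theorem hasDerivAt_weight (β : ℝ) (x : ℝ) :
    HasDerivAt (fun y : ℝ => Real.exp (β * V (y : Torus) / 2))
      (Real.exp (β * V (x : Torus) / 2) * (β * sinMode 1 (x : Torus) / 2)) x :=
  (((hasDerivAt_V x).const_mul β).div_const 2).exp

theorem continuous_weight (β : ℝ) : Continuous (fun q : Torus => Real.exp (β * V q / 2)) := by
  have := continuous_V
  fun_prop

theorem isC1_G (β : ℝ) (n : ℕ) : IsC1 (G β n) := by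
  have hw := continuous_weight β
  have hs := continuous_sinMode
  have hc := continuous_cosMode
  unfold G
  split_ifs
  · exact isC1_of_hasDerivAt
      (h' := fun q => _ * (Real.exp (β * V q / 2) * (β * sinMode 1 q / 2)))
      (by fun_prop) (by fun_prop) (fun x => (hasDerivAt_weight β x).const_mul _)
  · exact isC1_of_hasDerivAt
      (h' := fun q => _ * (-(((n / 2 : ℕ) : ℝ) * sinMode (n / 2) q)) * Real.exp (β * V q / 2) +
        _ * cosMode (n / 2) q * (Real.exp (β * V q / 2) * (β * sinMode 1 q / 2)))
      (by fun_prop) (by fun_prop)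
      (fun x => ((hasDerivAt_cosMode (n / 2) x).const_mul _).mul (hasDerivAt_weight β x))
  · exact isC1_of_hasDerivAt
      (h' := fun q => _ * ((((n + 1) / 2 : ℕ) : ℝ) * cosMode ((n + 1) / 2) q) *
          Real.exp (β * V q / 2) +
        _ * sinMode ((n + 1) / 2) q * (Real.exp (β * V q / 2) * (β * sinMode 1 q / 2)))
      (by fun_prop) (by fun_prop)
      (fun x => ((hasDerivAt_sinMode ((n + 1) / 2) x).const_mul _).mul (hasDerivAt_weight β x))

theorem exists_polynomial_H (β : ℝ) (l : ℕ) :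
    ∃ P : Polynomial ℝ, H β l = fun p => P.eval p := by
  refine ⟨Polynomial.C (√(Nat.factorial l : ℝ))⁻¹ *
    (((Polynomial.hermite l).map (Int.castRingHom ℝ)).comp
      (Polynomial.C √β * Polynomial.X)), ?_⟩
  funext p
  simp [H, Polynomial.aeval_def, Polynomial.eval₂_eq_eval_map, div_eq_inv_mul]

theorem integrable_polynomial_kappa (β : ℝ) (P : Polynomial ℝ) :
    Integrable (fun p => P.eval p) (kappa β) := by
  induction P using Polynomial.induction_on' with
  | add P Q hP hQ =>
    simp only [Polynomial.eval_add]
    exact hP.add hQ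
  | monomial n a =>
    simp only [Polynomial.eval_monomial]
    refine Integrable.const_mul ?_ a
    have h := (memLp_id_gaussianReal (μ := 0) (v := (β⁻¹).toNNReal) n)
    have h2 := MemLp.integrable_norm_pow' (p := n) (by simpa using h)
    refine (integrable_norm_iff (by fun_prop)).1 ?_
    simpa [kappa] using h2

theorem memLp_polynomial_kappa (β : ℝ) (P : Polynomial ℝ) :
    MemLp (fun p => P.eval p) 2 (kappa β) := by
  rw [memLp_two_iff_integrable_sq (by fun_prop)]
  have h := integrable_polynomial_kappa β (P ^ 2)
  simp only [Polynomial.eval_pow] at h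
  exact h

theorem memLp_tensor (β : ℝ) {h : Torus → ℝ} (hh : Continuous h) (P : Polynomial ℝ) :
    MemLp (fun x : Phase => h x.1 * P.eval x.2) 2 (mu β) := by
  obtain ⟨C, hC⟩ := (isCompact_univ (X := Torus)).exists_bound_of_continuousOn hh.continuousOn
  have hP : MemLp (fun x : Phase => P.eval x.2) 2 (mu β) :=
    (memLp_polynomial_kappa β P).comp_measurePreserving measurePreserving_snd
  refine (hP.const_mul C).mono ?_ (Filter.Eventually.of_forall fun x => ?_)
  · exact (by fun_prop : Continuous fun x : Phase => h x.1 * P.eval x.2).aestronglyMeasurable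
  · have h1 := hC x.1 (Set.mem_univ _)
    rw [norm_mul, norm_mul]
    exact mul_le_mul_of_nonneg_right (h1.trans (le_abs_self C)) (norm_nonneg _)

theorem ham_tensor (β : ℝ) (k : ℕ) {l : ℕ} {P : Polynomial ℝ} (hP : H β l = fun p => P.eval p) :
    ham (e β k l) = fun x => torusDeriv (G β k) x.1 * (Polynomial.X * P).eval x.2 -
      (sinMode 1 x.1 * G β k x.1) * P.derivative.eval x.2 := by
  funext x
  have h1 : dq (e β k l) x = torusDeriv (G β k) x.1 * P.eval x.2 := by
    simp only [dq, e, hP, torusDeriv, deriv_mul_const_field]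
  have h2 : dp (e β k l) x = G β k x.1 * P.derivative.eval x.2 := by
    simp only [dp, e, hP, deriv_const_mul_field, Polynomial.deriv]
  rw [ham, h1, h2, torusDeriv_V]
  simp only [Polynomial.eval_mul, Polynomial.eval_X]
  ring

theorem fd_tensor (β : ℝ) (k : ℕ) {l : ℕ} {P : Polynomial ℝ} (hP : H β l = fun p => P.eval p) :
    fd β (e β k l) = fun x => G β k x.1 * (-Polynomial.X * P.derivative +
      Polynomial.C β⁻¹ * P.derivative.derivative).eval x.2 := by
  have h2 : dp (e β k l) = fun x => G β k x.1 * P.derivative.eval x.2 := by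
    funext x
    simp only [dp, e, hP, deriv_const_mul_field, Polynomial.deriv]
  funext x
  rw [fd, h2]
  simp only [dp, deriv_const_mul_field, Polynomial.deriv, Polynomial.eval_mul, Polynomial.eval_X,
    Polynomial.eval_add, Polynomial.eval_neg, Polynomial.eval_C]
  ring

theorem memLp_e (β : ℝ) (k l : ℕ) : MemLp (e β k l) 2 (mu β) := by
  obtain ⟨P, hP⟩ := exists_polynomial_H β l
  have : e β k l = fun x => G β k x.1 * P.eval x.2 := by funext x; simp only [e, hP]
  rw [this]
  exact memLp_tensor β (isC1_G β k).1 P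

theorem memLp_ham_e (β : ℝ) (k l : ℕ) : MemLp (ham (e β k l)) 2 (mu β) := by
  obtain ⟨P, hP⟩ := exists_polynomial_H β l
  rw [ham_tensor β k hP]
  exact (memLp_tensor β (isC1_G β k).2 _).sub
    (memLp_tensor β ((continuous_sinMode 1).mul (isC1_G β k).1) _)

theorem memLp_fd_e (β : ℝ) (k l : ℕ) : MemLp (fd β (e β k l)) 2 (mu β) := by
  obtain ⟨P, hP⟩ := exists_polynomial_H β l
  rw [fd_tensor β k hP]
  exact memLp_tensor β (isC1_G β k).1 _

theorem memLp_gen_e (β γ : ℝ) (k l : ℕ) : MemLp (gen β γ (e β k l)) 2 (mu β) :=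
  (memLp_ham_e β k l).add ((memLp_fd_e β k l).const_mul γ)

theorem memLp_genAdj_e (β γ : ℝ) (k l : ℕ) : MemLp (genAdj β γ (e β k l)) 2 (mu β) :=
  (memLp_ham_e β k l).neg.add ((memLp_fd_e β k l).const_mul γ)

theorem memLp_G (β : ℝ) (k : ℕ) : MemLp (G β k) 2 (nu β) := by
  have hc := (isC1_G β k).1
  obtain ⟨C, hC⟩ := (isCompact_univ (X := Torus)).exists_bound_of_continuousOn hc.continuousOn
  exact MemLp.of_bound hc.aestronglyMeasurable C
    (Filter.Eventually.of_forall fun x => hC x (Set.mem_univ _))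

/-- `G_k` in `L²(ν)`. -/
def gVec (β : ℝ) (k : ℕ) : L2nu β := (memLp_G β k).toLp _

/-! ## The Galerkin discretization -/

/-- The indices `(k, l)` with `0 ≤ k < 2K - 1` and `0 ≤ l < L`. -/
abbrev Idx (K L : ℕ) : Type := Fin (2 * K - 1) × Fin L

/-- `e_{k l}` in `L²(μ)`. -/
def eVec (β : ℝ) {K L : ℕ} (i : Idx K L) : L2 β := (memLp_e β i.1 i.2).toLp _

/-- `L e_{k l}` in `L²(μ)`. -/
def genVec (β γ : ℝ) {K L : ℕ} (i : Idx K L) : L2 β := (memLp_gen_e β γ i.1 i.2).toLp _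

/-- `L* e_{k l}` in `L²(μ)`. -/
def genAdjVec (β γ : ℝ) {K L : ℕ} (i : Idx K L) : L2 β := (memLp_genAdj_e β γ i.1 i.2).toLp _

/-- The norm of `(1 - Π^q_K) 1` in `L²(ν)`, where `Π^q_K φ = ∑_{k < 2K - 1} ⟪G_k, φ⟫ G_k`. -/
def qDefect (β : ℝ) (K : ℕ) : ℝ :=
  ‖oneNu β - ∑ k : Fin (2 * K - 1), ⟪gVec β k, oneNu β⟫_ℝ • gVec β k‖

/-- The projector `Π_{KL}` of `L²(μ)` onto the Galerkin space. -/
def projKL (β : ℝ) (K L : ℕ) : L2 β →L[ℝ] L2 β :=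
  ∑ i : Idx K L, (innerSL ℝ (eVec β i)).smulRight (eVec β i)

/-- The bounded operator `L Π_{KL}` on `L²(μ)`. -/
def genPi (β γ : ℝ) (K L : ℕ) : L2 β →L[ℝ] L2 β :=
  ∑ i : Idx K L, (innerSL ℝ (eVec β i)).smulRight (genVec β γ i)

/-- The bounded operator `L* Π_{KL}` on `L²(μ)`. -/
def genAdjPi (β γ : ℝ) (K L : ℕ) : L2 β →L[ℝ] L2 β :=
  ∑ i : Idx K L, (innerSL ℝ (eVec β i)).smulRight (genAdjVec β γ i)

/-- The normalized projection `u_{KL} = Π_{KL} 1 / ‖Π_{KL} 1‖` of the constant function. -/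
def uVec (β : ℝ) (K L : ℕ) : L2 β := ‖projKL β K L (one β)‖⁻¹ • projKL β K L (one β)

/-- The rigidity matrix, with entries `⟪e_i, -L e_j⟫`. -/
def rigidity (β γ : ℝ) (K L : ℕ) : Matrix (Idx K L) (Idx K L) ℝ :=
  Matrix.of fun i j => ⟪eVec β i, -genVec β γ j⟫_ℝ

/-- The coordinates `⟪u_{KL}, e_i⟫` of `u_{KL}`. -/
def uCoord (β : ℝ) (K L : ℕ) (i : Idx K L) : ℝ := ⟪uVec β K L, eVec β i⟫_ℝ

/-- The saddle-point matrix: the rigidity matrix bordered by the column and the row of the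
coordinates of `u_{KL}`, with `0` in the corner. -/
def saddle (β γ : ℝ) (K L : ℕ) : Matrix (Idx K L ⊕ Unit) (Idx K L ⊕ Unit) ℝ :=
  Matrix.fromBlocks (rigidity β γ K L) (Matrix.replicateCol Unit (uCoord β K L))
    (Matrix.replicateRow Unit (uCoord β K L)) 0

/-- The Galerkin space `V_{KL}`. -/
def galerkin (β : ℝ) (K L : ℕ) : Submodule ℝ (L2 β) :=
  Submodule.span ℝ (Set.range (eVec β (K := K) (L := L)))

/-- The functions of mean zero in the Galerkin space. -/
def galerkin0 (β : ℝ) (K L : ℕ) : Submodule ℝ (L2 β) :=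
  galerkin β K L ⊓ (Submodule.span ℝ {one β})ᗮ

instance finiteDimensional_galerkin (β : ℝ) (K L : ℕ) :
    FiniteDimensional ℝ (galerkin β K L) :=
  FiniteDimensional.span_of_finite ℝ (Set.finite_range _)

instance finiteDimensional_galerkin0 (β : ℝ) (K L : ℕ) :
    FiniteDimensional ℝ (galerkin0 β K L) :=
  Submodule.finiteDimensional_of_le (inf_le_left : galerkin0 β K L ≤ galerkin β K L)

/-- The discrete generator `Π_{KL,0} L Π_{KL,0}` on the mean-zero Galerkin space, where
`Π_{KL,0}` is the orthogonal projector onto that space. -/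
def discreteGen (β γ : ℝ) (K L : ℕ) : galerkin0 β K L →L[ℝ] galerkin0 β K L :=
  (galerkin0 β K L).orthogonalProjectionOnto ∘L genPi β γ K L ∘L (galerkin0 β K L).subtypeL

/-- The discrete convergence rate
`λ - ε / (1 + ε) (‖(A + A*) (1 - Π_{KL}) L Π_{KL}‖ + ‖L* u_{KL}‖)`, where `λ = rate ε lt`. -/
def discreteRate (β γ ε lt : ℝ) (K L : ℕ) : ℝ :=
  rate ε lt - ε / (1 + ε) *
    (‖(A β + ContinuousLinearMap.adjoint (A β)) ∘L
        (ContinuousLinearMap.id ℝ (L2 β) - projKL β K L) ∘L genPi β γ K L‖ +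
      ‖genAdjPi β γ K L (uVec β K L)‖)

end

end Langevin

namespace Langevin

open scoped Real ContDiff InnerProductSpace

noncomputable section

/-! Write T = L_ham Π_p. The operator A is only known through the weak identity `A_spec`: u = A h
satisfies ⟨u, ψ⟩ + ⟨T u, T ψ⟩ = ⟨h, T ψ⟩ for all ψ in the domain of T. Well chosen ψ give ‖A‖ ≤ 1/2,
‖A T‖ ≤ 1 and ‖T A‖ ≤ 1 without spectral calculus, and show that A h depends on h only through T* h,
that is, through the first Hermite coefficient of h in p.

Admissible triples come from the hypocoercivity argument of Dolbeault, Mouhot and Schmeiser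
(`modInner_ge`). With X = ‖Π_p φ‖ and Y = ‖φ - Π_p φ‖, the Gaussian Poincaré inequality yields the
dissipation γ Y². The correction by A adds ε c X², because T satisfies a Poincaré inequality on
functions of q (`hamPi_poincare`, `le_inner_A_of_mem`); its price is ε Y² and cross terms ε (C +
γ/2) X Y. The scaling ε = εbar min(γ, 1/γ) absorbs this price for every γ (`exists_admissible`). A
Gronwall argument in the modified norm and the density of the domain then give the decay of the
semigroup.

For φ in the mean-zero Galerkin space, L φ differs from the discrete generator applied to φ by (1 -
Π_KL) L φ and by ⟨u, L φ⟩ u. Both are orthogonal to φ, so they enter the modified product only with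
a factor ε. This gives (discrete rate) ‖φ‖ ≤ ‖discrete generator of φ‖ (`discreteRate_mul_norm_le`);
in finite dimension, a positive rate makes the discrete generator and the saddle-point matrix
invertible.

The explicit rate is a consistency estimate (`exists_consErr_le`). In the Hermite basis L_FD is
diagonal and L_ham shifts l by one, while ∂_q shifts the Fourier frequency of the weighted modes by
at most one; A sees only l = 1 and A* only l = 0. Hence the error is carried by frequency K, reached
from frequency K - 1 with l ≤ 2. Up to its neighbours, k times a mode of frequency k is a
derivative, and A and A* are bounded on derivatives, so their size on these modes is at most (√β +
o(1))/k (`modeSize_succ_le`, `eventually_modeSize_le`). The same recurrence without source makes the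
overlaps of 1 with the modes o(1/k), which controls L* u. Thus K times the error is at most √2 β/2 +
o(1), uniformly in γ and L ≥ 2, and the β/2 left over in the claimed bound absorbs the remainders.
The second term of the bracket, made of defects of 1, is only used through its sign. -/

/-! ## Calculus on the phase space -/

/-- The covering map of the phase space. -/
def cover (x : ℝ × ℝ) : Phase := ((x.1 : Torus), x.2)

theorem isOpenQuotientMap_cover : IsOpenQuotientMap cover := by
  have h : IsOpenQuotientMap (fun x : ℝ => (x : Torus)) :=
    QuotientAddGroup.isOpenQuotientMap_mk
  exact h.prodMap IsOpenQuotientMap.id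

theorem cover_surjective : Function.Surjective cover := isOpenQuotientMap_cover.surjective

theorem continuous_of_comp_cover {X : Type*} [TopologicalSpace X] {F : Phase → X}
    (h : Continuous (F ∘ cover)) : Continuous F :=
  isOpenQuotientMap_cover.isQuotientMap.continuous_iff.2 h

/-- `F` is of class `C^n`. -/
def Smooth (n : ℕ∞) (F : Phase → ℝ) : Prop := ContDiff ℝ n (fun x : ℝ × ℝ => F ((x.1 : Torus), x.2))

theorem Smooth.continuous {n : ℕ∞} {F : Phase → ℝ} (h : Smooth n F) : Continuous F :=
  continuous_of_comp_cover (ContDiff.continuous h)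

theorem Smooth.of_le {m n : ℕ∞} {F : Phase → ℝ} (h : Smooth n F) (hmn : m ≤ n) : Smooth m F :=
  ContDiff.of_le h (by exact_mod_cast hmn)

theorem dq_coe (F : Phase → ℝ) (x y : ℝ) :
    dq F ((x : Torus), y) = deriv (fun s : ℝ => F ((s : Torus), y)) x := by
  have := deriv_comp_const_add (f := fun s : ℝ => F ((s : Torus), y)) x 0
  simpa [dq] using this

theorem Smooth.hasDerivAt_q {n : ℕ∞} {F : Phase → ℝ} (h : Smooth n F) (hn : 1 ≤ n) (x y : ℝ) :
    HasDerivAt (fun s : ℝ => F ((s : Torus), y)) (dq F ((x : Torus), y)) x := by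
  rw [dq_coe]
  have h1 : ContDiff ℝ 1 (fun s : ℝ => F ((s : Torus), y)) :=
    (h.of_le hn : ContDiff ℝ 1 _).comp (contDiff_prodMk_left y)
  exact (h1.differentiable (by simp) x).hasDerivAt

theorem Smooth.hasDerivAt_p {n : ℕ∞} {F : Phase → ℝ} (h : Smooth n F) (hn : 1 ≤ n)
    (q : Torus) (y : ℝ) :
    HasDerivAt (fun s : ℝ => F (q, s)) (dp F (q, y)) y := by
  induction q using QuotientAddGroup.induction_on with
  | H x =>
    have h1 : ContDiff ℝ 1 (fun s : ℝ => F ((x : Torus), s)) :=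
      (h.of_le hn : ContDiff ℝ 1 _).comp (contDiff_prodMk_right x)
    exact (h1.differentiable (by simp) y).hasDerivAt

theorem Smooth.dq {m n : ℕ∞} {F : Phase → ℝ} (h : Smooth n F) (hmn : m + 1 ≤ n) :
    Smooth m (dq F) := by
  have h1 := h.of_le (le_trans (le_add_self) hmn)
  have e : (fun x : ℝ × ℝ => Langevin.dq F ((x.1 : Torus), x.2)) =
      fun x => fderiv ℝ (fun x : ℝ × ℝ => F ((x.1 : Torus), x.2)) x (1, 0) := by
    funext ⟨x, y⟩
    have h2 := (ContDiff.differentiable h1 (by simp) (x, y)).hasFDerivAt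
    have h3 : HasDerivAt (fun s : ℝ => (s, y)) ((1 : ℝ), (0 : ℝ)) x :=
      (hasDerivAt_id x).prodMk (hasDerivAt_const x y)
    have h4 : HasDerivAt ((fun x : ℝ × ℝ => F ((x.1 : Torus), x.2)) ∘ fun s : ℝ => (s, y)) _ x :=
      h2.comp_hasDerivAt x h3
    exact (h1.hasDerivAt_q le_rfl x y).unique h4
  unfold Smooth
  rw [e]
  exact (ContDiff.fderiv_right h (by exact_mod_cast hmn)).clm_apply contDiff_const

theorem Smooth.dp {m n : ℕ∞} {F : Phase → ℝ} (h : Smooth n F) (hmn : m + 1 ≤ n) :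
    Smooth m (dp F) := by
  have h1 := h.of_le (le_trans (le_add_self) hmn)
  have e : (fun x : ℝ × ℝ => Langevin.dp F ((x.1 : Torus), x.2)) =
      fun x => fderiv ℝ (fun x : ℝ × ℝ => F ((x.1 : Torus), x.2)) x (0, 1) := by
    funext ⟨x, y⟩
    have h2 := (ContDiff.differentiable h1 (by simp) (x, y)).hasFDerivAt
    have h3 : HasDerivAt (fun s : ℝ => (x, s)) ((0 : ℝ), (1 : ℝ)) y :=
      (hasDerivAt_const y x).prodMk (hasDerivAt_id y)
    exact (h1.hasDerivAt_p le_rfl (x : Torus) y).unique (h2.comp_hasDerivAt y h3)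
  unfold Smooth
  rw [e]
  exact (ContDiff.fderiv_right h (by exact_mod_cast hmn)).clm_apply contDiff_const

theorem Smooth.mul {n : ℕ∞} {F F' : Phase → ℝ} (h : Smooth n F) (h' : Smooth n F') :
    Smooth n (fun x => F x * F' x) := ContDiff.mul h h'

theorem Smooth.add {n : ℕ∞} {F F' : Phase → ℝ} (h : Smooth n F) (h' : Smooth n F') :
    Smooth n (fun x => F x + F' x) := ContDiff.add h h'

theorem Smooth.sub {n : ℕ∞} {F F' : Phase → ℝ} (h : Smooth n F) (h' : Smooth n F') :
    Smooth n (fun x => F x - F' x) := ContDiff.sub h h'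

theorem Smooth.const_mul {n : ℕ∞} {F : Phase → ℝ} (c : ℝ) (h : Smooth n F) :
    Smooth n (fun x => c * F x) := contDiff_const.mul h

theorem smooth_snd (n : ℕ∞) {θ : ℝ → ℝ} (h : ContDiff ℝ n θ) :
    Smooth n (fun x => θ x.2) := h.comp contDiff_snd

theorem smooth_fst (n : ℕ∞) {η : Torus → ℝ} (h : ContDiff ℝ n (fun x : ℝ => η (x : Torus))) :
    Smooth n (fun x => η x.1) := h.comp contDiff_fst

theorem contDiff_sinMode (k : ℕ) (n : WithTop ℕ∞) :
    ContDiff ℝ n (fun x : ℝ => sinMode k (x : Torus)) := by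
  simp only [sinMode_coe]; fun_prop

theorem contDiff_cosMode (k : ℕ) (n : WithTop ℕ∞) :
    ContDiff ℝ n (fun x : ℝ => cosMode k (x : Torus)) := by
  simp only [cosMode_coe]; fun_prop

theorem Smooth.ham {m n : ℕ∞} {F : Phase → ℝ} (h : Smooth n F) (hmn : m + 1 ≤ n) :
    Smooth m (ham F) := by
  have h1 := (smooth_snd m contDiff_id).mul (h.dq hmn)
  have h2 := (smooth_fst m (contDiff_sinMode 1 m)).mul (h.dp hmn)
  have h3 := h1.sub h2
  rw [← torusDeriv_V] at h3
  exact h3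

theorem Smooth.fd {m n : ℕ∞} (β : ℝ) {F : Phase → ℝ} (h : Smooth n F) (hmn : m + 2 ≤ n) :
    Smooth m (fd β F) := by
  have h1 : Smooth (m + 1) (Langevin.dp F) := h.dp (by rw [add_assoc]; exact hmn)
  have h2 := ((smooth_snd m (θ := fun y => - y) contDiff_neg).mul
    (h1.of_le le_self_add)).add ((h1.dp le_rfl).const_mul β⁻¹)
  exact h2

/-- `F` vanishes for large momenta. -/
def VanishesAt (F : Phase → ℝ) : Prop := ∃ R : ℝ, ∀ q p, R < |p| → F (q, p) = 0

/-- The torus is compact, so only the momentum can escape to infinity. -/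
theorem hasCompactSupport_iff {F : Phase → ℝ} : HasCompactSupport F ↔ VanishesAt F := by
  constructor
  · intro h
    obtain ⟨R, hR⟩ := (h.isCompact.image continuous_snd).isBounded.exists_norm_le
    refine ⟨R, fun q p hp => ?_⟩
    by_contra hne
    exact absurd (hR p ⟨(q, p), subset_tsupport _ hne, rfl⟩) (by simpa using hp)
  · rintro ⟨R, hR⟩
    refine HasCompactSupport.intro (K := Set.univ ×ˢ Set.Icc (-R) R)
      (isCompact_univ.prod isCompact_Icc) ?_
    rintro ⟨q, p⟩ hx
    refine hR q p ?_
    by_contra! h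
    exact hx ⟨trivial, abs_le.1 h⟩

theorem VanishesAt.dq {F : Phase → ℝ} (h : VanishesAt F) : VanishesAt (dq F) := by
  obtain ⟨R, hR⟩ := h
  refine ⟨R, fun q p hp => ?_⟩
  simp [Langevin.dq, hR _ _ hp]

theorem VanishesAt.dp {F : Phase → ℝ} (h : VanishesAt F) : VanishesAt (dp F) := by
  obtain ⟨R, hR⟩ := h
  refine ⟨R, fun q p hp => ?_⟩
  have h1 : (fun y => F (q, y)) =ᶠ[nhds p] fun _ => 0 := by
    filter_upwards [(isOpen_lt continuous_const continuous_abs).mem_nhds hp] with y hy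
    exact hR q y hy
  simp [Langevin.dp, h1.deriv_eq]

theorem VanishesAt.mul_left {F : Phase → ℝ} (h : VanishesAt F) (F' : Phase → ℝ) :
    VanishesAt (fun x => F' x * F x) := by
  obtain ⟨R, hR⟩ := h
  exact ⟨R, fun q p hp => by simp [hR _ _ hp]⟩

theorem VanishesAt.add {F F' : Phase → ℝ} (h : VanishesAt F) (h' : VanishesAt F') :
    VanishesAt (fun x => F x + F' x) := by
  obtain ⟨R, hR⟩ := h
  obtain ⟨R', hR'⟩ := h'
  exact ⟨max R R', fun q p hp => by
    simp [hR _ _ ((le_max_left _ _).trans_lt hp), hR' _ _ ((le_max_right _ _).trans_lt hp)]⟩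

theorem VanishesAt.ham {F : Phase → ℝ} (h : VanishesAt F) : VanishesAt (ham F) := by
  have := (h.dq.mul_left (fun x => x.2)).add (h.dp.mul_left (fun x => -torusDeriv V x.1))
  convert this using 2 with x
  simp only [Langevin.ham]; ring

theorem VanishesAt.fd (β : ℝ) {F : Phase → ℝ} (h : VanishesAt F) : VanishesAt (fd β F) :=
  (h.dp.mul_left (fun x => -x.2)).add (h.dp.dp.mul_left (fun _ => β⁻¹))

theorem isTest_iff {F : Phase → ℝ} : IsTest F ↔ Smooth ⊤ F ∧ VanishesAt F :=
  ⟨fun h => ⟨h.1, hasCompactSupport_iff.1 h.2⟩, fun h => ⟨h.1, hasCompactSupport_iff.2 h.2⟩⟩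

theorem IsTest.smooth' {F : Phase → ℝ} (h : IsTest F) : Smooth ⊤ F := h.1

theorem IsTest.vanishes {F : Phase → ℝ} (h : IsTest F) : VanishesAt F := (isTest_iff.1 h).2

theorem IsTest.dq {F : Phase → ℝ} (h : IsTest F) : IsTest (dq F) :=
  isTest_iff.2 ⟨h.smooth'.dq (by simp), h.vanishes.dq⟩

theorem IsTest.dp {F : Phase → ℝ} (h : IsTest F) : IsTest (dp F) :=
  isTest_iff.2 ⟨h.smooth'.dp (by simp), h.vanishes.dp⟩

theorem IsTest.ham {F : Phase → ℝ} (h : IsTest F) : IsTest (ham F) :=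
  isTest_iff.2 ⟨h.smooth'.ham (by simp), h.vanishes.ham⟩

theorem IsTest.fd (β : ℝ) {F : Phase → ℝ} (h : IsTest F) : IsTest (fd β F) :=
  isTest_iff.2 ⟨h.smooth'.fd β (by simp), h.vanishes.fd β⟩

theorem IsTest.add {F F' : Phase → ℝ} (h : IsTest F) (h' : IsTest F') :
    IsTest (fun x => F x + F' x) :=
  isTest_iff.2 ⟨h.smooth'.add h'.smooth', h.vanishes.add h'.vanishes⟩

theorem IsTest.mul_left {F F' : Phase → ℝ} (h : IsTest F) (h' : Smooth ⊤ F') :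
    IsTest (fun x => F' x * F x) :=
  isTest_iff.2 ⟨h'.mul h.smooth', h.vanishes.mul_left F'⟩

theorem smooth_const (n : ℕ∞) (c : ℝ) : Smooth n (fun _ => c) := contDiff_const

theorem IsTest.const_mul {F : Phase → ℝ} (h : IsTest F) (c : ℝ) : IsTest (fun x => c * F x) :=
  h.mul_left (smooth_const ⊤ c)

theorem IsTest.gen (β γ : ℝ) {F : Phase → ℝ} (h : IsTest F) : IsTest (gen β γ F) :=
  h.ham.add ((h.fd β).const_mul γ)

theorem VanishesAt.integrable {F : Phase → ℝ} (h : VanishesAt F) (hc : Continuous F)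
    (m : Measure Phase) [IsFiniteMeasure m] : Integrable F m :=
  hc.integrable_of_hasCompactSupport (hasCompactSupport_iff.2 h)

theorem VanishesAt.memLp {F : Phase → ℝ} (h : VanishesAt F) (hc : Continuous F)
    (m : Measure Phase) [IsFiniteMeasure m] : MemLp F 2 m :=
  hc.memLp_of_hasCompactSupport (hasCompactSupport_iff.2 h)

theorem IsTest.memLp {F : Phase → ℝ} (h : IsTest F) (β : ℝ) : MemLp F 2 (mu β) :=
  h.vanishes.memLp h.smooth'.continuous _

theorem VanishesAt.hasCompactSupport_fiber {F : Phase → ℝ} (h : VanishesAt F) (q : Torus) :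
    HasCompactSupport (fun p => F (q, p)) := by
  obtain ⟨R, hR⟩ := h
  refine HasCompactSupport.intro (K := Set.Icc (-R) R) isCompact_Icc ?_
  intro p hx
  refine hR q p ?_
  by_contra! h
  exact hx (abs_le.1 h)

theorem ham_mul {F F' : Phase → ℝ} (h : Smooth 1 F) (h' : Smooth 1 F') :
    ham (fun x => F x * F' x) = fun x => ham F x * F' x + F x * ham F' x := by
  funext x
  obtain ⟨⟨x, y⟩, rfl⟩ := cover_surjective x
  have h1 : dq (fun x => F x * F' x) (cover (x, y)) = _ :=
    (dq_coe _ _ _).trans ((h.hasDerivAt_q le_rfl x y).mul (h'.hasDerivAt_q le_rfl x y)).deriv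
  have h2 : dp (fun x => F x * F' x) (cover (x, y)) = _ :=
    ((h.hasDerivAt_p le_rfl (x : Torus) y).mul (h'.hasDerivAt_p le_rfl (x : Torus) y)).deriv
  simp only [Langevin.ham, h1, h2]
  simp only [cover]
  ring

/-! ## Integration by parts -/

theorem Z_pos (β : ℝ) : 0 < Z β := by
  have hc : Continuous (fun q : Torus => Real.exp (-β * V q)) :=
    Real.continuous_exp.comp (continuous_const.mul continuous_V)
  unfold Z
  rw [← AddCircle.intervalIntegral_preimage (2 * π) 0]
  refine intervalIntegral.intervalIntegral_pos_of_pos ?_ (fun x => Real.exp_pos _)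
    (by simp [Real.pi_pos])
  exact (hc.comp (AddCircle.continuous_mk' (2 * π))).intervalIntegrable _ _

theorem integral_nu (β : ℝ) (h : Torus → ℝ) :
    ∫ q, h q ∂(nu β) =
      (Z β)⁻¹ * ∫ x in (0 : ℝ)..2 * π, h (x : Torus) * Real.exp (-β * V (x : Torus)) := by
  have := AddCircle.intervalIntegral_preimage (2 * π) 0
    (fun q : Torus => h q * Real.exp (-β * V q))
  rw [zero_add] at this
  rw [this, nu, integral_tilted, ← integral_const_mul]
  congr 1
  funext q
  simp only [Z, smul_eq_mul]
  ring

/-- The derivative of h exp(-βV) integrates to zero over a period, by periodicity. -/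
theorem integral_nu_deriv (β : ℝ) {h h' : Torus → ℝ} (hc : Continuous h')
    (hh : ∀ x : ℝ, HasDerivAt (fun y : ℝ => h (y : Torus)) (h' (x : Torus)) x) :
    ∫ q, h' q ∂(nu β) = β * ∫ q, sinMode 1 q * h q ∂(nu β) := by
  have hch : Continuous (fun y : ℝ => h (y : Torus)) :=
    continuous_iff_continuousAt.2 fun x => (hh x).continuousAt
  have hmk : Continuous (fun x : ℝ => (x : Torus)) := AddCircle.continuous_mk' (2 * π)
  have hV := continuous_V.comp hmk
  have hs := (continuous_sinMode 1).comp hmk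
  have hc' := hc.comp hmk
  have i1 : Continuous (fun x : ℝ => h' (x : Torus) * Real.exp (-β * V (x : Torus))) :=
    hc'.mul (continuous_const.mul hV).rexp
  have i2 : Continuous (fun x : ℝ => β * (sinMode 1 (x : Torus) * h (x : Torus) *
      Real.exp (-β * V (x : Torus)))) :=
    continuous_const.mul ((hs.mul hch).mul (continuous_const.mul hV).rexp)
  have key : ∫ x in (0 : ℝ)..2 * π, (h' (x : Torus) * Real.exp (-β * V (x : Torus)) -
      β * (sinMode 1 (x : Torus) * h (x : Torus) * Real.exp (-β * V (x : Torus)))) = 0 := by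
    have := intervalIntegral.integral_eq_sub_of_hasDerivAt (a := 0) (b := 2 * π)
      (f := fun x : ℝ => h (x : Torus) * Real.exp (-β * V (x : Torus)))
      (f' := fun x : ℝ => h' (x : Torus) * Real.exp (-β * V (x : Torus)) -
      β * (sinMode 1 (x : Torus) * h (x : Torus) * Real.exp (-β * V (x : Torus))))
      (fun x _ => ((hh x).mul (((hasDerivAt_V x).const_mul (-β)).exp)).congr_deriv (by ring))
      ((i1.sub i2).intervalIntegrable _ _)
    rw [this]
    simp [AddCircle.coe_period]
  rw [intervalIntegral.integral_sub (i1.intervalIntegrable _ _)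
    (i2.intervalIntegrable _ _), intervalIntegral.integral_const_mul] at key
  rw [integral_nu, integral_nu]
  linear_combination (Z β)⁻¹ * key

theorem var_ne_zero {β : ℝ} (hβ : 0 < β) : (β⁻¹).toNNReal ≠ 0 := by
  simp [hβ]

theorem hasDerivAt_gaussianPDFReal {β : ℝ} (hβ : 0 < β) (p : ℝ) :
    HasDerivAt (gaussianPDFReal 0 (β⁻¹).toNNReal)
      (-β * p * gaussianPDFReal 0 (β⁻¹).toNNReal p) p := by
  unfold gaussianPDFReal
  have h0 : (((β⁻¹).toNNReal : NNReal) : ℝ) = β⁻¹ := Real.coe_toNNReal _ (by positivity)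
  rw [h0]
  have h1 : HasDerivAt (fun x : ℝ => -(x - 0) ^ 2 / (2 * β⁻¹)) (-β * p) p := by
    have := (((hasDerivAt_id p).sub_const 0).pow 2).neg.div_const (2 * β⁻¹)
    refine this.congr_deriv ?_
    simp
    field_simp
  exact (h1.exp.const_mul _).congr_deriv (by ring)

theorem integrable_kappa_iff {β : ℝ} (hβ : 0 < β) (h : ℝ → ℝ) :
    Integrable h (kappa β) ↔
      Integrable (fun p => gaussianPDFReal 0 (β⁻¹).toNNReal p * h p) := by
  rw [kappa, gaussianReal_of_var_ne_zero _ (var_ne_zero hβ),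
    integrable_withDensity_iff_integrable_smul' (measurable_gaussianPDF _ _)
      (Filter.Eventually.of_forall fun x => gaussianPDF_lt_top)]
  simp [toReal_gaussianPDF]

/-- An integrable function with integrable derivative has a derivative of integral zero; here it is
h times the Gaussian density, whose logarithmic derivative is -βp. -/
theorem integral_kappa_deriv {β : ℝ} (hβ : 0 < β) {h h' : ℝ → ℝ}
    (hh : ∀ p, HasDerivAt h (h' p) p) (h1 : Integrable h (kappa β))
    (h2 : Integrable h' (kappa β)) (h3 : Integrable (fun p => p * h p) (kappa β)) :
    ∫ p, h' p ∂(kappa β) = β * ∫ p, p * h p ∂(kappa β) := by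
  rw [integrable_kappa_iff hβ] at h1 h2 h3
  have := integral_eq_zero_of_hasDerivAt_of_integrable
    (f := fun p => gaussianPDFReal 0 (β⁻¹).toNNReal p * h p)
    (f' := fun p => gaussianPDFReal 0 (β⁻¹).toNNReal p * h' p -
      β * (gaussianPDFReal 0 (β⁻¹).toNNReal p * (p * h p)))
    (fun p => ((hasDerivAt_gaussianPDFReal hβ p).mul (hh p)).congr_deriv (by ring))
    (h2.sub (h3.const_mul β)) h1
  rw [integral_sub h2 (h3.const_mul β), integral_const_mul] at this
  rw [kappa, integral_gaussianReal_eq_integral_smul (var_ne_zero hβ),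
    integral_gaussianReal_eq_integral_smul (var_ne_zero hβ)]
  simp only [smul_eq_mul]
  linarith

theorem integral_kappa_dp {β : ℝ} (hβ : 0 < β) {F : Phase → ℝ} (h : Smooth 1 F)
    (hv : VanishesAt F) (q : Torus) :
    ∫ p, dp F (q, p) ∂(kappa β) = β * ∫ p, p * F (q, p) ∂(kappa β) := by
  have hc := h.continuous
  have hc' : Continuous (dp F) := (h.dp (m := 0) (by simp)).continuous
  have e (p : ℝ) : Continuous (fun p : ℝ => (q, p)) := by fun_prop
  refine integral_kappa_deriv hβ (fun p => h.hasDerivAt_p le_rfl q p) ?_ ?_ ?_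
  · exact Continuous.integrable_of_hasCompactSupport (by fun_prop) (hv.hasCompactSupport_fiber q)
  · exact Continuous.integrable_of_hasCompactSupport (by fun_prop)
      (hv.dp.hasCompactSupport_fiber q)
  · exact Continuous.integrable_of_hasCompactSupport (by fun_prop)
      ((hv.mul_left (fun x => x.2)).hasCompactSupport_fiber q)

theorem integral_nu_dq (β : ℝ) {F : Phase → ℝ} (h : Smooth 1 F) (p : ℝ) :
    ∫ q, dq F (q, p) ∂(nu β) = β * ∫ q, sinMode 1 q * F (q, p) ∂(nu β) := by
  have hc : Continuous (dq F) := (h.dq (m := 0) (by simp)).continuous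
  exact integral_nu_deriv β (h := fun q => F (q, p)) (h' := fun q => dq F (q, p)) (by fun_prop)
    (fun x => h.hasDerivAt_q le_rfl x p)

/-- Invariance of μ: integrating p ∂_q by parts in q and V' ∂_p by parts in p produces the same
integral β ∫ p V' F, with opposite signs. -/
theorem integral_ham_eq_zero {β : ℝ} (hβ : 0 < β) {F : Phase → ℝ} (h : Smooth 1 F)
    (hv : VanishesAt F) : ∫ x, ham F x ∂(mu β) = 0 := by
  have hc := h.continuous
  have hq : Continuous (dq F) := (h.dq (m := 0) (by simp)).continuous
  have hp : Continuous (dp F) := (h.dp (m := 0) (by simp)).continuous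
  have hs := continuous_sinMode 1
  have i1 : Integrable (fun x : Phase => x.2 * dq F x) ((nu β).prod (kappa β)) :=
    (hv.dq.mul_left fun x => x.2).integrable (by fun_prop) _
  have i2 : Integrable (fun x : Phase => sinMode 1 x.1 * dp F x) ((nu β).prod (kappa β)) :=
    (hv.dp.mul_left fun x => sinMode 1 x.1).integrable (by fun_prop) _
  have i3 : Integrable (fun x : Phase => x.2 * (sinMode 1 x.1 * F x)) ((nu β).prod (kappa β)) :=
    ((hv.mul_left fun x => sinMode 1 x.1).mul_left fun x => x.2).integrable (by fun_prop) _
  simp only [ham, torusDeriv_V, mu]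
  rw [integral_sub i1 i2, integral_prod_symm _ i1, integral_prod _ i2]
  have e1 : ∀ y : ℝ, ∫ q, y * dq F (q, y) ∂(nu β) =
      β * ∫ q, y * (sinMode 1 q * F (q, y)) ∂(nu β) := by
    intro y
    rw [integral_const_mul, integral_const_mul, integral_nu_dq β h]
    ring
  have e2 : ∀ q : Torus, ∫ p, sinMode 1 q * dp F (q, p) ∂(kappa β) =
      β * ∫ p, p * (sinMode 1 q * F (q, p)) ∂(kappa β) := by
    intro q
    rw [integral_const_mul, integral_kappa_dp hβ h hv, ← integral_const_mul, ← integral_const_mul,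
      ← integral_const_mul]
    congr 1; funext p; ring
  simp only [e1, e2]
  rw [integral_const_mul, integral_const_mul, ← integral_prod_symm _ i3, ← integral_prod _ i3,
    sub_self]

/-! ## Averages over the momenta -/

/-- The average of `F` over the momenta. -/
def avg (β : ℝ) (F : Phase → ℝ) (q : Torus) : ℝ := ∫ p, F (q, p) ∂(kappa β)

theorem hasDerivAt_avg (β : ℝ) {F : Phase → ℝ} (hF : IsTest F) (x : ℝ) :
    HasDerivAt (fun y : ℝ => avg β F (y : Torus)) (avg β (dq F) (x : Torus)) x := by
  obtain ⟨C, hC⟩ := hF.dq.compact.exists_bound_of_continuous hF.dq.smooth'.continuous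
  have hc := hF.smooth'.continuous
  have hc' := hF.dq.smooth'.continuous
  refine (hasDerivAt_integral_of_dominated_loc_of_deriv_le (bound := fun _ => C)
    (F := fun (y : ℝ) p => F ((y : Torus), p)) (F' := fun (y : ℝ) p => dq F ((y : Torus), p))
    Filter.univ_mem ?_ ?_ ?_ ?_ (integrable_const C) ?_).2
  · refine Filter.Eventually.of_forall fun y => Continuous.aestronglyMeasurable ?_
    fun_prop
  · exact Continuous.integrable_of_hasCompactSupport (by fun_prop)
      (hF.vanishes.hasCompactSupport_fiber _)
  · exact Continuous.aestronglyMeasurable (by fun_prop)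
  · exact Filter.Eventually.of_forall fun p y _ => hC _
  · exact Filter.Eventually.of_forall fun p y _ => hF.smooth'.hasDerivAt_q le_top y p

/-- The derivative of the average is the average of `dq F`, which is again a test function; hence
the induction. -/
theorem contDiff_avg (β : ℝ) {F : Phase → ℝ} (hF : IsTest F) :
    ContDiff ℝ ∞ (fun y : ℝ => avg β F (y : Torus)) := by
  rw [contDiff_infty]
  intro n
  induction n generalizing F with
  | zero =>
    exact contDiff_zero.2 (continuous_iff_continuousAt.2 fun x => (hasDerivAt_avg β hF x).continuousAt)
  | succ n ih =>
    have h1 : deriv (fun y : ℝ => avg β F (y : Torus)) = fun y : ℝ => avg β (dq F) (y : Torus) :=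
      funext fun x => (hasDerivAt_avg β hF x).deriv
    push_cast
    rw [contDiff_succ_iff_deriv, h1]
    exact ⟨fun x => (hasDerivAt_avg β hF x).differentiableAt, by simp, ih hF.dq⟩

theorem continuous_torus {h : Torus → ℝ} (hh : Continuous fun x : ℝ => h (x : Torus)) :
    Continuous h :=
  (QuotientAddGroup.isOpenQuotientMap_mk (G := ℝ)).isQuotientMap.continuous_iff.2 hh

/-- The average over the momenta of a test function. -/
def avgC (β : ℝ) {F : Phase → ℝ} (hF : IsTest F) : C(Torus, ℝ) :=
  ⟨avg β F, continuous_torus (contDiff_avg β hF).continuous⟩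

/-- `η'` is the derivative of `η`. -/
def HasD (η η' : C(Torus, ℝ)) : Prop :=
  ∀ x : ℝ, HasDerivAt (fun y : ℝ => η (y : Torus)) (η' (x : Torus)) x

theorem hasD_avgC (β : ℝ) {F : Phase → ℝ} (hF : IsTest F) : HasD (avgC β hF) (avgC β hF.dq) :=
  fun x => hasDerivAt_avg β hF x

theorem HasD.add {η η' ξ ξ' : C(Torus, ℝ)} (h : HasD η η') (h' : HasD ξ ξ') :
    HasD (η + ξ) (η' + ξ') := fun x => (h x).add (h' x)

theorem HasD.sub {η η' ξ ξ' : C(Torus, ℝ)} (h : HasD η η') (h' : HasD ξ ξ') :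
    HasD (η - ξ) (η' - ξ') := fun x => (h x).sub (h' x)

theorem HasD.smul {η η' : C(Torus, ℝ)} (c : ℝ) (h : HasD η η') :
    HasD (c • η) (c • η') := fun x => (h x).const_mul c

theorem hasD_const (c : ℝ) : HasD (ContinuousMap.const Torus c) 0 :=
  fun x => hasDerivAt_const x c

theorem HasD.smooth {η η' : C(Torus, ℝ)} (h : HasD η η') :
    ContDiff ℝ 1 (fun x : ℝ => η (x : Torus)) := by
  have h1 : deriv (fun x : ℝ => η (x : Torus)) = fun x : ℝ => η' (x : Torus) :=
    funext fun x => (h x).deriv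
  rw [contDiff_one_iff_deriv, h1]
  exact ⟨fun x => (h x).differentiableAt, η'.continuous.comp (AddCircle.continuous_mk' (2 * π))⟩

/-- `V'` as a continuous function. -/
def dV : C(Torus, ℝ) := ⟨sinMode 1, continuous_sinMode 1⟩

@[simp] theorem dV_apply (q : Torus) : dV q = sinMode 1 q := rfl

/-! ## Gaussian moments -/

/-- The Gaussian expectation of a polynomial. -/
def gE (β : ℝ) (P : Polynomial ℝ) : ℝ := ∫ p, P.eval p ∂(kappa β)

theorem gE_add (β : ℝ) (P Q : Polynomial ℝ) : gE β (P + Q) = gE β P + gE β Q := by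
  simp only [gE, Polynomial.eval_add]
  exact integral_add (integrable_polynomial_kappa β P) (integrable_polynomial_kappa β Q)

theorem gE_sub (β : ℝ) (P Q : Polynomial ℝ) : gE β (P - Q) = gE β P - gE β Q := by
  simp only [gE, Polynomial.eval_sub]
  exact integral_sub (integrable_polynomial_kappa β P) (integrable_polynomial_kappa β Q)

theorem gE_smul (β c : ℝ) (P : Polynomial ℝ) : gE β (c • P) = c * gE β P := by
  simp only [gE, Polynomial.eval_smul, smul_eq_mul]
  exact integral_const_mul _ _

theorem gE_one (β : ℝ) : gE β 1 = 1 := by simp [gE]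

theorem gE_derivative {β : ℝ} (hβ : 0 < β) (P : Polynomial ℝ) :
    gE β P.derivative = β * gE β (Polynomial.X * P) := by
  have h3 := integrable_polynomial_kappa β (Polynomial.X * P)
  simp only [Polynomial.eval_mul, Polynomial.eval_X] at h3
  have := integral_kappa_deriv hβ (fun p => P.hasDerivAt p) (integrable_polynomial_kappa β P)
    (integrable_polynomial_kappa β _) h3
  simpa [gE] using this

theorem gE_X {β : ℝ} (hβ : 0 < β) : gE β Polynomial.X = 0 := by
  have := gE_derivative hβ 1
  simp only [Polynomial.derivative_one, mul_one] at this
  have h0 : gE β 0 = 0 := by simp [gE]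
  rw [h0] at this
  simpa [hβ.ne'] using this.symm

theorem gE_X_mul_X {β : ℝ} (hβ : 0 < β) : gE β (Polynomial.X * Polynomial.X) = β⁻¹ := by
  have := gE_derivative hβ Polynomial.X
  rw [Polynomial.derivative_X, gE_one] at this
  field_simp
  linarith

/-! ## Hermite polynomials -/

/-- The normalized Hermite polynomials. -/
def hpoly (β : ℝ) (l : ℕ) : Polynomial ℝ :=
  (√(Nat.factorial l : ℝ))⁻¹ •
    (((Polynomial.hermite l).map (Int.castRingHom ℝ)).comp (√β • Polynomial.X))

theorem H_eq_hpoly (β : ℝ) (l : ℕ) : H β l = fun p => (hpoly β l).eval p := by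
  funext p
  simp [H, hpoly, Polynomial.aeval_def, Polynomial.eval₂_eq_eval_map, div_eq_inv_mul]

theorem derivative_hermite_succ (n : ℕ) :
    (Polynomial.hermite (n + 1)).derivative = (n + 1 : ℕ) • Polynomial.hermite n := by
  induction n with
  | zero => simp
  | succ n ih =>
    have h1 := Polynomial.hermite_succ (n + 1)
    have h2 := Polynomial.hermite_succ n
    rw [h1, Polynomial.derivative_sub, Polynomial.derivative_mul, ih, Polynomial.derivative_X]
    rw [Polynomial.derivative_smul, succ_nsmul (Polynomial.hermite (n + 1)) (n + 1)]
    simp only [nsmul_eq_mul]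
    push_cast
    linear_combination (-(n + 1 : Polynomial ℤ)) * h2

theorem hpoly_zero (β : ℝ) : hpoly β 0 = 1 := by
  simp [hpoly]

/-- The creation operator. Together with the annihilation operator of `derivative_hpoly_succ`, it
gives multiplication by p and L_FD in the Hermite basis. -/
theorem hpoly_succ {β : ℝ} (hβ : 0 < β) (l : ℕ) :
    √(l + 1 : ℝ) • hpoly β (l + 1) =
      √β • (Polynomial.X * hpoly β l) - (√β)⁻¹ • (hpoly β l).derivative := by
  have hb : √β ≠ 0 := (Real.sqrt_pos.2 hβ).ne'
  have hl : √(l + 1 : ℝ) ≠ 0 := (Real.sqrt_pos.2 (by positivity)).ne'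
  have hf : √(Nat.factorial l : ℝ) ≠ 0 := (Real.sqrt_pos.2 (by positivity)).ne'
  have h2 : √(Nat.factorial (l + 1) : ℝ) = √(l + 1 : ℝ) * √(Nat.factorial l : ℝ) := by
    rw [Nat.factorial_succ, ← Real.sqrt_mul (by positivity)]
    push_cast; rfl
  unfold hpoly
  rw [Polynomial.hermite_succ, h2, Polynomial.derivative_smul, Polynomial.derivative_comp,
    Polynomial.derivative_map]
  apply Polynomial.funext
  intro p
  simp
  field_simp

theorem derivative_hpoly_succ {β : ℝ} (l : ℕ) :
    (hpoly β (l + 1)).derivative = (√β * √(l + 1 : ℝ)) • hpoly β l := by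
  have hl : √(l + 1 : ℝ) ≠ 0 := (Real.sqrt_pos.2 (by positivity)).ne'
  have hf : √(Nat.factorial l : ℝ) ≠ 0 := (Real.sqrt_pos.2 (by positivity)).ne'
  have h2 : √(Nat.factorial (l + 1) : ℝ) = √(l + 1 : ℝ) * √(Nat.factorial l : ℝ) := by
    rw [Nat.factorial_succ, ← Real.sqrt_mul (by positivity)]
    push_cast; rfl
  have h3 : √(l + 1 : ℝ) ^ 2 = l + 1 := Real.sq_sqrt (by positivity)
  unfold hpoly
  rw [h2, Polynomial.derivative_smul, Polynomial.derivative_comp, Polynomial.derivative_map,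
    derivative_hermite_succ]
  apply Polynomial.funext
  intro p
  simp
  field_simp
  rw [h3]

theorem derivative_hpoly_zero (β : ℝ) : (hpoly β 0).derivative = 0 := by
  simp [hpoly_zero]

/-- Creation is adjoint to differentiation in L²(κ), up to the factor 1/√β. Lowering both indices in
this way proves orthonormality. -/
theorem gE_hpoly_succ_mul {β : ℝ} (hβ : 0 < β) (l : ℕ) (Q : Polynomial ℝ) :
    √(l + 1 : ℝ) * gE β (hpoly β (l + 1) * Q) = (√β)⁻¹ * gE β (hpoly β l * Q.derivative) := by
  have hb : √β ≠ 0 := (Real.sqrt_pos.2 hβ).ne'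
  have hb2 : √β * √β = β := Real.mul_self_sqrt hβ.le
  have h1 := congrArg (fun P => gE β (P * Q)) (hpoly_succ hβ l)
  simp only [sub_mul, smul_mul_assoc, gE_sub, gE_smul] at h1
  have h2 := gE_derivative hβ (hpoly β l * Q)
  rw [Polynomial.derivative_mul, gE_add] at h2
  rw [h1, mul_assoc]
  have h3 : gE β (Polynomial.X * (hpoly β l * Q)) = (√β)⁻¹ * ((√β)⁻¹ *
      (gE β ((hpoly β l).derivative * Q) + gE β (hpoly β l * Q.derivative))) := by
    rw [h2]
    field_simp
    rw [pow_two, hb2]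
  rw [h3]
  field_simp
  ring

theorem gE_hpoly_mul {β : ℝ} (hβ : 0 < β) (l m : ℕ) :
    gE β (hpoly β l * hpoly β m) = if l = m then 1 else 0 := by
  have hb : √β ≠ 0 := (Real.sqrt_pos.2 hβ).ne'
  have hl (l : ℕ) : √(l + 1 : ℝ) ≠ 0 := (Real.sqrt_pos.2 (by positivity)).ne'
  have h0 (l : ℕ) : gE β (hpoly β (l + 1) * hpoly β 0) = 0 := by
    have := gE_hpoly_succ_mul hβ l (hpoly β 0)
    rw [derivative_hpoly_zero, mul_zero] at this
    have h0 : gE β 0 = 0 := by simp [gE]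
    rw [h0, mul_zero] at this
    exact (mul_eq_zero.1 this).resolve_left (hl l)
  induction l generalizing m with
  | zero =>
    cases m with
    | zero => simp [hpoly_zero, gE_one]
    | succ m => rw [mul_comm, h0]; simp
  | succ l ih =>
    cases m with
    | zero => rw [h0]; simp
    | succ m =>
      have := gE_hpoly_succ_mul hβ l (hpoly β (m + 1))
      rw [derivative_hpoly_succ, mul_smul_comm, gE_smul, ih] at this
      simp only [add_left_inj]
      split_ifs at this ⊢ with h
      · subst h
        refine mul_left_cancel₀ (hl l) (this.trans ?_)
        field_simp
      · simpa [hl l] using this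

theorem hpoly_one {β : ℝ} (hβ : 0 < β) : hpoly β 1 = √β • Polynomial.X := by
  have := hpoly_succ hβ 0
  simpa [hpoly_zero] using this

theorem gE_X_mul_hpoly {β : ℝ} (hβ : 0 < β) (l : ℕ) :
    gE β (Polynomial.X * hpoly β l) = if l = 1 then (√β)⁻¹ else 0 := by
  have hb : √β ≠ 0 := (Real.sqrt_pos.2 hβ).ne'
  have h := gE_hpoly_mul hβ 1 l
  rw [hpoly_one hβ, smul_mul_assoc, gE_smul] at h
  by_cases hl : l = 1
  · simp only [hl, if_true] at h ⊢; field_simp; linarith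
  · rw [if_neg (Ne.symm hl)] at h
    simpa [hl, hb] using h

/-! ## Tensor products -/

/-- The function `η(q) P(p)` in `L²(μ)`. -/
def tv (β : ℝ) (η : C(Torus, ℝ)) (P : Polynomial ℝ) : L2 β :=
  (memLp_tensor β η.continuous P).toLp _

theorem tv_coe (β : ℝ) (η : C(Torus, ℝ)) (P : Polynomial ℝ) :
    tv β η P =ᵐ[mu β] fun x => η x.1 * P.eval x.2 := MemLp.coeFn_toLp _

theorem toLp_eq_iff {β : ℝ} {F F' : Phase → ℝ} (h : MemLp F 2 (mu β)) (h' : MemLp F' 2 (mu β))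
    (e : ∀ x, F x = F' x) : h.toLp F = h'.toLp F' := by
  congr 1; funext x; exact e x

theorem tv_add_left (β : ℝ) (η ξ : C(Torus, ℝ)) (P : Polynomial ℝ) :
    tv β (η + ξ) P = tv β η P + tv β ξ P := by
  unfold tv
  rw [← MemLp.toLp_add]
  exact toLp_eq_iff _ _ fun x => by simp; ring

theorem tv_add_right (β : ℝ) (η : C(Torus, ℝ)) (P Q : Polynomial ℝ) :
    tv β η (P + Q) = tv β η P + tv β η Q := by
  unfold tv
  rw [← MemLp.toLp_add]
  exact toLp_eq_iff _ _ fun x => by simp; ring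

theorem tv_smul_left (β c : ℝ) (η : C(Torus, ℝ)) (P : Polynomial ℝ) :
    tv β (c • η) P = c • tv β η P := by
  unfold tv
  rw [← MemLp.toLp_const_smul]
  exact toLp_eq_iff _ _ fun x => by simp; ring

theorem tv_smul_right (β c : ℝ) (η : C(Torus, ℝ)) (P : Polynomial ℝ) :
    tv β η (c • P) = c • tv β η P := by
  unfold tv
  rw [← MemLp.toLp_const_smul]
  exact toLp_eq_iff _ _ fun x => by simp; ring

theorem tv_sub_left (β : ℝ) (η ξ : C(Torus, ℝ)) (P : Polynomial ℝ) :
    tv β (η - ξ) P = tv β η P - tv β ξ P := by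
  unfold tv
  rw [← MemLp.toLp_sub]
  exact toLp_eq_iff _ _ fun x => by simp; ring

theorem tv_zero_left (β : ℝ) (P : Polynomial ℝ) : tv β 0 P = 0 := by
  simpa using tv_smul_left β 0 0 P

theorem tv_zero_right (β : ℝ) (η : C(Torus, ℝ)) : tv β η 0 = 0 := by
  simpa using tv_smul_right β 0 η 0

theorem tv_neg_left (β : ℝ) (η : C(Torus, ℝ)) (P : Polynomial ℝ) : tv β (-η) P = -tv β η P := by
  simpa using tv_smul_left β (-1) η P

theorem inner_toLp {β : ℝ} {F F' : Phase → ℝ} (h : MemLp F 2 (mu β)) (h' : MemLp F' 2 (mu β)) :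
    ⟪h.toLp F, h'.toLp F'⟫_ℝ = ∫ x, F x * F' x ∂(mu β) := by
  rw [L2.inner_def]
  refine integral_congr_ae ?_
  filter_upwards [h.coeFn_toLp, h'.coeFn_toLp] with x hx hx'
  simp [hx, hx', mul_comm]

/-- The scalar product of `L²(ν)` for continuous functions. -/
def nuIn (β : ℝ) (η ξ : C(Torus, ℝ)) : ℝ := ∫ q, η q * ξ q ∂(nu β)

theorem inner_tv (β : ℝ) (η ξ : C(Torus, ℝ)) (P Q : Polynomial ℝ) :
    ⟪tv β η P, tv β ξ Q⟫_ℝ = nuIn β η ξ * gE β (P * Q) := by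
  unfold tv
  rw [inner_toLp, nuIn, gE, mu, ← integral_prod_mul]
  congr 1; funext x; simp; ring

theorem one_eq_tv (β : ℝ) : one β = tv β 1 1 := by
  refine Lp.ext ((Lp.coeFn_const _ _ _).trans ?_)
  filter_upwards [tv_coe β 1 1] with x hx
  simp [hx]

theorem norm_one (β : ℝ) : ‖one β‖ = 1 := by
  have h : ‖one β‖ ^ 2 = 1 := by
    rw [← real_inner_self_eq_norm_sq, one_eq_tv, inner_tv, mul_one, gE_one, nuIn]
    simp
  nlinarith [norm_nonneg (one β)]

theorem tv_one_eq_posEmb (β : ℝ) (η : C(Torus, ℝ)) :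
    tv β η 1 = posEmb β (ContinuousMap.toLp (E := ℝ) 2 (nu β) ℝ η) := by
  have h1 : posEmb β (ContinuousMap.toLp (E := ℝ) 2 (nu β) ℝ η) =ᵐ[mu β]
      (ContinuousMap.toLp (E := ℝ) 2 (nu β) ℝ η : Torus → ℝ) ∘ Prod.fst :=
    Lp.coeFn_compMeasurePreserving _ (measurePreserving_fst (μ := nu β) (ν := kappa β))
  have h2 := (measurePreserving_fst (μ := nu β) (ν := kappa β)).quasiMeasurePreserving.ae_eq_comp
    (ContinuousMap.coeFn_toLp (E := ℝ) (p := 2) (nu β) (𝕜 := ℝ) η)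
  refine Lp.ext ?_
  filter_upwards [h1, tv_coe β η 1, h2] with x hx1 hx2 hx3
  rw [hx1, hx2, hx3]
  simp

/-! ### The projector onto functions of the position as an average over momenta -/

theorem inner_posEmb {β : ℝ} (v : L2nu β) {F : Phase → ℝ} (h : MemLp F 2 (mu β)) :
    ⟪posEmb β v, h.toLp F⟫_ℝ = ∫ q, v q * avg β F q ∂(nu β) := by
  have h1 : posEmb β v =ᵐ[mu β] (v : Torus → ℝ) ∘ Prod.fst :=
    Lp.coeFn_compMeasurePreserving _ (measurePreserving_fst (μ := nu β) (ν := kappa β))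
  have hv : MemLp ((v : Torus → ℝ) ∘ Prod.fst) 2 (mu β) :=
    (Lp.memLp v).comp_measurePreserving (measurePreserving_fst (μ := nu β) (ν := kappa β))
  have h2 : posEmb β v = hv.toLp _ := by
    refine Lp.ext (h1.trans hv.coeFn_toLp.symm)
  rw [h2, inner_toLp]
  have hi : Integrable (fun x => ((v : Torus → ℝ) ∘ Prod.fst) x * F x)
    ((nu β).prod (kappa β)) := hv.integrable_mul h
  rw [mu, integral_prod _ hi]
  simp only [Function.comp, avg, integral_const_mul]

/-- `PiP` is built from an abstract adjoint; testing against functions of the position is how it is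
identified with concrete averages. -/
theorem PiP_eq_of (β : ℝ) {x y : L2 β} (v : L2nu β) (hy : y = posEmb β v)
    (h : ∀ w : L2nu β, ⟪posEmb β w, x⟫_ℝ = ⟪posEmb β w, y⟫_ℝ) : PiP β x = y := by
  have : ContinuousLinearMap.adjoint (posEmb β).toContinuousLinearMap x = v := by
    refine ext_inner_left ℝ fun w => ?_
    rw [ContinuousLinearMap.adjoint_inner_right]
    refine (h w).trans ?_
    rw [hy]
    exact (posEmb β).inner_map_map w v
  rw [hy]
  show posEmb β (ContinuousLinearMap.adjoint (posEmb β).toContinuousLinearMap x) = _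
  rw [this]

theorem PiP_toLp {β : ℝ} {F : Phase → ℝ} (h : MemLp F 2 (mu β)) (a : C(Torus, ℝ))
    (ha : ∀ q, avg β F q = a q) : PiP β (h.toLp F) = tv β a 1 := by
  refine PiP_eq_of β _ (tv_one_eq_posEmb β a) fun w => ?_
  rw [tv, inner_posEmb, inner_posEmb]
  congr 1; funext q
  rw [ha]
  simp [avg]

theorem PiP_tv (β : ℝ) (η : C(Torus, ℝ)) (P : Polynomial ℝ) :
    PiP β (tv β η P) = gE β P • tv β η 1 := by
  rw [← tv_smul_left]
  refine PiP_toLp _ _ fun q => ?_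
  simp only [avg, gE, integral_const_mul, ContinuousMap.smul_apply, smul_eq_mul]
  ring

theorem inner_PiP_left (β : ℝ) (x y : L2 β) : ⟪PiP β x, y⟫_ℝ = ⟪x, PiP β y⟫_ℝ := by
  show ⟪posEmb β (ContinuousLinearMap.adjoint (posEmb β).toContinuousLinearMap x), y⟫_ℝ =
    ⟪x, posEmb β (ContinuousLinearMap.adjoint (posEmb β).toContinuousLinearMap y)⟫_ℝ
  have h1 := ContinuousLinearMap.adjoint_inner_right (posEmb β).toContinuousLinearMap
    (ContinuousLinearMap.adjoint (posEmb β).toContinuousLinearMap x) y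
  have h2 := ContinuousLinearMap.adjoint_inner_left (posEmb β).toContinuousLinearMap
    (ContinuousLinearMap.adjoint (posEmb β).toContinuousLinearMap y) x
  exact h1.symm.trans h2

theorem PiP_posEmb (β : ℝ) (v : L2nu β) : PiP β (posEmb β v) = posEmb β v :=
  PiP_eq_of β v rfl fun _ => rfl

theorem PiP_PiP (β : ℝ) (x : L2 β) : PiP β (PiP β x) = PiP β x := PiP_posEmb β _

theorem PiP_tv_one (β : ℝ) (η : C(Torus, ℝ)) : PiP β (tv β η 1) = tv β η 1 := by
  rw [PiP_tv, gE_one, one_smul]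

theorem norm_tv_one_sq (β : ℝ) (η : C(Torus, ℝ)) : ‖tv β η 1‖ ^ 2 = nuIn β η η := by
  rw [← real_inner_self_eq_norm_sq, inner_tv, mul_one, gE_one, mul_one]

theorem norm_tv (β : ℝ) (η : C(Torus, ℝ)) (P : Polynomial ℝ) :
    ‖tv β η P‖ = √(gE β (P * P)) * ‖tv β η 1‖ := by
  have h0 : 0 ≤ gE β (P * P) := by
    refine integral_nonneg fun p => ?_
    simp only [Polynomial.eval_mul]
    exact mul_self_nonneg _
  rw [← Real.sqrt_sq (norm_nonneg (tv β η P)), ← Real.sqrt_sq (norm_nonneg (tv β η 1)),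
    ← Real.sqrt_mul h0, norm_tv_one_sq, ← real_inner_self_eq_norm_sq, inner_tv, mul_comm]

theorem norm_tv_mul_le (β : ℝ) (ξ η : C(Torus, ℝ)) (P : Polynomial ℝ) (hξ : ∀ q, |ξ q| ≤ 1) :
    ‖tv β (ξ * η) P‖ ≤ ‖tv β η P‖ := by
  rw [norm_tv β (ξ * η), norm_tv β η P]
  refine mul_le_mul_of_nonneg_left ?_ (Real.sqrt_nonneg _)
  refine Lp.norm_le_norm_of_ae_le ?_
  filter_upwards [tv_coe β (ξ * η) 1, tv_coe β η 1] with x h1 h2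
  rw [h1, h2]
  simp only [ContinuousMap.mul_apply, Polynomial.eval_one, mul_one, norm_mul, Real.norm_eq_abs]
  exact mul_le_of_le_one_left (abs_nonneg _) (hξ x.1)

/-! ## The generator on tensor products -/

theorem contDiff_eval {n : WithTop ℕ∞} (P : Polynomial ℝ) : ContDiff ℝ n (fun p => P.eval p) := by
  simpa using P.contDiff_aeval (𝕜 := ℝ) n

theorem memLp_add_fun {α : Type*} [MeasurableSpace α] {m : Measure α} {f g : α → ℝ}
    (hf : MemLp f 2 m) (hg : MemLp g 2 m) : MemLp (fun x => f x + g x) 2 m := hf.add hg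

theorem torusDeriv_of_hasD {η η' : C(Torus, ℝ)} (h : HasD η η') : torusDeriv η = η' :=
  torusDeriv_of_hasDerivAt h

theorem dq_tensor {η η' : C(Torus, ℝ)} (h : HasD η η') (u : ℝ → ℝ) :
    dq (fun x => η x.1 * u x.2) = fun x => η' x.1 * u x.2 := by
  funext x
  have := congrFun (torusDeriv_of_hasD h) x.1
  simp only [torusDeriv] at this
  simp only [dq, deriv_mul_const_field, this]

theorem dp_tensor (η : C(Torus, ℝ)) {u u' : ℝ → ℝ} (h : ∀ p, HasDerivAt u (u' p) p) :
    dp (fun x => η x.1 * u x.2) = fun x => η x.1 * u' x.2 := by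
  funext x
  exact ((h x.2).const_mul (η x.1)).deriv

theorem gen_tensor (β γ : ℝ) {η η' : C(Torus, ℝ)} (h : HasD η η') {u u' u'' : ℝ → ℝ}
    (hu : ∀ p, HasDerivAt u (u' p) p) (hu' : ∀ p, HasDerivAt u' (u'' p) p) :
    gen β γ (fun x => η x.1 * u x.2) = fun x => η' x.1 * (x.2 * u x.2) -
      (dV * η) x.1 * u' x.2 + γ * (η x.1 * (-x.2 * u' x.2 + β⁻¹ * u'' x.2)) := by
  funext x
  simp only [gen, ham, fd, dq_tensor h, dp_tensor η hu, dp_tensor η hu', torusDeriv_V,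
    ContinuousMap.mul_apply, dV_apply]
  ring

/-- The polynomial `-p P' + β⁻¹ P''`. -/
def ouPoly (β : ℝ) (P : Polynomial ℝ) : Polynomial ℝ :=
  -(Polynomial.X * P.derivative) + β⁻¹ • P.derivative.derivative

/-- The image of `η(q) P(p)` under the Hamiltonian operator, `η'` being the derivative of `η`. -/
def hamTv (β : ℝ) (η η' : C(Torus, ℝ)) (P : Polynomial ℝ) : L2 β :=
  tv β η' (Polynomial.X * P) - tv β (dV * η) P.derivative

/-- The image of `η(q) P(p)` under the generator, `η'` being the derivative of `η`. -/
def genTv (β γ : ℝ) (η η' : C(Torus, ℝ)) (P : Polynomial ℝ) : L2 β :=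
  hamTv β η η' P + γ • tv β η (ouPoly β P)

theorem gen_poly (β γ : ℝ) {η η' : C(Torus, ℝ)} (h : HasD η η') (P : Polynomial ℝ) :
    gen β γ (fun x => η x.1 * P.eval x.2) = fun x => η' x.1 * (Polynomial.X * P).eval x.2 -
      (dV * η) x.1 * P.derivative.eval x.2 + γ * (η x.1 * (ouPoly β P).eval x.2) := by
  rw [gen_tensor β γ h (fun p => P.hasDerivAt p) (fun p => P.derivative.hasDerivAt p)]
  funext x
  simp [ouPoly]

theorem gen_zero_right (β : ℝ) (F : Phase → ℝ) : gen β 0 F = ham F := by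
  funext x; simp [gen]

theorem hamTv_eq_toLp {β : ℝ} {η η' : C(Torus, ℝ)} (h : HasD η η') (P : Polynomial ℝ)
    (hm : MemLp (ham (fun x => η x.1 * P.eval x.2)) 2 (mu β)) : hm.toLp _ = hamTv β η η' P := by
  unfold hamTv tv
  rw [← MemLp.toLp_sub]
  refine toLp_eq_iff _ _ fun x => ?_
  rw [← gen_zero_right β, gen_poly β 0 h]
  simp

theorem memLp_ham_tensor (β : ℝ) {η η' : C(Torus, ℝ)} (h : HasD η η') (P : Polynomial ℝ) :
    MemLp (ham (fun x => η x.1 * P.eval x.2)) 2 (mu β) := by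
  rw [← gen_zero_right β, gen_poly β 0 h]
  simp only [zero_mul, add_zero]
  exact (memLp_tensor β η'.continuous _).sub (memLp_tensor β (dV * η).continuous _)

/-! ## Convergence of cutoffs -/

/-- Dominated convergence applied to |F n - G|² ≤ 4 B². -/
theorem tendsto_toLp {β : ℝ} {F : ℕ → Phase → ℝ} {G B : Phase → ℝ}
    (hF : ∀ n, MemLp (F n) 2 (mu β)) (hG : MemLp G 2 (mu β)) (hB : MemLp B 2 (mu β))
    (hFB : ∀ n x, |F n x| ≤ B x) (hGB : ∀ x, |G x| ≤ B x)
    (hlim : ∀ x, Filter.Tendsto (fun n => F n x) Filter.atTop (nhds (G x))) :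
    Filter.Tendsto (fun n => (hF n).toLp (F n)) Filter.atTop (nhds (hG.toLp G)) := by
  rw [tendsto_iff_norm_sub_tendsto_zero]
  have h1 : ∀ n, ‖(hF n).toLp (F n) - hG.toLp G‖ = √(∫ x, (F n x - G x) ^ 2 ∂(mu β)) := by
    intro n
    rw [← MemLp.toLp_sub, ← Real.sqrt_sq (norm_nonneg _), ← real_inner_self_eq_norm_sq,
      inner_toLp]
    congr 2; funext x; simp only [Pi.sub_apply]; ring
  simp only [h1]
  have h2 : Filter.Tendsto (fun n => ∫ x, (F n x - G x) ^ 2 ∂(mu β)) Filter.atTop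
      (nhds (∫ x, (0 : ℝ) ∂(mu β))) := by
    refine tendsto_integral_of_dominated_convergence (fun x => 4 * B x ^ 2) (fun n => ?_) ?_ ?_ ?_
    · exact (((hF n).1.sub hG.1).pow 2)
    · exact hB.integrable_sq.const_mul 4
    · intro n
      refine Filter.Eventually.of_forall fun x => ?_
      rw [Real.norm_eq_abs, abs_pow]
      have h3 : |F n x - G x| ≤ 2 * B x := (abs_sub _ _).trans (by linarith [hFB n x, hGB x])
      nlinarith [abs_nonneg (F n x - G x)]
    · refine Filter.Eventually.of_forall fun x => ?_
      have := ((hlim x).sub_const (G x)).pow 2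
      simpa using this
  have h3 := (Real.continuous_sqrt.tendsto _).comp h2
  simpa [Function.comp_def] using h3

/-- A smooth cutoff, equal to one near the origin. -/
def bump : ContDiffBump (0 : ℝ) := ⟨1, 2, one_pos, one_lt_two⟩

/-- The cutoff at the scale `n + 1`. -/
def cutoff (n : ℕ) (p : ℝ) : ℝ := bump ((n + 1 : ℝ)⁻¹ * p)

theorem contDiff_bump : ContDiff ℝ ∞ (bump : ℝ → ℝ) := bump.contDiff

theorem contDiff_cutoff (n : ℕ) : ContDiff ℝ ∞ (cutoff n) :=
  contDiff_bump.comp (contDiff_const.mul contDiff_id)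

theorem exists_bound_deriv_bump : ∃ C : ℝ, ∀ p, |bump p| ≤ C ∧ |deriv bump p| ≤ C ∧
    |deriv (deriv bump) p| ≤ C := by
  have h1 : ContDiff ℝ ∞ (deriv bump) := (contDiff_infty_iff_deriv.1 contDiff_bump).2
  have h2 : ContDiff ℝ ∞ (deriv (deriv bump)) := (contDiff_infty_iff_deriv.1 h1).2
  have hs : HasCompactSupport (bump : ℝ → ℝ) := bump.hasCompactSupport
  obtain ⟨C0, h0⟩ := hs.exists_bound_of_continuous contDiff_bump.continuous
  obtain ⟨C1, h1⟩ := hs.deriv.exists_bound_of_continuous h1.continuous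
  obtain ⟨C2, h2⟩ := hs.deriv.deriv.exists_bound_of_continuous h2.continuous
  refine ⟨max C0 (max C1 C2), fun p => ⟨(h0 p).trans ?_, (h1 p).trans ?_, (h2 p).trans ?_⟩⟩ <;> simp

theorem hasDerivAt_cutoff (n : ℕ) (p : ℝ) :
    HasDerivAt (cutoff n) ((n + 1 : ℝ)⁻¹ * deriv bump ((n + 1 : ℝ)⁻¹ * p)) p := by
  have h1 := (contDiff_bump.differentiable (by simp) ((n + 1 : ℝ)⁻¹ * p)).hasDerivAt
  have h2 := (hasDerivAt_id p).const_mul (n + 1 : ℝ)⁻¹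
  exact (HasDerivAt.comp p h1 h2).congr_deriv (by simp; ring)

theorem hasDerivAt_deriv_cutoff (n : ℕ) (p : ℝ) :
    HasDerivAt (fun p => (n + 1 : ℝ)⁻¹ * deriv bump ((n + 1 : ℝ)⁻¹ * p))
      ((n + 1 : ℝ)⁻¹ * ((n + 1 : ℝ)⁻¹ * deriv (deriv bump) ((n + 1 : ℝ)⁻¹ * p))) p := by
  have h0 : ContDiff ℝ ∞ (deriv bump) := (contDiff_infty_iff_deriv.1 contDiff_bump).2
  have h1 := (h0.differentiable (by simp) ((n + 1 : ℝ)⁻¹ * p)).hasDerivAt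
  have h2 := (hasDerivAt_id p).const_mul (n + 1 : ℝ)⁻¹
  exact ((HasDerivAt.comp p h1 h2).congr_deriv (by simp; ring)).const_mul _

/-- The rescaled argument tends to 0, and the bump is constant near 0. -/
theorem cutoff_eventually (p : ℝ) :
    ∀ᶠ n : ℕ in Filter.atTop, cutoff n p = 1 ∧ deriv bump ((n + 1 : ℝ)⁻¹ * p) = 0 ∧
      deriv (deriv bump) ((n + 1 : ℝ)⁻¹ * p) = 0 := by
  have h1 : (bump : ℝ → ℝ) =ᶠ[nhds 0] fun _ => 1 := bump.eventuallyEq_one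
  have h2 : deriv bump =ᶠ[nhds 0] fun _ => 0 := by
    have := h1.deriv; simpa using this
  have h3 : deriv (deriv bump) =ᶠ[nhds 0] fun _ => 0 := by
    have := h2.deriv; simpa using this
  have ht : Filter.Tendsto (fun n : ℕ => (n + 1 : ℝ)⁻¹ * p) Filter.atTop (nhds 0) := by
    have := (tendsto_one_div_add_atTop_nhds_zero_nat (𝕜 := ℝ)).mul_const p
    simpa [one_div] using this
  filter_upwards [ht.eventually h1, ht.eventually h2, ht.eventually h3] with n a b c
  exact ⟨a, b, c⟩

theorem abs_inv_succ_mul_le (n : ℕ) (a : ℝ) : |(n + 1 : ℝ)⁻¹ * a| ≤ |a| := by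
  rw [abs_mul]
  refine mul_le_of_le_one_left (abs_nonneg _) ?_
  rw [abs_of_pos (by positivity)]
  exact inv_le_one_of_one_le₀ (by linarith [n.cast_nonneg (α := ℝ)])

/-- Polynomials are limits of compactly supported smooth functions, together with their
derivatives of order at most two. -/
theorem exists_cutoff (P : Polynomial ℝ) :
    ∃ u u' u'' : ℕ → ℝ → ℝ, ∃ C : ℝ,
      (∀ n, ContDiff ℝ ∞ (u n)) ∧ (∀ n, ∃ R, ∀ p, R < |p| → u n p = 0) ∧
      (∀ n p, HasDerivAt (u n) (u' n p) p) ∧ (∀ n p, HasDerivAt (u' n) (u'' n p) p) ∧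
      (∀ n p, |u n p| ≤ C * |P.eval p|) ∧
      (∀ n p, |u' n p| ≤ C * (|P.eval p| + |P.derivative.eval p|)) ∧
      (∀ n p, |u'' n p| ≤ C * (|P.eval p| + 2 * |P.derivative.eval p| +
        |P.derivative.derivative.eval p|)) ∧
      ∀ p, ∀ᶠ n in Filter.atTop, u n p = P.eval p ∧ u' n p = P.derivative.eval p ∧
        u'' n p = P.derivative.derivative.eval p := by
  obtain ⟨C, hC⟩ := exists_bound_deriv_bump
  set θ' : ℕ → ℝ → ℝ := fun n p => (n + 1 : ℝ)⁻¹ * deriv bump ((n + 1 : ℝ)⁻¹ * p) with hθ'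
  set θ'' : ℕ → ℝ → ℝ := fun n p =>
    (n + 1 : ℝ)⁻¹ * ((n + 1 : ℝ)⁻¹ * deriv (deriv bump) ((n + 1 : ℝ)⁻¹ * p)) with hθ''
  have b0 : ∀ n p, |cutoff n p| ≤ C := fun n p => (hC _).1
  have b1 : ∀ n p, |θ' n p| ≤ C := fun n p => (abs_inv_succ_mul_le n _).trans (hC _).2.1
  have b2 : ∀ n p, |θ'' n p| ≤ C := fun n p => ((abs_inv_succ_mul_le n _).trans
    (abs_inv_succ_mul_le n _)).trans (hC _).2.2
  have d1 : ∀ n p, HasDerivAt (cutoff n) (θ' n p) p := hasDerivAt_cutoff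
  have d2 : ∀ n p, HasDerivAt (θ' n) (θ'' n p) p := hasDerivAt_deriv_cutoff
  refine ⟨fun n p => P.eval p * cutoff n p,
    fun n p => P.derivative.eval p * cutoff n p + P.eval p * θ' n p,
    fun n p => (P.derivative.derivative.eval p * cutoff n p + P.derivative.eval p * θ' n p) +
      (P.derivative.eval p * θ' n p + P.eval p * θ'' n p), C, fun n => ?_, fun n => ?_,
    fun n p => (P.hasDerivAt p).mul (d1 n p),
    fun n p => ((P.derivative.hasDerivAt p).mul (d1 n p)).add ((P.hasDerivAt p).mul (d2 n p)),
    fun n p => ?_, fun n p => ?_, fun n p => ?_, fun p => ?_⟩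
  · exact (contDiff_eval P).mul (contDiff_cutoff n)
  · refine ⟨2 * (n + 1), fun p hp => ?_⟩
    have : cutoff n p = 0 := by
      refine bump.zero_of_le_dist ?_
      have hn : (0 : ℝ) < n + 1 := by positivity
      rw [dist_zero_right, Real.norm_eq_abs, abs_mul, abs_of_pos (inv_pos.2 hn)]
      show (2 : ℝ) ≤ _
      rw [← div_eq_inv_mul, le_div_iff₀ hn]
      exact hp.le
    simp [this]
  · rw [abs_mul, mul_comm]
    exact mul_le_mul_of_nonneg_right (b0 n p) (abs_nonneg _)
  · refine (abs_add_le _ _).trans ?_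
    rw [abs_mul, abs_mul]
    nlinarith [mul_le_mul_of_nonneg_left (b0 n p) (abs_nonneg (P.derivative.eval p)),
      mul_le_mul_of_nonneg_left (b1 n p) (abs_nonneg (P.eval p))]
  · refine (abs_add_le _ _).trans ((add_le_add (abs_add_le _ _) (abs_add_le _ _)).trans ?_)
    simp only [abs_mul]
    nlinarith [mul_le_mul_of_nonneg_left (b0 n p) (abs_nonneg (P.derivative.derivative.eval p)),
      mul_le_mul_of_nonneg_left (b1 n p) (abs_nonneg (P.derivative.eval p)),
      mul_le_mul_of_nonneg_left (b2 n p) (abs_nonneg (P.eval p))]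
  · filter_upwards [cutoff_eventually p] with n hn
    obtain ⟨h1, h2, h3⟩ := hn
    simp [hθ', hθ'', h1, h2, h3]

/-! ## The graphs -/

/-- The Hamiltonian part is the generator without friction, so results on `genGraph` serve for both
graphs. -/
theorem hamGraph_eq (β : ℝ) : hamGraph β = genGraph β 0 := by
  unfold hamGraph genGraph
  simp only [gen_zero_right]

theorem test_mem_genGraph (β γ : ℝ) {f : Phase → ℝ} (hf : IsTest f) :
    WithLp.toLp 2 ((hf.memLp β).toLp f, ((hf.gen β γ).memLp β).toLp (gen β γ f)) ∈
      genGraph β γ :=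
  Submodule.le_topologicalClosure _ (Submodule.subset_span
    ⟨f, hf, (hf.memLp β).coeFn_toLp, ((hf.gen β γ).memLp β).coeFn_toLp⟩)

theorem gen_add {f f' : Phase → ℝ} (β γ : ℝ) (hf : IsTest f) (hf' : IsTest f') :
    gen β γ (fun x => f x + f' x) = fun x => gen β γ f x + gen β γ f' x := by
  have hq {f f' : Phase → ℝ} (hf : IsTest f) (hf' : IsTest f') :
      dq (fun x => f x + f' x) = fun x => dq f x + dq f' x := by
    funext x
    obtain ⟨⟨x, y⟩, rfl⟩ := cover_surjective x
    exact (dq_coe _ _ _).trans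
      ((hf.smooth'.hasDerivAt_q le_top x y).add (hf'.smooth'.hasDerivAt_q le_top x y)).deriv
  have hp {f f' : Phase → ℝ} (hf : IsTest f) (hf' : IsTest f') :
      dp (fun x => f x + f' x) = fun x => dp f x + dp f' x := by
    funext x
    exact ((hf.smooth'.hasDerivAt_p le_top x.1 x.2).add
      (hf'.smooth'.hasDerivAt_p le_top x.1 x.2)).deriv
  funext x
  simp only [gen, ham, fd, hq hf hf', hp hf hf', hp hf.dp hf'.dp]
  ring

theorem gen_const_mul (β γ c : ℝ) (f : Phase → ℝ) :
    gen β γ (fun x => c * f x) = fun x => c * gen β γ f x := by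
  have hq (f : Phase → ℝ) : dq (fun x => c * f x) = fun x => c * dq f x := by
    funext x; simp only [dq, deriv_const_mul_field]
  have hp (f : Phase → ℝ) : dp (fun x => c * f x) = fun x => c * dp f x := by
    funext x; simp only [dp, deriv_const_mul_field]
  funext x
  simp only [gen, ham, fd, hq, hp]
  ring

/-- The pairs given by test functions already form a subspace, so the span adds nothing and a closed
property need only be checked on them. -/
theorem genGraph_induction {β γ : ℝ} {p : WithLp 2 (L2 β × L2 β) → Prop}
    (hcl : IsClosed {z | p z})
    (h : ∀ f (hf : IsTest f),
      p (WithLp.toLp 2 ((hf.memLp β).toLp f, ((hf.gen β γ).memLp β).toLp (gen β γ f))))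
    (z) (hz : z ∈ genGraph β γ) : p z := by
  refine closure_minimal ?_ hcl hz
  intro z hz
  suffices ∃ f, IsTest f ∧ z.fst =ᵐ[mu β] f ∧ z.snd =ᵐ[mu β] gen β γ f by
    obtain ⟨f, hf, h1, h2⟩ := this
    have e : z = WithLp.toLp 2
        ((hf.memLp β).toLp f, ((hf.gen β γ).memLp β).toLp (gen β γ f)) := by
      have e1 : z.fst = (hf.memLp β).toLp f := Lp.ext (h1.trans (MemLp.coeFn_toLp _).symm)
      have e2 : z.snd = ((hf.gen β γ).memLp β).toLp (gen β γ f) :=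
        Lp.ext (h2.trans (MemLp.coeFn_toLp _).symm)
      rw [← e1, ← e2]; rfl
    show p z
    rw [e]
    exact h f hf
  refine Submodule.span_induction (fun z hz => hz) ?_ ?_ ?_ hz
  · refine ⟨fun _ => 0, isTest_iff.2 ⟨smooth_const ⊤ 0, 0, by simp⟩, ?_, ?_⟩
    · exact Lp.coeFn_zero _ _ _
    · have : gen β γ (fun _ => 0) = 0 := by
        have := gen_const_mul β γ 0 (fun _ => 0)
        funext x
        simpa using congrFun this x
      rw [this]
      exact Lp.coeFn_zero _ _ _
  · rintro x y - - ⟨f, hf, h1, h2⟩ ⟨f', hf', h1', h2'⟩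
    refine ⟨_, hf.add hf', ?_, ?_⟩
    · exact (Lp.coeFn_add x.fst y.fst).trans (h1.add h1')
    · rw [gen_add β γ hf hf']
      exact (Lp.coeFn_add x.snd y.snd).trans (h2.add h2')
  · rintro c x - ⟨f, hf, h1, h2⟩
    refine ⟨_, hf.const_mul c, ?_, ?_⟩
    · exact (Lp.coeFn_smul c x.fst).trans (h1.const_smul c)
    · rw [gen_const_mul]
      exact (Lp.coeFn_smul c x.snd).trans (h2.const_smul c)

/-- The Galerkin functions are polynomial in p, hence outside the core. Their truncations in p lie
in the core, and these and their images converge in L² under polynomial domination; the graph is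
closed. -/
theorem tv_mem_genGraph (β γ : ℝ) {η η' : C(Torus, ℝ)} (h : HasD η η')
    (hη : ContDiff ℝ ∞ (fun x : ℝ => η (x : Torus))) (P : Polynomial ℝ) :
    WithLp.toLp 2 (tv β η P, genTv β γ η η' P) ∈ genGraph β γ := by
  obtain ⟨u, u', u'', C, hs, hR, hd, hd', b, b', b'', hlim⟩ := exists_cutoff P
  -- `exists_cutoff` gives no sign for C, but |u| ≤ C |P| forces C ≥ 0 unless P = 0, where the claim
  -- is trivial.
  have hC : 0 ≤ C ∨ P = 0 := by
    by_cases hP : P = 0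
    · exact Or.inr hP
    · left
      by_contra hneg
      push Not at hneg
      have : P = 0 := Polynomial.funext fun p => by
        have h1 := (abs_nonneg _).trans (b 0 p)
        have h2 := abs_nonneg (P.eval p)
        have : |P.eval p| = 0 := by nlinarith
        simpa using this
      exact hP this
  have hf : ∀ n, IsTest (fun x : Phase => η x.1 * u n x.2) := by
    intro n
    refine isTest_iff.2 ⟨(smooth_fst ⊤ hη).mul (smooth_snd ⊤ (hs n)), ?_⟩
    obtain ⟨R, hR⟩ := hR n
    exact ⟨R, fun q p hp => by simp [hR p hp]⟩
  rcases hC with hC | rfl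
  swap
  · have : genTv β γ η η' 0 = 0 := by simp [genTv, hamTv, ouPoly, tv_zero_right]
    rw [this, tv_zero_right]
    exact Submodule.zero_mem _
  have bd (ξ : C(Torus, ℝ)) (q : Torus) : |ξ q| ≤ ‖ξ‖ := ξ.norm_coe_le_norm q
  have mP (Q : Polynomial ℝ) : MemLp (fun x : Phase => |Q.eval x.2|) 2 (mu β) :=
    ((memLp_polynomial_kappa β Q).comp_measurePreserving measurePreserving_snd).norm
  -- The constant C + 1 dominates the truncations and their limit at once.
  have t1 := tendsto_toLp (β := β) (fun n => (hf n).memLp β) (memLp_tensor β η.continuous P)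
    (B := fun x => (‖η‖ * (C + 1)) * |P.eval x.2|) ((mP P).const_mul _) (fun n x => by
      rw [abs_mul, mul_assoc]
      refine mul_le_mul (bd _ _) ((b n x.2).trans ?_) (abs_nonneg _) (norm_nonneg _)
      nlinarith [abs_nonneg (P.eval x.2)]) (fun x => by
      rw [abs_mul, mul_assoc]
      refine mul_le_mul (bd _ _) ?_ (abs_nonneg _) (norm_nonneg _)
      nlinarith [abs_nonneg (P.eval x.2)]) (fun x => by
      refine tendsto_const_nhds.congr' ?_
      filter_upwards [hlim x.2] with n hn
      rw [hn.1])
  have hg : MemLp (gen β γ (fun x => η x.1 * P.eval x.2)) 2 (mu β) := by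
    rw [gen_poly β γ h]
    exact ((memLp_tensor β η'.continuous _).sub (memLp_tensor β (dV * η).continuous _)).add
      ((memLp_tensor β η.continuous _).const_mul γ)
  have mB : MemLp (fun x : Phase => ‖η'‖ * (C * |(Polynomial.X * P).eval x.2|) +
      ‖dV * η‖ * (C * (|P.eval x.2| + |P.derivative.eval x.2|)) +
      |γ| * (‖η‖ * (C * (|(Polynomial.X * P).eval x.2| +
        |(Polynomial.X * P.derivative).eval x.2|) +
      |β⁻¹| * (C * (|P.eval x.2| + 2 * |P.derivative.eval x.2| +
        |P.derivative.derivative.eval x.2|))))) 2 (mu β) := by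
    refine memLp_add_fun (memLp_add_fun ?_ ?_) ?_
    · exact ((mP _).const_mul _).const_mul _
    · exact ((memLp_add_fun (mP _) (mP _)).const_mul _).const_mul _
    · refine MemLp.const_mul (MemLp.const_mul (memLp_add_fun ?_ ?_) _) _
      · exact (memLp_add_fun (mP _) (mP _)).const_mul _
      · exact ((memLp_add_fun (memLp_add_fun (mP _) ((mP _).const_mul 2)) (mP _)).const_mul _).const_mul _
  have bound : ∀ n (x : Phase), |gen β γ (fun x : Phase => η x.1 * u n x.2) x| ≤
      ‖η'‖ * (C * |(Polynomial.X * P).eval x.2|) +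
      ‖dV * η‖ * (C * (|P.eval x.2| + |P.derivative.eval x.2|)) +
      |γ| * (‖η‖ * (C * (|(Polynomial.X * P).eval x.2| +
        |(Polynomial.X * P.derivative).eval x.2|) +
      |β⁻¹| * (C * (|P.eval x.2| + 2 * |P.derivative.eval x.2| +
        |P.derivative.derivative.eval x.2|)))) := by
    intro n x
    rw [gen_tensor β γ h (hd n) (hd' n)]
    simp only [Polynomial.eval_mul, Polynomial.eval_X]
    refine (abs_add_le _ _).trans (add_le_add ((abs_sub _ _).trans (add_le_add ?_ ?_)) ?_)
    · rw [abs_mul, abs_mul, abs_mul]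
      refine mul_le_mul (bd _ _) ?_ (by positivity) (norm_nonneg _)
      calc |x.2| * |u n x.2| ≤ |x.2| * (C * |P.eval x.2|) :=
            mul_le_mul_of_nonneg_left (b n x.2) (abs_nonneg _)
        _ = _ := by ring
    · rw [abs_mul]
      exact mul_le_mul (bd _ _) (b' n x.2) (abs_nonneg _) (norm_nonneg _)
    · rw [abs_mul, abs_mul]
      refine mul_le_mul_of_nonneg_left ?_ (abs_nonneg _)
      refine mul_le_mul (bd _ _) ?_ (abs_nonneg _) (norm_nonneg _)
      refine (abs_add_le _ _).trans (add_le_add ?_ ?_)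
      · rw [abs_mul, abs_neg, abs_mul, abs_mul]
        calc |x.2| * |u' n x.2| ≤ |x.2| * (C * (|P.eval x.2| + |P.derivative.eval x.2|)) :=
              mul_le_mul_of_nonneg_left (b' n x.2) (abs_nonneg _)
          _ = _ := by ring
      · rw [abs_mul]
        exact mul_le_mul_of_nonneg_left (b'' n x.2) (abs_nonneg _)
  have lim : ∀ x : Phase, Filter.Tendsto (fun n => gen β γ (fun x : Phase => η x.1 * u n x.2) x)
      Filter.atTop (nhds (gen β γ (fun x => η x.1 * P.eval x.2) x)) := by
    intro x
    refine tendsto_const_nhds.congr' ?_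
    filter_upwards [hlim x.2] with n hn
    rw [gen_tensor β γ h (hd n) (hd' n), gen_tensor β γ h (fun p => P.hasDerivAt p)
      (fun p => P.derivative.hasDerivAt p)]
    simp only [hn.1, hn.2.1, hn.2.2]
  have t2 := tendsto_toLp (β := β) (fun n => ((hf n).gen β γ).memLp β) hg mB bound
    (fun x => le_of_tendsto (lim x).abs (Filter.Eventually.of_forall fun n => bound n x)) lim
  have e : hg.toLp _ = genTv β γ η η' P := by
    unfold genTv hamTv tv
    rw [← MemLp.toLp_sub, ← MemLp.toLp_const_smul, ← MemLp.toLp_add]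
    refine toLp_eq_iff _ _ fun x => ?_
    rw [gen_poly β γ h]
    simp
  rw [e] at t2
  have hcl : IsClosed (genGraph β γ : Set (WithLp 2 (L2 β × L2 β))) :=
    Submodule.isClosed_topologicalClosure _
  have t3 := ((WithLp.prod_continuous_toLp 2 (L2 β) (L2 β)).tendsto _).comp (t1.prodMk_nhds t2)
  exact hcl.mem_of_tendsto t3 (Filter.Eventually.of_forall fun n => test_mem_genGraph β γ (hf n))

theorem tv_mem_hamGraph (β : ℝ) {η η' : C(Torus, ℝ)} (h : HasD η η')
    (hη : ContDiff ℝ ∞ (fun x : ℝ => η (x : Torus))) (P : Polynomial ℝ) :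
    WithLp.toLp 2 (tv β η P, hamTv β η η' P) ∈ hamGraph β := by
  have := tv_mem_genGraph β 0 h hη P
  rw [hamGraph_eq]
  simpa [genTv] using this

/-! ## Antisymmetry of the Hamiltonian part -/

/-- Leibniz rule and invariance of μ. Only one factor needs compact support, which lets polynomials
in p serve as the other one. -/
theorem integral_ham_mul {β : ℝ} (hβ : 0 < β) {f F : Phase → ℝ} (hf : IsTest f)
    (hF : Smooth 1 F) :
    ∫ x, ham f x * F x ∂(mu β) = -∫ x, f x * ham F x ∂(mu β) := by
  have h1 := hf.smooth'.of_le (m := 1) le_top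
  have hv : VanishesAt (fun x => f x * F x) := by
    obtain ⟨R, hR⟩ := hf.vanishes
    exact ⟨R, fun q p hp => by simp [hR q p hp]⟩
  have h2 := integral_ham_eq_zero hβ (h1.mul hF) hv
  have hc : Continuous (ham F) := (hF.ham (m := 0) (by simp)).continuous
  have i1 : Integrable (fun x => ham f x * F x) (mu β) := by
    have := (hf.ham.vanishes.mul_left F).integrable
      (hF.continuous.mul hf.ham.smooth'.continuous) (mu β)
    simpa [mul_comm] using this
  have i2 : Integrable (fun x => f x * ham F x) (mu β) := by
    have := (hf.vanishes.mul_left (ham F)).integrable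
      (hc.mul hf.smooth'.continuous) (mu β)
    simpa [mul_comm] using this
  rw [ham_mul h1 hF, integral_add i1 i2] at h2
  linarith

/-- The antisymmetry passes from the core to the closed graph, since both sides are continuous in
the graph norm. It is the only access to elements of the graph, which need not be differentiable. -/
theorem weak_ham {β : ℝ} (hβ : 0 < β) {φ g : L2 β} (h : WithLp.toLp 2 (φ, g) ∈ hamGraph β)
    {F : Phase → ℝ} (hF : Smooth 1 F) (m : MemLp F 2 (mu β)) (m' : MemLp (ham F) 2 (mu β)) :
    ⟪g, m.toLp F⟫_ℝ = -⟪φ, m'.toLp (ham F)⟫_ℝ := by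
  rw [hamGraph_eq] at h
  refine genGraph_induction (p := fun z => ⟪z.snd, m.toLp F⟫_ℝ = -⟪z.fst, m'.toLp (ham F)⟫_ℝ)
    ?_ (fun f hf => ?_) _ h
  · refine isClosed_eq ?_ ?_ <;> fun_prop
  · show ⟪((hf.gen β 0).memLp β).toLp (gen β 0 f), _⟫_ℝ = -⟪(hf.memLp β).toLp f, _⟫_ℝ
    rw [inner_toLp, inner_toLp, gen_zero_right, integral_ham_mul hβ hf hF]

theorem weak_ham_tv {β : ℝ} (hβ : 0 < β) {φ g : L2 β} (h : WithLp.toLp 2 (φ, g) ∈ hamGraph β)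
    {η η' : C(Torus, ℝ)} (hη : HasD η η') (P : Polynomial ℝ) :
    ⟪g, tv β η P⟫_ℝ = -⟪φ, hamTv β η η' P⟫_ℝ := by
  have m' := memLp_ham_tensor β hη P
  rw [← hamTv_eq_toLp hη P m']
  exact weak_ham hβ h ((smooth_fst 1 hη.smooth).mul (smooth_snd 1 (contDiff_eval P))) _ m'

theorem weak_ham_test {β : ℝ} (hβ : 0 < β) {φ g : L2 β} (h : WithLp.toLp 2 (φ, g) ∈ hamGraph β)
    {f : Phase → ℝ} (hf : IsTest f) :
    ⟪g, (hf.memLp β).toLp f⟫_ℝ = -⟪φ, (hf.ham.memLp β).toLp (ham f)⟫_ℝ :=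
  weak_ham hβ h (hf.smooth'.of_le le_top) _ _

/-! ## The range of `L_ham Π_p` -/

theorem PiP_hamTv {β : ℝ} (hβ : 0 < β) (η η' : C(Torus, ℝ)) (P : Polynomial ℝ) :
    PiP β (hamTv β η η' P) = gE β (Polynomial.X * P) • tv β (η' - β • (dV * η)) 1 := by
  rw [hamTv, map_sub, PiP_tv, PiP_tv, gE_derivative hβ, tv_sub_left, tv_smul_left, smul_sub,
    smul_smul, mul_comm β]

/-- Weak form of T*(ηP) = E[pP] (βV'η - η'): the antisymmetry moves L_ham onto ηP, and Π_p then
averages over p. On tensors, T* sees only the first Hermite coefficient. -/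
theorem inner_hamPi_tv {β : ℝ} (hβ : 0 < β) {ψ w : L2 β}
    (h : WithLp.toLp 2 (ψ, w) ∈ hamPiGraph β) {η η' : C(Torus, ℝ)} (hη : HasD η η')
    (P : Polynomial ℝ) :
    ⟪w, tv β η P⟫_ℝ =
      gE β (Polynomial.X * P) * ⟪PiP β ψ, tv β (β • (dV * η) - η') 1⟫_ℝ := by
  rw [weak_ham_tv hβ ((mem_hamPiGraph β ψ w).1 h) hη, ← PiP_PiP, inner_PiP_left, PiP_hamTv hβ,
    inner_smul_right, ← neg_sub η', tv_neg_left, inner_neg_right, PiP_PiP, mul_neg]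

theorem avg_ham {β : ℝ} (hβ : 0 < β) {F : Phase → ℝ} (hF : IsTest F)
    (hX : IsTest (fun x => x.2 * F x)) (q : Torus) :
    avg β (ham F) q = (avgC β hX.dq - β • (dV * avgC β hX)) q := by
  have e1 : dq (fun x => x.2 * F x) = fun x => x.2 * dq F x := by
    funext x; simp only [dq, deriv_const_mul_field]
  have hc := hF.dq.smooth'.continuous
  have hc' := hF.dp.smooth'.continuous
  have i1 : Integrable (fun p => p * dq F (q, p)) (kappa β) :=
    Continuous.integrable_of_hasCompactSupport (by fun_prop)
      ((hF.dq.vanishes.mul_left fun x => x.2).hasCompactSupport_fiber q)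
  have i2 : Integrable (fun p => sinMode 1 q * dp F (q, p)) (kappa β) :=
    Continuous.integrable_of_hasCompactSupport (by fun_prop)
      ((hF.dp.vanishes.mul_left fun x => sinMode 1 x.1).hasCompactSupport_fiber q)
  simp only [avg, ham, torusDeriv_V]
  rw [integral_sub i1 i2, integral_const_mul,
    integral_kappa_dp hβ (hF.smooth'.of_le le_top) hF.vanishes]
  simp only [ContinuousMap.sub_apply, ContinuousMap.smul_apply, ContinuousMap.mul_apply, avgC,
    ContinuousMap.coe_mk, avg, e1, dV_apply, smul_eq_mul]
  ring

/-- T* sees a test function only through its first moment in p; the factor β compensates E[p²] =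
1/β. -/
theorem inner_hamPi_test {β : ℝ} (hβ : 0 < β) {ψ w : L2 β}
    (h : WithLp.toLp 2 (ψ, w) ∈ hamPiGraph β) {F : Phase → ℝ} (hF : IsTest F)
    (hX : IsTest (fun x => x.2 * F x)) :
    ⟪w, (hF.memLp β).toLp F⟫_ℝ = ⟪w, β • tv β (avgC β hX) Polynomial.X⟫_ℝ := by
  rw [weak_ham_test hβ ((mem_hamPiGraph β ψ w).1 h) hF, ← PiP_PiP, inner_PiP_left,
    PiP_toLp _ _ (avg_ham hβ hF hX), inner_smul_right, inner_hamPi_tv hβ h (hasD_avgC β hX),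
    gE_X_mul_X hβ, ← neg_sub (avgC β hX.dq), tv_neg_left, inner_neg_right]
  field_simp

theorem tv_one_mem_hamPiGraph (β : ℝ) {η η' : C(Torus, ℝ)} (h : HasD η η')
    (hη : ContDiff ℝ ∞ (fun x : ℝ => η (x : Torus))) :
    WithLp.toLp 2 (tv β η 1, tv β η' Polynomial.X) ∈ hamPiGraph β := by
  rw [mem_hamPiGraph, PiP_tv_one]
  have := tv_mem_hamGraph β h hη 1
  simpa [hamTv, tv_zero_right] using this

/-! ## Bounds on `A` -/

/-- The hypothesis says T* h = 0. In `A_spec`, the choice ψ = A h gives ‖A h‖² + ‖T A h‖² = 0. With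
linearity, A h is determined by the functional ψ ↦ ⟨T ψ, h⟩, which is the form in which A is
computed below (`A_congr`). -/
theorem A_eq_zero {β : ℝ} {h : L2 β}
    (hh : ∀ ψ w : L2 β, WithLp.toLp 2 (ψ, w) ∈ hamPiGraph β → ⟪w, h⟫_ℝ = 0) : A β h = 0 := by
  obtain ⟨v, hv, h1⟩ := A_spec β h
  have h2 := h1 _ _ hv
  have h3 := hh _ _ hv
  rw [real_inner_comm] at h3
  rw [h3, real_inner_self_eq_norm_sq, real_inner_self_eq_norm_sq] at h2
  have : ‖A β h‖ ^ 2 = 0 := by nlinarith [sq_nonneg ‖A β h‖, sq_nonneg ‖v‖]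
  simpa using this

theorem A_congr {β : ℝ} {h h' : L2 β}
    (hh : ∀ ψ w : L2 β, WithLp.toLp 2 (ψ, w) ∈ hamPiGraph β → ⟪w, h⟫_ℝ = ⟪w, h'⟫_ℝ) :
    A β h = A β h' := by
  rw [← sub_eq_zero, ← map_sub]
  exact A_eq_zero fun ψ w hw => by rw [inner_sub_right, hh ψ w hw, sub_self]

/-- With u = A h, ‖u‖² + ‖T u‖² = ⟨h, T u⟩ ≤ ‖h‖²/4 + ‖T u‖². -/
theorem norm_A_apply_le (β : ℝ) (h : L2 β) : ‖A β h‖ ≤ 1 / 2 * ‖h‖ := by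
  obtain ⟨v, hv, h1⟩ := A_spec β h
  have h2 := h1 _ _ hv
  rw [real_inner_self_eq_norm_sq, real_inner_self_eq_norm_sq] at h2
  have h3 := real_inner_le_norm h v
  refine abs_le_of_sq_le_sq' ?_ (by positivity) |>.2
  nlinarith [sq_nonneg (‖h‖ - 2 * ‖v‖)]

/-- A T = (1 + T*T)⁻¹ T*T is a contraction: u = A T ψ satisfies ‖u‖² + ‖T u - T ψ‖² = ⟨u, ψ⟩. That A
absorbs a derivative is the source of the 1/k decay along the Fourier modes. -/
theorem norm_A_apply_le_of_mem {β : ℝ} {ψ w : L2 β}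
    (h : WithLp.toLp 2 (ψ, w) ∈ hamPiGraph β) : ‖A β w‖ ≤ ‖ψ‖ := by
  obtain ⟨v, hv, h1⟩ := A_spec β w
  have h2 := h1 _ _ hv
  have h3 := h1 _ _ h
  have h4 : ‖A β w‖ ^ 2 - ⟪A β w, ψ⟫_ℝ = -‖v - w‖ ^ 2 := by
    rw [norm_sub_sq_real, ← real_inner_self_eq_norm_sq, ← real_inner_self_eq_norm_sq v,
      ← real_inner_self_eq_norm_sq w]
    rw [real_inner_comm w v] at *
    linarith
  have h5 := real_inner_le_norm (A β w) ψ
  by_contra! hlt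
  have : 0 < ‖A β w‖ := lt_of_le_of_lt (norm_nonneg _) hlt
  nlinarith [sq_nonneg ‖v - w‖]

/-- The difference A h - Π_p A h is in the kernel of T, so `A_spec` makes it orthogonal to A h. -/
theorem PiP_A (β : ℝ) (h : L2 β) : PiP β (A β h) = A β h := by
  obtain ⟨v, hv, h1⟩ := A_spec β h
  have h2 : WithLp.toLp 2 (A β h - PiP β (A β h), 0) ∈ hamPiGraph β := by
    rw [mem_hamPiGraph, map_sub, PiP_PiP, sub_self]
    exact Submodule.zero_mem _
  have h3 := h1 _ _ h2
  rw [inner_zero_right, inner_zero_right, add_zero] at h3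
  have h4 : ⟪PiP β (A β h), A β h - PiP β (A β h)⟫_ℝ = 0 := by
    rw [inner_PiP_left, map_sub, PiP_PiP, sub_self, inner_zero_right]
  have h5 : ⟪A β h - PiP β (A β h), A β h - PiP β (A β h)⟫_ℝ = 0 := by
    rw [inner_sub_left, h3, h4, sub_zero]
  exact (sub_eq_zero.1 (inner_self_eq_zero.1 h5)).symm

theorem exists_hamPi_A (β : ℝ) (φ : L2 β) :
    ∃ v : L2 β, WithLp.toLp 2 (A β φ, v) ∈ hamPiGraph β ∧ ‖v‖ ^ 2 ≤ ⟪φ, v⟫_ℝ ∧ ‖v‖ ≤ ‖φ‖ := by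
  obtain ⟨v, hv, h1⟩ := A_spec β φ
  have h2 := h1 _ _ hv
  rw [real_inner_self_eq_norm_sq, real_inner_self_eq_norm_sq] at h2
  have h4 : ‖v‖ ^ 2 ≤ ⟪φ, v⟫_ℝ := by nlinarith [sq_nonneg ‖A β φ‖]
  refine ⟨v, hv, h4, ?_⟩
  have h3 := real_inner_le_norm φ v
  by_contra! hlt
  have : 0 < ‖v‖ := lt_of_le_of_lt (norm_nonneg _) hlt
  nlinarith

theorem norm_adjoint_A_apply_le (β : ℝ) (x : L2 β) :
    ‖ContinuousLinearMap.adjoint (A β) x‖ ≤ 1 / 2 * ‖x‖ := by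
  have h1 := ContinuousLinearMap.adjoint_inner_right (A β) (ContinuousLinearMap.adjoint (A β) x) x
  rw [real_inner_self_eq_norm_sq] at h1
  have h2 := real_inner_le_norm (A β (ContinuousLinearMap.adjoint (A β) x)) x
  have h3 := norm_A_apply_le β (ContinuousLinearMap.adjoint (A β) x)
  by_contra! hlt
  have : 0 < ‖ContinuousLinearMap.adjoint (A β) x‖ := lt_of_le_of_lt (by positivity) hlt
  nlinarith [mul_le_mul_of_nonneg_right h3 (norm_nonneg x)]

/-- The hypothesis reads x = T* y when tested on functions of q, where the range of A lies. Then A*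
x = (T A)* y, and T A is a contraction. -/
theorem norm_adjoint_A_apply_le_of {β : ℝ} {x y : L2 β}
    (h : ∀ ψ w : L2 β, WithLp.toLp 2 (ψ, w) ∈ hamPiGraph β → ⟪PiP β ψ, x⟫_ℝ = ⟪w, y⟫_ℝ) :
    ‖ContinuousLinearMap.adjoint (A β) x‖ ≤ ‖y‖ := by
  set z := ContinuousLinearMap.adjoint (A β) x with hz
  have h1 := ContinuousLinearMap.adjoint_inner_right (A β) z x
  rw [← hz, real_inner_self_eq_norm_sq] at h1
  obtain ⟨v, hv, -, hn⟩ := exists_hamPi_A β z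
  have h2 := h _ _ hv
  rw [PiP_A] at h2
  have h3 := real_inner_le_norm v y
  by_contra! hlt
  have : 0 < ‖z‖ := lt_of_le_of_lt (norm_nonneg _) hlt
  nlinarith [mul_le_mul_of_nonneg_right hn (norm_nonneg y)]

theorem A_tv_eq_zero {β : ℝ} (hβ : 0 < β) {η η' : C(Torus, ℝ)} (hη : HasD η η')
    {P : Polynomial ℝ} (hP : gE β (Polynomial.X * P) = 0) : A β (tv β η P) = 0 :=
  A_eq_zero fun ψ w hw => by rw [inner_hamPi_tv hβ hw hη, hP, zero_mul]

/-- The range of A consists of functions of q, so A* kills whatever averages to zero in p. -/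
theorem adjoint_A_tv_eq_zero {β : ℝ} {η : C(Torus, ℝ)}
    {P : Polynomial ℝ} (hP : gE β P = 0) : ContinuousLinearMap.adjoint (A β) (tv β η P) = 0 := by
  refine ext_inner_left ℝ fun y => ?_
  rw [ContinuousLinearMap.adjoint_inner_right, ← PiP_A, inner_PiP_left, PiP_tv, hP, zero_smul,
    inner_zero_right, inner_zero_right]

/-! ## The Gaussian Poincaré inequality -/

/-- Subtract g²ρ/x from the integral up to x, ρ being the Gaussian density. The derivative of the
difference is the square ρ (g' - g/x)², which vanishes for the extremal g = p, and the difference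
starts from 0 because g(0) = 0. -/
theorem gaussian_halfline {β : ℝ} (hβ : 0 < β) {g g' : ℝ → ℝ} (hg : ∀ p, HasDerivAt g (g' p) p)
    (hc : Continuous g') (h0 : g 0 = 0) {R : ℝ} (hR : 0 ≤ R) :
    0 ≤ ∫ p in (0 : ℝ)..R, gaussianPDFReal 0 (β⁻¹).toNNReal p * (g' p ^ 2 - β * g p ^ 2) := by
  set ρ := gaussianPDFReal 0 (β⁻¹).toNNReal with hρ
  have hρd : ∀ p, HasDerivAt ρ (-β * p * ρ p) p := hasDerivAt_gaussianPDFReal hβ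
  have hρc : Continuous ρ := continuous_iff_continuousAt.2 fun p => (hρd p).continuousAt
  have hgc : Continuous g := continuous_iff_continuousAt.2 fun p => (hg p).continuousAt
  have hρ0 : ∀ p, 0 ≤ ρ p := gaussianPDFReal_nonneg _ _
  have hD : Continuous (fun p => ρ p * (g' p ^ 2 - β * g p ^ 2)) := by fun_prop
  have hd : ∀ x, HasDerivAt (fun x => ∫ p in (0 : ℝ)..x, ρ p * (g' p ^ 2 - β * g p ^ 2))
      (ρ x * (g' x ^ 2 - β * g x ^ 2)) x := fun x =>
    intervalIntegral.integral_hasDerivAt_right (hD.intervalIntegrable _ _)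
      (hD.stronglyMeasurableAtFilter _ _) hD.continuousAt
  have hS : ∀ x, x ≠ 0 → HasDerivAt (fun x => g x ^ 2 * ρ x / x)
      (2 * g x * g' x * ρ x / x - g x ^ 2 * ρ x / x ^ 2 - β * g x ^ 2 * ρ x) x := by
    intro x hx
    refine ((((hg x).pow 2).mul (hρd x)).div (hasDerivAt_id x) hx).congr_deriv ?_
    simp
    field_simp
    ring
  -- At 0 the quotient has value 0 by the convention on division; this is also its limit g(0) g'(0)
  -- ρ(0).
  have hS0 : ContinuousAt (fun x => g x ^ 2 * ρ x / x) 0 := by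
    have h1 := (hasDerivAt_iff_tendsto_slope_zero.1 (hg 0))
    have h2 : Filter.Tendsto (fun t => g t * (t⁻¹ • (g (0 + t) - g 0)) * ρ t) (nhdsWithin 0 {0}ᶜ)
        (nhds (g 0 * g' 0 * ρ 0)) :=
      (((hgc.tendsto 0).mono_left nhdsWithin_le_nhds).mul h1).mul
        ((hρc.tendsto 0).mono_left nhdsWithin_le_nhds)
    rw [h0, zero_mul, zero_mul] at h2
    rw [continuousAt_iff_punctured_nhds]
    simp only [div_zero]
    refine h2.congr fun t => ?_
    simp only [zero_add, sub_zero, smul_eq_mul]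
    ring
  have hmono : MonotoneOn (fun x => (∫ p in (0 : ℝ)..x, ρ p * (g' p ^ 2 - β * g p ^ 2)) -
      g x ^ 2 * ρ x / x) (Set.Icc 0 R) := by
    refine monotoneOn_of_hasDerivWithinAt_nonneg (convex_Icc _ _) ?_ (f' := fun x =>
      ρ x * (g' x ^ 2 - β * g x ^ 2) -
      (2 * g x * g' x * ρ x / x - g x ^ 2 * ρ x / x ^ 2 - β * g x ^ 2 * ρ x)) ?_ ?_
    · intro x hx
      refine ContinuousAt.continuousWithinAt ((hd x).continuousAt.sub ?_)
      by_cases hx0 : x = 0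
      · rw [hx0]; exact hS0
      · exact (hS x hx0).continuousAt
    · intro x hx
      rw [interior_Icc] at hx
      exact ((hd x).sub (hS x hx.1.ne')).hasDerivWithinAt
    · intro x hx
      rw [interior_Icc] at hx
      have hx0 := hx.1.ne'
      have : ρ x * (g' x ^ 2 - β * g x ^ 2) -
        (2 * g x * g' x * ρ x / x - g x ^ 2 * ρ x / x ^ 2 - β * g x ^ 2 * ρ x) =
        ρ x * (g' x - g x / x) ^ 2 := by field_simp; ring
      rw [this]
      exact mul_nonneg (hρ0 x) (sq_nonneg _)
  have h1 := hmono (Set.left_mem_Icc.2 hR) (Set.right_mem_Icc.2 hR) hR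
  have h2 : 0 ≤ g R ^ 2 * ρ R / R := div_nonneg (mul_nonneg (sq_nonneg _) (hρ0 R)) hR
  simp only [intervalIntegral.integral_same, h0] at h1
  norm_num at h1
  linarith

/-- The half-line estimate on both sides of the origin, by reflection. The normalisation g(0) = 0
replaces mean zero: it is enough because subtracting the mean gives the smallest second moment. -/
theorem gaussian_poincare {β : ℝ} (hβ : 0 < β) {g g' : ℝ → ℝ} (hg : ∀ p, HasDerivAt g (g' p) p)
    (hc : Continuous g') (h0 : g 0 = 0) (i : Integrable (fun p => g p ^ 2) (kappa β))
    (i' : Integrable (fun p => g' p ^ 2) (kappa β)) :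
    β * ∫ p, g p ^ 2 ∂(kappa β) ≤ ∫ p, g' p ^ 2 ∂(kappa β) := by
  set ρ := gaussianPDFReal 0 (β⁻¹).toNNReal with hρ
  have hρc : Continuous ρ := continuous_iff_continuousAt.2 fun p =>
    (hasDerivAt_gaussianPDFReal hβ p).continuousAt
  have hgc : Continuous g := continuous_iff_continuousAt.2 fun p => (hg p).continuousAt
  have hD : Continuous (fun p => ρ p * (g' p ^ 2 - β * g p ^ 2)) := by fun_prop
  have hint : Integrable (fun p => ρ p * (g' p ^ 2 - β * g p ^ 2)) :=
    (integrable_kappa_iff hβ _).1 (i'.sub (i.const_mul β))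
  have key : 0 ≤ ∫ p, ρ p * (g' p ^ 2 - β * g p ^ 2) := by
    refine ge_of_tendsto (intervalIntegral_tendsto_integral hint Filter.tendsto_neg_atTop_atBot
      Filter.tendsto_id) ?_
    filter_upwards [Filter.eventually_ge_atTop 0] with R hR
    rw [← intervalIntegral.integral_add_adjacent_intervals (b := 0) (hD.intervalIntegrable _ _)
      (hD.intervalIntegrable _ _)]
    refine add_nonneg ?_ (gaussian_halfline hβ hg hc h0 hR)
    have h1 := gaussian_halfline hβ (g := fun p => g (-p)) (g' := fun p => -g' (-p))
      (fun p => ((hg (-p)).comp p (hasDerivAt_neg p)).congr_deriv (by ring)) (by fun_prop)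
      (by simpa using h0) hR
    have h2 := intervalIntegral.integral_comp_neg (a := 0) (b := R)
      (fun p => ρ p * (g' p ^ 2 - β * g p ^ 2))
    rw [neg_zero] at h2
    have h3 : ∀ p, ρ (-p) = ρ p := fun p => by simp [hρ, gaussianPDFReal]
    simp only [h3] at h2
    simp only [neg_sq] at h1
    exact h1.trans_eq h2
  have h3 : ∫ p, (g' p ^ 2 - β * g p ^ 2) ∂(kappa β) = ∫ p, ρ p * (g' p ^ 2 - β * g p ^ 2) := by
    rw [kappa, integral_gaussianReal_eq_integral_smul (var_ne_zero hβ)]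
    simp only [smul_eq_mul, hρ]
  rw [← h3, integral_sub i' (i.const_mul β), integral_const_mul] at key
  linarith

/-! ## The Poincaré inequality on the torus -/

theorem norm_tv_one_le {β : ℝ} {η : C(Torus, ℝ)} {M : ℝ} (hM : ∀ q, |η q| ≤ M) :
    ‖tv β η 1‖ ≤ M := by
  have hM0 : 0 ≤ M := (abs_nonneg _).trans (hM 0)
  have h1 : ‖tv β η 1‖ ≤ ‖tv β (ContinuousMap.const Torus M) 1‖ := by
    refine Lp.norm_le_norm_of_ae_le ?_
    filter_upwards [tv_coe β η 1, tv_coe β (ContinuousMap.const Torus M) 1] with x h1 h2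
    rw [h1, h2]
    simpa [abs_of_nonneg hM0] using hM x.1
  have h2 : ContinuousMap.const Torus M = M • (1 : C(Torus, ℝ)) := by ext; simp
  rw [h2, tv_smul_left, ← one_eq_tv, norm_smul, norm_one, Real.norm_of_nonneg hM0, mul_one] at h1
  exact h1

theorem integral_abs_nu_le (β : ℝ) (ζ : C(Torus, ℝ)) : ∫ q, |ζ q| ∂(nu β) ≤ ‖tv β ζ 1‖ := by
  have h1 := real_inner_le_norm (tv β |ζ| 1) (one β)
  rw [norm_one, mul_one, one_eq_tv, inner_tv, mul_one, gE_one, mul_one] at h1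
  have h2 : ‖tv β |ζ| 1‖ = ‖tv β ζ 1‖ := by
    have : ‖tv β |ζ| 1‖ ^ 2 = ‖tv β ζ 1‖ ^ 2 := by
      simp [norm_tv_one_sq, nuIn]
    exact (sq_eq_sq₀ (norm_nonneg _) (norm_nonneg _)).1 this
  rw [h2] at h1
  simpa [nuIn] using h1

theorem V_le_two (q : Torus) : V q ≤ 2 := by
  induction q using QuotientAddGroup.induction_on with
  | H x => simp only [V, cosMode_coe]; linarith [Real.neg_one_le_cos ((1 : ℕ) * x)]

/-- The solution is η = -exp(βV) ∫₀ˣ ζ exp(-βV), periodic exactly because ζ has ν-mean zero. The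
factor exp(2β) bounds exp(βV) as V ≤ 2, and the integral over one period is at most Z ∫ |ζ| dν ≤ Z
‖ζ‖. -/
theorem exists_antiderivative {β : ℝ} (hβ : 0 < β) (ζ : C(Torus, ℝ))
    (h0 : ∫ q, ζ q ∂(nu β) = 0) :
    ∃ η η' : C(Torus, ℝ), HasD η η' ∧ β • (dV * η) - η' = ζ ∧
      ∀ q, |η q| ≤ Real.exp (2 * β) * Z β * ‖tv β ζ 1‖ := by
  have hmk : Continuous (fun x : ℝ => (x : Torus)) := AddCircle.continuous_mk' (2 * π)
  set w : ℝ → ℝ := fun x => ζ (x : Torus) * Real.exp (-β * V (x : Torus)) with hw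
  have hwc : Continuous w :=
    (ζ.continuous.comp hmk).mul (continuous_const.mul (continuous_V.comp hmk)).rexp
  set I : ℝ → ℝ := fun x => ∫ s in (0 : ℝ)..x, w s with hI
  have hId : ∀ x, HasDerivAt I (w x) x := fun x =>
    intervalIntegral.integral_hasDerivAt_right (hwc.intervalIntegrable _ _)
      (hwc.stronglyMeasurableAtFilter _ _) hwc.continuousAt
  have hwp : Function.Periodic w (2 * π) := fun x => by simp [hw]
  have hint : ∫ s in (0 : ℝ)..2 * π, w s = 0 := by
    have := integral_nu β ζ
    rw [h0] at this
    exact (mul_eq_zero.1 this.symm).resolve_left (inv_ne_zero (Z_pos β).ne')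
  have hIp : Function.Periodic I (2 * π) := fun x => by
    have h1 := intervalIntegral.integral_add_adjacent_intervals (a := 0) (b := x)
      (c := x + 2 * π) (hwc.intervalIntegrable (μ := volume) _ _) (hwc.intervalIntegrable _ _)
    have h2 := hwp.intervalIntegral_add_eq x 0
    rw [zero_add] at h2
    simp only [hI]
    rw [← h1, h2, hint, add_zero]
  have hc : Continuous I := continuous_iff_continuousAt.2 fun x => (hId x).continuousAt
  have hexp : Continuous (fun q : Torus => Real.exp (β * V q)) :=
    (continuous_const.mul continuous_V).rexp
  let J : C(Torus, ℝ) := ⟨hIp.lift, continuous_torus hc⟩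
  let E : C(Torus, ℝ) := ⟨fun q => Real.exp (β * V q), hexp⟩
  have hJ : ∀ x : ℝ, J (x : Torus) = I x := fun x => rfl
  refine ⟨-(E * J), β • (dV * -(E * J)) - ζ, fun x => ?_, by abel, fun q => ?_⟩
  · have h1 : HasDerivAt (fun y : ℝ => E (y : Torus))
        (Real.exp (β * V (x : Torus)) * (β * sinMode 1 (x : Torus))) x :=
      ((hasDerivAt_V x).const_mul β).exp
    refine ((h1.mul (hId x)).neg).congr_deriv ?_
    simp only [ContinuousMap.sub_apply, ContinuousMap.smul_apply, ContinuousMap.mul_apply,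
      ContinuousMap.neg_apply, hJ, smul_eq_mul, dV_apply]
    have h2 : Real.exp (β * V (x : Torus)) * Real.exp (-β * V (x : Torus)) = 1 := by
      rw [← Real.exp_add]; simp
    have h3 : E (x : Torus) = Real.exp (β * V (x : Torus)) := rfl
    rw [h3]
    simp only [hw]
    linear_combination (-ζ (x : Torus)) * h2
  · obtain ⟨x, hx, rfl⟩ : ∃ x ∈ Set.Ico (0 : ℝ) (0 + 2 * π), (x : Torus) = q :=
      ⟨_, (AddCircle.equivIco (2 * π) 0 q).2, AddCircle.coe_equivIco⟩
    rw [zero_add] at hx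
    have h1 : |I x| ≤ Z β * ‖tv β ζ 1‖ := by
      calc |I x| ≤ ∫ s in (0 : ℝ)..x, |w s| :=
            intervalIntegral.abs_integral_le_integral_abs hx.1
        _ ≤ ∫ s in (0 : ℝ)..2 * π, |w s| := by
            refine intervalIntegral.integral_mono_interval le_rfl hx.1 hx.2.le
              (Filter.Eventually.of_forall fun s => abs_nonneg _)
              (hwc.abs.intervalIntegrable _ _)
        _ = Z β * ∫ q, |ζ q| ∂(nu β) := by
            rw [integral_nu, ← mul_assoc, mul_inv_cancel₀ (Z_pos β).ne', one_mul]
            simp only [hw, abs_mul, Real.abs_exp]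
        _ ≤ Z β * ‖tv β ζ 1‖ :=
            mul_le_mul_of_nonneg_left (integral_abs_nu_le β ζ) (Z_pos β).le
    have h2 : |(-(E * J)) (x : Torus)| = Real.exp (β * V (x : Torus)) * |I x| := by
      simp [E, hJ, abs_mul]
    rw [h2, mul_assoc]
    refine mul_le_mul (Real.exp_le_exp.2 ?_) h1 (abs_nonneg _) (Real.exp_pos _).le
    nlinarith [V_le_two (x : Torus)]

theorem inner_one_tv (β : ℝ) (ζ : C(Torus, ℝ)) : ⟪tv β ζ 1, one β⟫_ℝ = ∫ q, ζ q ∂(nu β) := by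
  rw [one_eq_tv, inner_tv, mul_one, gE_one, mul_one]
  simp [nuIn]

/-- By duality, since ψ lies only in the domain of a closure. A continuous ζ of mean zero is βV'η -
η' with η bounded by ‖ζ‖, so ⟨ψ, ζ⟩ = β ⟨T ψ, η p⟩ ≤ C ‖T ψ‖ ‖ζ‖. Continuous functions are dense in
L²(ν). -/
theorem hamPi_poincare {β : ℝ} (hβ : 0 < β) :
    ∃ C : ℝ, 0 < C ∧ ∀ ψ w : L2 β, WithLp.toLp 2 (ψ, w) ∈ hamPiGraph β → PiP β ψ = ψ →
      ⟪ψ, one β⟫_ℝ = 0 → ‖ψ‖ ≤ C * ‖w‖ := by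
  have hgX : gE β (Polynomial.X * Polynomial.X) = β⁻¹ := gE_X_mul_X hβ
  set C := β * (√(β⁻¹) * (Real.exp (2 * β) * Z β)) with hC
  have hC0 : 0 < C := by have := Z_pos β; positivity
  refine ⟨C, hC0, fun ψ w h hψ h1 => ?_⟩
  have key : ∀ u : L2nu β, ⟪ψ, posEmb β u⟫_ℝ ≤
      C * ‖w‖ * ‖posEmb β u - ⟪posEmb β u, one β⟫_ℝ • one β‖ := by
    intro u
    refine (ContinuousMap.toLp_denseRange ℝ (nu β) ℝ (p := 2) (by simp)).induction_on
      (p := fun u => ⟪ψ, posEmb β u⟫_ℝ ≤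
      C * ‖w‖ * ‖posEmb β u - ⟪posEmb β u, one β⟫_ℝ • one β‖) u ?_ ?_
    · have := (posEmb β).continuous
      exact isClosed_le (by fun_prop) (by fun_prop)
    · intro ζ
      rw [← tv_one_eq_posEmb]
      set m := ⟪tv β ζ 1, one β⟫_ℝ with hm
      have e1 : tv β ζ 1 - m • one β = tv β (ζ - m • 1) 1 := by
        rw [tv_sub_left, tv_smul_left, one_eq_tv]
      have e2 : ∫ q, (ζ - m • 1 : C(Torus, ℝ)) q ∂(nu β) = 0 := by
        rw [← inner_one_tv, ← e1, inner_sub_left, inner_smul_left, real_inner_self_eq_norm_sq,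
          norm_one, ← hm]
        simp
      obtain ⟨η, η', hη, heq, hb⟩ := exists_antiderivative hβ _ e2
      have e3 := inner_hamPi_tv hβ h hη Polynomial.X
      rw [heq, hψ, hgX, ← e1, inner_sub_right, inner_smul_right, h1, mul_zero, sub_zero] at e3
      have e4 : ⟪ψ, tv β ζ 1⟫_ℝ = β * ⟪w, tv β η Polynomial.X⟫_ℝ := by
        rw [e3]; field_simp
      rw [e4, e1]
      have e5 := real_inner_le_norm w (tv β η Polynomial.X)
      rw [norm_tv β η, hgX] at e5
      calc β * ⟪w, tv β η Polynomial.X⟫_ℝ ≤ β * (‖w‖ * (√(β⁻¹) * (Real.exp (2 * β) * Z β *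
            ‖tv β (ζ - m • 1) 1‖))) := by
            refine mul_le_mul_of_nonneg_left (e5.trans ?_) hβ.le
            gcongr
            exact norm_tv_one_le hb
        _ = _ := by rw [hC]; ring
  -- The dual estimate is applied to ψ itself, a function of the position of mean zero.
  have h2 := key (ContinuousLinearMap.adjoint (posEmb β).toContinuousLinearMap ψ)
  have h3 : posEmb β (ContinuousLinearMap.adjoint (posEmb β).toContinuousLinearMap ψ) = ψ := hψ
  rw [h3, h1, zero_smul, sub_zero, real_inner_self_eq_norm_sq] at h2
  by_contra! hlt
  have : 0 < ‖ψ‖ := lt_of_le_of_lt (by positivity) hlt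
  nlinarith

/-! ## Hypocoercivity -/

theorem isTest_mul_poly {f : Phase → ℝ} (hf : IsTest f) (P : Polynomial ℝ) :
    IsTest (fun x => P.eval x.2 * f x) :=
  hf.mul_left (smooth_snd ⊤ (contDiff_eval P))

theorem isTest_snd_mul {f : Phase → ℝ} (hf : IsTest f) : IsTest (fun x => x.2 * f x) := by
  simpa using isTest_mul_poly hf Polynomial.X

theorem integrable_fiber {f : Phase → ℝ} (hf : IsTest f) (β : ℝ) (q : Torus) :
    Integrable (fun p => f (q, p)) (kappa β) := by
  have hc := hf.smooth'.continuous
  exact Continuous.integrable_of_hasCompactSupport (by fun_prop)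
    (hf.vanishes.hasCompactSupport_fiber q)

theorem integral_neg_add_const_mul {m : Measure ℝ} {a b : ℝ → ℝ} (ha : Integrable a m)
    (hb : Integrable b m) (c : ℝ) :
    ∫ p, (-a p + c * b p) ∂m = -∫ p, a p ∂m + c * ∫ p, b p ∂m := by
  have h : Integrable (fun p => -a p) m := ha.neg
  rw [integral_add h (hb.const_mul c), integral_neg, integral_const_mul]

theorem avg_dp {β : ℝ} (hβ : 0 < β) {f : Phase → ℝ} (hf : IsTest f) (q : Torus) :
    avg β (dp f) q = β * avg β (fun x => x.2 * f x) q :=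
  integral_kappa_dp hβ (hf.smooth'.of_le le_top) hf.vanishes q

theorem dp_mul {F F' : Phase → ℝ} (h : Smooth 1 F) (h' : Smooth 1 F') :
    dp (fun x => F x * F' x) = fun x => dp F x * F' x + F x * dp F' x := by
  funext x
  exact ((h.hasDerivAt_p le_rfl x.1 x.2).mul (h'.hasDerivAt_p le_rfl x.1 x.2)).deriv

theorem dp_snd_mul {f : Phase → ℝ} (hf : IsTest f) :
    dp (fun x => x.2 * f x) = fun x => f x + x.2 * dp f x := by
  funext x
  have h1 : HasDerivAt (fun y : ℝ => y) 1 x.2 := hasDerivAt_id x.2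
  have h2 := (h1.mul (hf.smooth'.hasDerivAt_p le_top x.1 x.2)).deriv
  refine h2.trans ?_
  simp

theorem avg_fd {β : ℝ} (hβ : 0 < β) {f : Phase → ℝ} (hf : IsTest f) (q : Torus) :
    avg β (fd β f) q = 0 := by
  have h1 := avg_dp hβ hf.dp q
  have i1 := integrable_fiber (isTest_snd_mul hf.dp) β q
  have i2 := integrable_fiber hf.dp.dp β q
  simp only [avg] at h1 ⊢
  simp only [fd]
  simp only [neg_mul]
  rw [integral_neg_add_const_mul i1 i2, h1]
  field_simp
  ring

/-- L_FD is symmetric in L²(κ) and p is an eigenfunction with eigenvalue -1. -/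
theorem avg_snd_mul_fd {β : ℝ} (hβ : 0 < β) {f : Phase → ℝ} (hf : IsTest f) (q : Torus) :
    avg β (fun x => x.2 * fd β f x) q = -avg β (fun x => x.2 * f x) q := by
  have h1 := avg_dp hβ (isTest_snd_mul hf.dp) q
  have h2 := avg_dp hβ hf q
  have i1 := integrable_fiber (isTest_snd_mul (isTest_snd_mul hf.dp)) β q
  have i2 := integrable_fiber (isTest_snd_mul hf.dp.dp) β q
  have i3 := integrable_fiber hf.dp β q
  rw [dp_snd_mul hf.dp] at h1
  simp only [avg] at h1 h2 ⊢
  rw [integral_add i3 i2] at h1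
  have e : ∀ p, p * fd β f (q, p) = -(p * (p * dp f (q, p))) + β⁻¹ * (p * dp (dp f) (q, p)) := by
    intro p; simp only [fd]; ring
  simp only [e]
  rw [integral_neg_add_const_mul i1 i2]
  have h3 : ∫ p, p * dp (dp f) (q, p) ∂(kappa β) =
    β * ∫ p, p * (p * dp f (q, p)) ∂(kappa β) - β * ∫ p, p * f (q, p) ∂(kappa β) := by
    linarith
  rw [h3]
  field_simp
  ring

/-- The polynomial `β p² - 1`. -/
def q2 (β : ℝ) : Polynomial ℝ := β • (Polynomial.X * Polynomial.X) - 1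

theorem gE_q2 {β : ℝ} (hβ : 0 < β) : gE β (q2 β) = 0 := by
  rw [q2, gE_sub, gE_smul, gE_X_mul_X hβ, gE_one, mul_inv_cancel₀ hβ.ne', sub_self]

theorem eval_q2 (β p : ℝ) : (q2 β).eval p = β * (p * p) - 1 := by simp [q2]

/-- Writing βp² = 1 + `q2` splits the momentum flux into the gradient of the average of f, which is
macroscopic, and terms in the second Hermite moment, which only see φ - Π_p φ. -/
theorem avg_snd_mul_ham {β : ℝ} (hβ : 0 < β) {f : Phase → ℝ} (hf : IsTest f) (q : Torus) :
    β * avg β (fun x => x.2 * ham f x) q = avg β (dq f) q +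
      avg β (dq (fun x => (q2 β).eval x.2 * f x)) q -
      β * (sinMode 1 q * avg β (fun x => (q2 β).eval x.2 * f x) q) := by
  have e1 : dq (fun x => (q2 β).eval x.2 * f x) = fun x => (q2 β).eval x.2 * dq f x := by
    funext x; simp only [dq, deriv_const_mul_field]
  have h1 := avg_dp hβ (isTest_snd_mul hf) q
  have i1 := integrable_fiber (isTest_snd_mul (isTest_snd_mul hf)) β q
  have i2 := integrable_fiber (isTest_snd_mul hf.dp) β q
  have i3 := integrable_fiber hf β q
  have i4 := integrable_fiber (isTest_snd_mul (isTest_snd_mul hf.dq)) β q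
  have i5 := integrable_fiber hf.dq β q
  rw [dp_snd_mul hf] at h1
  rw [e1]
  simp only [avg, eval_q2] at h1 ⊢
  rw [integral_add i3 i2] at h1
  have e : ∀ p, p * ham f (q, p) = p * (p * dq f (q, p)) - sinMode 1 q * (p * dp f (q, p)) := by
    intro p; simp only [ham, torusDeriv_V]; ring
  have e2 : ∀ p, (β * (p * p) - 1) * dq f (q, p) = β * (p * (p * dq f (q, p))) - dq f (q, p) := by
    intro p; ring
  have e3 : ∀ p, (β * (p * p) - 1) * f (q, p) = β * (p * (p * f (q, p))) - f (q, p) := by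
    intro p; ring
  simp only [e, e2, e3]
  rw [integral_sub i4 (i2.const_mul _), integral_sub (i4.const_mul _) i5,
    integral_sub (i1.const_mul _) i3, integral_const_mul, integral_const_mul, integral_const_mul]
  linear_combination (-β * sinMode 1 q) * h1

/-! ### The operator A on the images of test functions -/

/-- A depends only on the first moment in p, and L_FD multiplies that moment by -1. -/
theorem A_fd {β : ℝ} (hβ : 0 < β) {f : Phase → ℝ} (hf : IsTest f) :
    A β (((hf.fd β).memLp β).toLp (fd β f)) = -A β ((hf.memLp β).toLp f) := by
  rw [← map_neg]
  refine A_congr fun ψ w hw => ?_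
  rw [inner_neg_right, inner_hamPi_test hβ hw (hf.fd β) (isTest_snd_mul (hf.fd β)),
    inner_hamPi_test hβ hw hf (isTest_snd_mul hf), ← inner_neg_right, ← smul_neg, ← tv_neg_left]
  congr 3
  ext q
  exact avg_snd_mul_fd hβ hf q

/-- L_ham f is replaced by a function p a(q) with the same first moment. The first term is A T
applied to the average of f, the source of macroscopic coercivity; in the second, A T acts on the
second Hermite moment, so ‖A T‖ ≤ 1 removes its derivative. -/
theorem A_ham {β : ℝ} (hβ : 0 < β) {f : Phase → ℝ} (hf : IsTest f)
    (hR : IsTest (fun x => (q2 β).eval x.2 * f x)) :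
    A β ((hf.ham.memLp β).toLp (ham f)) = A β (tv β (avgC β hf.dq) Polynomial.X) +
      A β (tv β (avgC β hR.dq) Polynomial.X) -
      β • A β (tv β (dV * avgC β hR) Polynomial.X) := by
  rw [← map_add, ← map_smul, ← map_sub]
  refine A_congr fun ψ w hw => ?_
  rw [inner_hamPi_test hβ hw hf.ham (isTest_snd_mul hf.ham)]
  rw [← tv_smul_left, ← tv_smul_left, ← tv_add_left, ← tv_sub_left]
  congr 2
  ext q
  exact avg_snd_mul_ham hβ hf q

/-- Let r be the average of `q2` f. Then ‖r‖² = ⟨r q2, f⟩ = ⟨r q2, φ - Π_p φ⟩, because `q2` is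
orthogonal to constants in L²(κ); conclude by Cauchy-Schwarz. -/
theorem norm_tv_avg_le {β : ℝ} (hβ : 0 < β) {f : Phase → ℝ} (hf : IsTest f)
    (hR : IsTest (fun x => (q2 β).eval x.2 * f x)) (c : ℝ) {φ : L2 β}
    (hφ : φ = (hf.memLp β).toLp f - c • one β) :
    ‖tv β (avgC β hR) 1‖ ≤ √(gE β (q2 β * q2 β)) * ‖φ - PiP β φ‖ := by
  set r := avgC β hR with hr
  have h1 : ‖tv β r 1‖ ^ 2 = ⟪tv β r (q2 β), (hf.memLp β).toLp f⟫_ℝ := by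
    have e1 : ⟪tv β r (q2 β), (hf.memLp β).toLp f⟫_ℝ = ⟪tv β r 1, (hR.memLp β).toLp _⟫_ℝ := by
      unfold tv
      rw [inner_toLp, inner_toLp]
      congr 1; funext x; simp; ring
    rw [e1, ← PiP_tv_one β r, inner_PiP_left, PiP_toLp (hR.memLp β) r (fun q => rfl),
      PiP_tv_one, real_inner_self_eq_norm_sq]
  have h2 : ⟪tv β r (q2 β), one β⟫_ℝ = 0 := by
    rw [one_eq_tv, inner_tv, mul_one, gE_q2 hβ, mul_zero]
  have h3 : ⟪tv β r (q2 β), PiP β φ⟫_ℝ = 0 := by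
    rw [← inner_PiP_left, PiP_tv, gE_q2 hβ, zero_smul, inner_zero_left]
  have h4 : ⟪tv β r (q2 β), (hf.memLp β).toLp f⟫_ℝ = ⟪tv β r (q2 β), φ - PiP β φ⟫_ℝ := by
    rw [inner_sub_right, h3, hφ, inner_sub_right, inner_smul_right, h2]; ring
  have h5 := real_inner_le_norm (tv β r (q2 β)) (φ - PiP β φ)
  rw [← h4, ← h1, norm_tv β r (q2 β)] at h5
  by_contra! hlt
  have : 0 < ‖tv β r 1‖ := lt_of_le_of_lt (by positivity) hlt
  nlinarith

theorem one_zero_mem_hamPiGraph (β : ℝ) : WithLp.toLp 2 (one β, 0) ∈ hamPiGraph β := by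
  have := tv_one_mem_hamPiGraph β (hasD_const 1) contDiff_const
  rw [tv_zero_left] at this
  rw [one_eq_tv]
  exact this

theorem inner_A_one (β : ℝ) (h : L2 β) : ⟪A β h, one β⟫_ℝ = 0 := by
  obtain ⟨v, hv, h1⟩ := A_spec β h
  have := h1 _ _ (one_zero_mem_hamPiGraph β)
  simpa using this

/-- Macroscopic coercivity without functional calculus: u = A T ψ satisfies ⟨u, ψ⟩ = ‖u‖² + ‖T(ψ -
u)‖², and the Poincaré inequality for ψ - u gives ‖ψ‖ ≤ ‖u‖ + C ‖T(ψ - u)‖. The constant 1 + C² is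
that of Cauchy-Schwarz. -/
theorem le_inner_A_of_mem {β C : ℝ} (hC : 0 < C)
    (hP : ∀ ψ w : L2 β, WithLp.toLp 2 (ψ, w) ∈ hamPiGraph β → PiP β ψ = ψ →
      ⟪ψ, one β⟫_ℝ = 0 → ‖ψ‖ ≤ C * ‖w‖) {ψ w : L2 β}
    (h : WithLp.toLp 2 (ψ, w) ∈ hamPiGraph β) (hψ : PiP β ψ = ψ) (h0 : ⟪ψ, one β⟫_ℝ = 0) :
    (1 + C ^ 2)⁻¹ * ‖ψ‖ ^ 2 ≤ ⟪A β w, ψ⟫_ℝ := by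
  obtain ⟨v, hv, h1⟩ := A_spec β w
  have h2 : WithLp.toLp 2 (ψ - A β w, w - v) ∈ hamPiGraph β := Submodule.sub_mem _ h hv
  have h3 := h1 _ _ h2
  have h4 := hP _ _ h2 (by rw [map_sub, hψ, PiP_A])
    (by rw [inner_sub_left, h0, inner_A_one, sub_zero])
  have h5 : ⟪A β w, ψ - A β w⟫_ℝ = ‖w - v‖ ^ 2 := by
    rw [← real_inner_self_eq_norm_sq, inner_sub_left w v (w - v)]; linarith
  have h6 : ⟪A β w, ψ⟫_ℝ = ‖A β w‖ ^ 2 + ‖w - v‖ ^ 2 := by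
    rw [← h5, inner_sub_right, real_inner_self_eq_norm_sq]; ring
  have h7 : ‖ψ‖ ≤ ‖A β w‖ + C * ‖w - v‖ := by
    calc ‖ψ‖ = ‖A β w + (ψ - A β w)‖ := by rw [add_sub_cancel]
      _ ≤ _ := (norm_add_le _ _).trans (by linarith)
  rw [h6, inv_mul_le_iff₀ (by positivity)]
  have h8 : ‖ψ‖ ^ 2 ≤ (‖A β w‖ + C * ‖w - v‖) ^ 2 := by gcongr
  nlinarith [sq_nonneg (C * ‖A β w‖ - ‖w - v‖)]

theorem norm_sub_PiP_le (β : ℝ) (φ y : L2 β) (hy : PiP β y = y) : ‖φ - PiP β φ‖ ≤ ‖φ - y‖ := by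
  have h1 : ⟪φ - PiP β φ, PiP β φ - y⟫_ℝ = 0 := by
    have : PiP β φ - y = PiP β (φ - y) := by rw [map_sub, hy]
    rw [this, ← inner_PiP_left, map_sub, PiP_PiP, sub_self, inner_zero_left]
  have h2 : φ - y = (φ - PiP β φ) + (PiP β φ - y) := by abel
  have h3 : ‖φ - y‖ ^ 2 = ‖φ - PiP β φ‖ ^ 2 + ‖PiP β φ - y‖ ^ 2 := by
    rw [h2, norm_add_sq_real, h1]; ring
  nlinarith [norm_nonneg (φ - y), norm_nonneg (φ - PiP β φ), sq_nonneg ‖PiP β φ - y‖]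

theorem norm_sq_eq_PiP (β : ℝ) (φ : L2 β) : ‖φ‖ ^ 2 = ‖PiP β φ‖ ^ 2 + ‖φ - PiP β φ‖ ^ 2 := by
  have h1 : ⟪PiP β φ, φ - PiP β φ⟫_ℝ = 0 := by
    rw [inner_PiP_left, map_sub, PiP_PiP, sub_self, inner_zero_right]
  have h2 : φ = PiP β φ + (φ - PiP β φ) := by abel
  conv_lhs => rw [h2, norm_add_sq_real, h1]
  ring

theorem integral_fd_mul {β : ℝ} (hβ : 0 < β) {f F : Phase → ℝ} (hf : IsTest f)
    (hF : Smooth ⊤ F) :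
    ∫ x, fd β f x * F x ∂(mu β) = -(β⁻¹ * ∫ x, dp f x * dp F x ∂(mu β)) := by
  have hF1 : Smooth ⊤ (dp F) := hF.dp (by simp)
  have t1 : IsTest (fun x => F x * dp f x) := hf.dp.mul_left hF
  have t2 : IsTest (fun x => F x * fd β f x) := (hf.fd β).mul_left hF
  have t3 : IsTest (fun x => dp F x * dp f x) := hf.dp.mul_left hF1
  have i2 : Integrable (fun x => F x * fd β f x) ((nu β).prod (kappa β)) :=
    t2.vanishes.integrable t2.smooth'.continuous _
  have i3 : Integrable (fun x => dp F x * dp f x) ((nu β).prod (kappa β)) :=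
    t3.vanishes.integrable t3.smooth'.continuous _
  have e : ∀ q, ∫ p, F (q, p) * fd β f (q, p) ∂(kappa β) =
      -(β⁻¹ * ∫ p, dp F (q, p) * dp f (q, p) ∂(kappa β)) := by
    intro q
    have h1 := avg_dp hβ t1 q
    rw [dp_mul (hF.of_le le_top) (hf.dp.smooth'.of_le le_top)] at h1
    have j1 := integrable_fiber t3 β q
    have j2 := integrable_fiber (hf.dp.dp.mul_left hF) β q
    have j3 := integrable_fiber (isTest_snd_mul t1) β q
    simp only [avg] at h1
    rw [integral_add j1 j2] at h1
    have e : ∀ p, F (q, p) * fd β f (q, p) = -(p * (F (q, p) * dp f (q, p))) +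
        β⁻¹ * (F (q, p) * dp (dp f) (q, p)) := by intro p; simp only [fd]; ring
    simp only [e]
    rw [integral_neg_add_const_mul j3 j2]
    have h2 : ∫ p, F (q, p) * dp (dp f) (q, p) ∂(kappa β) =
      β * ∫ p, p * (F (q, p) * dp f (q, p)) ∂(kappa β) -
        ∫ p, dp F (q, p) * dp f (q, p) ∂(kappa β) := by linarith
    rw [h2]
    field_simp
    ring
  simp only [mul_comm (fd β f _), mul_comm (dp f _)]
  rw [mu, integral_prod _ i2, integral_prod _ i3]
  simp only [e]
  rw [integral_neg, integral_const_mul]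

/-- Π_p φ is the best approximation by functions of q, so it may be replaced by f(q, 0) - c, for
which the fibrewise Poincaré inequality has the required normalisation at p = 0. -/
theorem norm_sub_PiP_sq_le {β : ℝ} (hβ : 0 < β) {f : Phase → ℝ} (hf : IsTest f) (c : ℝ)
    {φ : L2 β} (hφ : φ = (hf.memLp β).toLp f - c • one β) :
    ‖φ - PiP β φ‖ ^ 2 ≤ β⁻¹ * ∫ x, dp f x * dp f x ∂(mu β) := by
  have hc := hf.smooth'.continuous
  have hc' := hf.dp.smooth'.continuous
  let ξ : C(Torus, ℝ) := ⟨fun q => f (q, 0), by fun_prop⟩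
  have h1 := norm_sub_PiP_le β φ (tv β (ξ - c • 1) 1) (PiP_tv_one β _)
  have m2 := (hf.memLp β).sub (memLp_tensor β ξ.continuous 1)
  have h2 : φ - tv β (ξ - c • 1) 1 = m2.toLp _ := by
    rw [hφ, tv_sub_left, tv_smul_left, ← one_eq_tv,
      MemLp.toLp_sub (hf.memLp β) (memLp_tensor β ξ.continuous 1), tv]
    abel
  have h3 : ‖φ - tv β (ξ - c • 1) 1‖ ^ 2 = ∫ x, (f x - f (x.1, 0)) ^ 2 ∂(mu β) := by
    rw [h2, ← real_inner_self_eq_norm_sq, inner_toLp]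
    congr 1; funext x; simp [ξ]; ring
  have i1 : Integrable (fun x : Phase => (f x - f (x.1, 0)) ^ 2) ((nu β).prod (kappa β)) := by
    have := m2.integrable_sq
    simpa [ξ, mu] using this
  have i2 : Integrable (fun x => dp f x * dp f x) ((nu β).prod (kappa β)) :=
    (hf.dp.vanishes.mul_left _).integrable (by fun_prop) _
  have h4 : ∫ x, (f x - f (x.1, 0)) ^ 2 ∂(mu β) ≤ β⁻¹ * ∫ x, dp f x * dp f x ∂(mu β) := by
    rw [mu, integral_prod _ i1, integral_prod _ i2, ← integral_const_mul]
    refine integral_mono i1.integral_prod_left (i2.integral_prod_left.const_mul _) fun q => ?_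
    have hcs := hf.vanishes.hasCompactSupport_fiber q
    obtain ⟨C, hC⟩ := hf.compact.exists_bound_of_continuous hc
    have := gaussian_poincare hβ (g := fun p => f (q, p) - f (q, 0)) (g' := fun p => dp f (q, p))
      (fun p => (hf.smooth'.hasDerivAt_p le_top q p).sub_const _) (by fun_prop) (by simp)
      (by
        refine Integrable.of_bound (Continuous.aestronglyMeasurable (by fun_prop)) ((C + C) ^ 2)
          (Filter.Eventually.of_forall fun p => ?_)
        rw [norm_pow]
        gcongr
        exact (norm_sub_le _ _).trans (add_le_add (hC _) (hC _)))
      (by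
        have h5 := integrable_fiber (hf.dp.mul_left hf.dp.smooth') β q
        simpa [pow_two] using h5)
    simp only [pow_two] at this ⊢
    rw [le_inv_mul_iff₀ hβ]
    exact this
  calc _ ≤ ‖φ - tv β (ξ - c • 1) 1‖ ^ 2 := by gcongr
    _ ≤ _ := h3.trans_le h4

theorem gen_sub_const (β γ c : ℝ) (f : Phase → ℝ) : gen β γ (fun x => f x - c) = gen β γ f := by
  have hq : dq (fun x => f x - c) = dq f := by
    funext x; simp only [dq, deriv_sub_const_fun]
  have hp : dp (fun x => f x - c) = dp f := by
    funext x; simp only [dp, deriv_sub_const_fun]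
  funext x
  simp only [gen, ham, fd, hq, hp]

theorem toLp_gen {β : ℝ} (γ : ℝ) {f : Phase → ℝ} (hf : IsTest f) :
    ((hf.gen β γ).memLp β).toLp (gen β γ f) = (hf.ham.memLp β).toLp (ham f) +
      γ • ((hf.fd β).memLp β).toLp (fd β f) := by
  rw [← MemLp.toLp_const_smul, ← MemLp.toLp_add]
  exact toLp_eq_iff _ _ fun x => by simp [gen]

theorem integral_eq_inner_one {β : ℝ} {f : Phase → ℝ} (hf : MemLp f 2 (mu β)) :
    ∫ x, f x ∂(mu β) = ⟪hf.toLp f, one β⟫_ℝ := by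
  rw [one_eq_tv, tv, inner_toLp]
  simp

theorem test_mem_hamGraph (β : ℝ) {f : Phase → ℝ} (hf : IsTest f) :
    WithLp.toLp 2 ((hf.memLp β).toLp f, (hf.ham.memLp β).toLp (ham f)) ∈ hamGraph β := by
  have := test_mem_genGraph β 0 hf
  rw [hamGraph_eq]
  convert this using 3
  exact toLp_eq_iff _ _ fun x => by rw [gen_zero_right]

theorem inner_ham_one {β : ℝ} (hβ : 0 < β) {f : Phase → ℝ} (hf : IsTest f) :
    ⟪(hf.ham.memLp β).toLp (ham f), one β⟫_ℝ = 0 := by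
  rw [one_eq_tv]
  have := weak_ham_tv hβ (test_mem_hamGraph β hf) (hasD_const 1) 1
  have e : hamTv β (ContinuousMap.const Torus 1) 0 1 = 0 := by
    simp [hamTv, tv_zero_left, tv_zero_right]
  rw [e, inner_zero_right, neg_zero] at this
  exact this

theorem inner_fd_one {β : ℝ} (hβ : 0 < β) {f : Phase → ℝ} (hf : IsTest f) :
    ⟪((hf.fd β).memLp β).toLp (fd β f), one β⟫_ℝ = 0 := by
  rw [← integral_eq_inner_one]
  have := integral_fd_mul hβ hf (smooth_const ⊤ 1)
  have e : dp (fun _ => (1 : ℝ)) = 0 := by funext x; simp [dp]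
  simpa [e] using this

/-- The microscopic and macroscopic contributions to the dissipation. -/
theorem modInner_ge {β : ℝ} (hβ : 0 < β) :
    ∃ c C : ℝ, 0 < c ∧ 0 < C ∧ ∀ γ ε : ℝ, 0 < γ → 0 ≤ ε → ∀ (f : Phase → ℝ) (hf : IsTest f)
      (φ : L2 β), φ = (hf.memLp β).toLp f - (∫ x, f x ∂(mu β)) • one β →
      γ * ‖φ - PiP β φ‖ ^ 2 + ε * (c * ‖PiP β φ‖ ^ 2 -
        (C + γ / 2) * ‖PiP β φ‖ * ‖φ - PiP β φ‖ - ‖φ - PiP β φ‖ ^ 2) ≤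
        modInner β ε (-((hf.gen β γ).memLp β).toLp (gen β γ f)) φ := by
  obtain ⟨CP, hCP, hP⟩ := hamPi_poincare hβ
  set σ := √(gE β (q2 β * q2 β)) with hσ
  -- The first term bounds A on the derivative of the second Hermite moment (‖A T‖ ≤ 1), the second
  -- bounds A on its product with V' (‖A‖ ≤ 1/2). The final 1 only makes the constant positive.
  set CR := σ + β * (1 / 2 * (√(β⁻¹) * σ)) + 1 with hCR
  have hσ0 : 0 ≤ σ := Real.sqrt_nonneg _
  refine ⟨(1 + CP ^ 2)⁻¹, CR, by positivity, by positivity, fun γ ε hγ hε f hf φ hφ => ?_⟩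
  set c := ∫ x, f x ∂(mu β) with hc
  set F := (hf.memLp β).toLp f with hF
  set gh := (hf.ham.memLp β).toLp (ham f) with hgh
  set gf := ((hf.fd β).memLp β).toLp (fd β f) with hgf
  set X := ‖PiP β φ‖ with hX
  set Y := ‖φ - PiP β φ‖ with hY
  have hR := isTest_mul_poly hf (q2 β)
  have hpi : PiP β φ = tv β (avgC β hf - c • 1) 1 := by
    rw [hφ, map_sub, map_smul, hF, PiP_toLp (hf.memLp β) (avgC β hf) (fun q => rfl), one_eq_tv,
      PiP_tv_one, tv_sub_left, tv_smul_left]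
  have hD : HasD (avgC β hf - c • 1) (avgC β hf.dq) := by
    have h1 := (hasD_avgC β hf).sub ((hasD_const 1).smul c)
    rw [smul_zero, sub_zero] at h1
    exact h1
  -- the symmetric part
  have s1 : ⟪gh + γ • gf, φ⟫_ℝ ≤ -(γ * Y ^ 2) := by
    have a1 : ⟪gh, F⟫_ℝ = 0 := by
      have := weak_ham_test hβ (test_mem_hamGraph β hf) hf
      have e := real_inner_comm gh F
      rw [← hF, ← hgh] at this
      linarith
    have a2 : ⟪gf, F⟫_ℝ = -(β⁻¹ * ∫ x, dp f x * dp f x ∂(mu β)) := by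
      rw [hgf, hF, inner_toLp, integral_fd_mul hβ hf hf.smooth']
    have a3 := norm_sub_PiP_sq_le hβ hf c hφ
    rw [← hY] at a3
    rw [hφ, inner_sub_right, inner_smul_right, inner_add_left, inner_add_left, inner_smul_left,
      inner_smul_left, inner_ham_one hβ hf, inner_fd_one hβ hf, a1, a2]
    simp only [conj_trivial, mul_zero, zero_add, sub_zero]
    nlinarith
  -- the macroscopic coercivity and the remainder
  have s2 : (1 + CP ^ 2)⁻¹ * X ^ 2 - (CR - 1) * Y * X ≤ ⟪A β gh, φ⟫_ℝ := by
    have b0 : ⟪A β gh, φ⟫_ℝ = ⟪A β gh, PiP β φ⟫_ℝ := by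
      rw [← inner_PiP_left, PiP_A]
    have b1 := norm_tv_avg_le hβ hf hR c hφ
    rw [← hσ, ← hY] at b1
    have hsm : ContDiff ℝ ∞ (fun x : ℝ => (avgC β hf - c • 1 : C(Torus, ℝ)) (x : Torus)) :=
      (contDiff_avg β hf).sub (contDiff_const (c := c * 1))
    have b2 : (1 + CP ^ 2)⁻¹ * X ^ 2 ≤ ⟪A β (tv β (avgC β hf.dq) Polynomial.X), PiP β φ⟫_ℝ := by
      rw [hX, hpi]
      refine le_inner_A_of_mem hCP hP (tv_one_mem_hamPiGraph β hD hsm) (PiP_tv_one β _) ?_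
      rw [← hpi, inner_PiP_left, one_eq_tv, PiP_tv_one, ← one_eq_tv, hφ, inner_sub_left,
        inner_smul_left, real_inner_self_eq_norm_sq, norm_one, hc, hF,
        integral_eq_inner_one (hf.memLp β)]
      simp
    have b3 : ‖A β (tv β (avgC β hR.dq) Polynomial.X)‖ ≤ σ * Y :=
      (norm_A_apply_le_of_mem (tv_one_mem_hamPiGraph β (hasD_avgC β hR)
        (contDiff_avg β hR))).trans b1
    have b4 : ‖A β (tv β (dV * avgC β hR) Polynomial.X)‖ ≤ 1 / 2 * (√(β⁻¹) * (σ * Y)) := by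
      refine (norm_A_apply_le β _).trans (mul_le_mul_of_nonneg_left ?_ (by norm_num))
      refine (norm_tv_mul_le β dV _ _ fun q => ?_).trans ?_
      · induction q using QuotientAddGroup.induction_on with
        | H x => simpa using Real.abs_sin_le_one _
      · rw [norm_tv, gE_X_mul_X hβ]
        exact mul_le_mul_of_nonneg_left b1 (Real.sqrt_nonneg _)
    rw [b0, hgh, A_ham hβ hf hR, inner_sub_left, inner_add_left, inner_smul_left, conj_trivial]
    have b5 := abs_real_inner_le_norm (A β (tv β (avgC β hR.dq) Polynomial.X)) (PiP β φ)
    have b6 := abs_real_inner_le_norm (A β (tv β (dV * avgC β hR) Polynomial.X)) (PiP β φ)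
    have b7 := (abs_le.1 b5).1
    have b8 := (abs_le.1 b6).2
    have hX0 : 0 ≤ X := norm_nonneg _
    have b9 := mul_le_mul_of_nonneg_right b3 hX0
    have b10 := mul_le_mul_of_nonneg_left (mul_le_mul_of_nonneg_right b4 hX0) hβ.le
    have b11 := mul_le_mul_of_nonneg_left b8 hβ.le
    have b12 : (CR - 1) * Y * X = σ * Y * X + β * (1 / 2 * (√(β⁻¹) * (σ * Y)) * X) := by
      rw [hCR]; ring
    linarith
  -- A L_FD f = -A f, and A kills constants and functions of q, so only A(φ - Π_p φ) is left.
  have s3 : -(1 / 2 * Y * X) ≤ ⟪A β gf, φ⟫_ℝ := by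
    have c1 : A β gf = -A β (φ - PiP β φ) := by
      have d1 : A β (one β) = 0 := by
        rw [one_eq_tv]
        exact A_tv_eq_zero hβ (hasD_const 1) (by rw [mul_one, gE_X hβ])
      have d2 : A β (PiP β φ) = 0 := by
        rw [hpi]
        exact A_tv_eq_zero hβ hD (by rw [mul_one, gE_X hβ])
      rw [hgf, A_fd hβ hf, map_sub, d2, sub_zero, hφ, map_sub, map_smul, d1, smul_zero, sub_zero]
    rw [c1, ← PiP_A, inner_neg_left, inner_PiP_left]
    have c2 := real_inner_le_norm (A β (φ - PiP β φ)) (PiP β φ)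
    have c3 := mul_le_mul_of_nonneg_right (norm_A_apply_le β (φ - PiP β φ)) (norm_nonneg (PiP β φ))
    linarith
  -- With v = T A φ, ⟨A φ, L_ham f⟩ = -⟨v, f⟩. As v is orthogonal to the functions of q that occur
  -- here, ⟨v, f⟩ = ⟨v, φ - Π_p φ⟩ and ‖v‖ ≤ Y. The friction term vanishes, A φ being a function of
  -- q.
  have s4 : -Y ^ 2 ≤ ⟪A β φ, gh + γ • gf⟫_ℝ := by
    obtain ⟨v, hv, hv1, -⟩ := exists_hamPi_A β φ
    have d0 : ⟪v, one β⟫_ℝ = 0 := by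
      rw [one_eq_tv, ← show ContinuousMap.const Torus (1 : ℝ) = 1 from rfl,
        inner_hamPi_tv hβ hv (hasD_const 1), mul_one, gE_X hβ, zero_mul]
    have d1 : ⟪v, PiP β φ⟫_ℝ = 0 := by
      rw [hpi, inner_hamPi_tv hβ hv hD, mul_one,
        gE_X hβ, zero_mul]
    have d2 : ⟪v, F⟫_ℝ = -⟪A β φ, gh⟫_ℝ := by
      have := weak_ham_test hβ ((mem_hamPiGraph β _ _).1 hv) hf
      rwa [PiP_A] at this
    have d3 : ⟪A β φ, gf⟫_ℝ = 0 := by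
      rw [← PiP_A, inner_PiP_left, hgf, PiP_toLp ((hf.fd β).memLp β) 0 (fun q => avg_fd hβ hf q),
        tv_zero_left, inner_zero_right]
    have d4 : ⟪v, F⟫_ℝ = ⟪v, φ - PiP β φ⟫_ℝ := by
      rw [inner_sub_right, d1, hφ, inner_sub_right, inner_smul_right, d0]; ring
    have d5 : ⟪φ, v⟫_ℝ = ⟪v, φ - PiP β φ⟫_ℝ := by
      rw [inner_sub_right, d1, sub_zero, real_inner_comm]
    have d6 := real_inner_le_norm v (φ - PiP β φ)
    rw [d5] at hv1
    have d7 : ‖v‖ ≤ Y := by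
      by_contra! hlt
      have : 0 < ‖v‖ := lt_of_le_of_lt (norm_nonneg _) hlt
      nlinarith
    rw [inner_add_right, inner_smul_right, d3]
    have d8 := mul_le_mul_of_nonneg_right d7 (norm_nonneg (φ - PiP β φ))
    rw [← hY] at d6 d8
    nlinarith
  have e1 : modInner β ε (-((hf.gen β γ).memLp β).toLp (gen β γ f)) φ =
      -⟪gh + γ • gf, φ⟫_ℝ + ε * ((⟪A β gh, φ⟫_ℝ + γ * ⟪A β gf, φ⟫_ℝ) +
        ⟪A β φ, gh + γ • gf⟫_ℝ) := by
    rw [toLp_gen γ hf, modInner, inner_neg_left, map_neg, inner_neg_left, inner_neg_right, map_add,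
      map_smul, inner_add_left (A β gh), inner_smul_left]
    simp only [conj_trivial]
    ring
  rw [e1]
  have hX0 : 0 ≤ X := norm_nonneg _
  have hY0 : 0 ≤ Y := norm_nonneg _
  have e2 := mul_le_mul_of_nonneg_left s3 hγ.le
  have e3 : (1 + CP ^ 2)⁻¹ * X ^ 2 - (CR + γ / 2) * X * Y - Y ^ 2 ≤
      (⟪A β gh, φ⟫_ℝ + γ * ⟪A β gf, φ⟫_ℝ) + ⟪A β φ, gh + γ • gf⟫_ℝ := by
    nlinarith [mul_nonneg hX0 hY0]
  have e4 := mul_le_mul_of_nonneg_left e3 hε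
  linarith

theorem one_coe (β : ℝ) : one β =ᵐ[mu β] fun _ => (1 : ℝ) := Lp.coeFn_const 2 (mu β) (1 : ℝ)

/-- The quadratic form of `modInner_ge` is made positive by Young's inequality: each cross term
takes a quarter of c X², and the resulting Y² terms are absorbed by half of γ Y². -/
theorem exists_admissible {β : ℝ} (hβ : 0 < β) :
    ∃ (εbar lbar : ℝ) (ltil : ℝ → ℝ), Admissible β εbar lbar ltil := by
  obtain ⟨c, C, hc, hC, h⟩ := modInner_ge hβ
  -- D collects the Y² costs: 1 directly, and C²/c and γ²/(4c) from Young's inequality. Since m =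
  -- min(γ, 1/γ) satisfies m ≤ γ and mγ² ≤ γ, their total with weight εb m is at most εb γ D = γ/2.
  set D := 1 + C ^ 2 / c + 1 / (4 * c) with hD
  have hD1 : 1 < D := by
    have : 0 < C ^ 2 / c + 1 / (4 * c) := by positivity
    rw [hD]; linarith
  set εb := 1 / (2 * D) with hεb
  have hεb0 : 0 < εb := by positivity
  have hεD : εb * D = 1 / 2 := by rw [hεb]; field_simp
  have hεb1 : εb < 1 := by nlinarith
  -- What remains is (γ/2) Y² and εb m (c/2) X², with γ ≥ m.
  set lb := min (1 / 2) (εb * c / 2) with hlb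
  have hlb0 : 0 < lb := lt_min (by norm_num) (by positivity)
  refine ⟨εb, lb, fun γ => lb * min γ γ⁻¹, hεb0, hεb1, hlb0, fun γ hγ => le_rfl,
    fun γ hγ f hf φ g hφ hg => ?_⟩
  set m := min γ γ⁻¹ with hm
  have hm0 : 0 < m := lt_min hγ (inv_pos.2 hγ)
  have hmγ : m ≤ γ := min_le_left _ _
  have hmγ2 : m * γ ≤ 1 := by
    calc m * γ ≤ γ⁻¹ * γ := mul_le_mul_of_nonneg_right (min_le_right _ _) hγ.le
      _ = 1 := inv_mul_cancel₀ hγ.ne'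
  have e1 : φ = (hf.memLp β).toLp f - (∫ x, f x ∂(mu β)) • one β := by
    refine Lp.ext (hφ.trans ?_)
    filter_upwards [Lp.coeFn_sub ((hf.memLp β).toLp f) ((∫ x, f x ∂(mu β)) • one β),
      (hf.memLp β).coeFn_toLp, Lp.coeFn_smul (∫ x, f x ∂(mu β)) (one β),
      one_coe β] with x h1 h2 h3 h4
    rw [h1]
    simp only [Pi.sub_apply, h2, h3, Pi.smul_apply, h4]
    simp
  have e2 : g = ((hf.gen β γ).memLp β).toLp (gen β γ f) := by
    rw [gen_sub_const] at hg
    exact Lp.ext (hg.trans (MemLp.coeFn_toLp _).symm)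
  have key := h γ (εb * m) hγ (by positivity) f hf φ e1
  rw [← e2] at key
  refine le_trans ?_ key
  rw [norm_sq_eq_PiP β φ]
  set X := ‖PiP β φ‖
  set Y := ‖φ - PiP β φ‖
  have k1 : C * X * Y ≤ c / 4 * X ^ 2 + C ^ 2 / c * Y ^ 2 := by
    have : 0 ≤ c * (X / 2 - C / c * Y) ^ 2 := by positivity
    have e : c * (X / 2 - C / c * Y) ^ 2 = c / 4 * X ^ 2 + C ^ 2 / c * Y ^ 2 - C * X * Y := by
      field_simp; ring
    linarith
  have k2 : γ / 2 * X * Y ≤ c / 4 * X ^ 2 + γ ^ 2 * (1 / (4 * c)) * Y ^ 2 := by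
    have : 0 ≤ c * (X / 2 - γ / (2 * c) * Y) ^ 2 := by positivity
    have e : c * (X / 2 - γ / (2 * c) * Y) ^ 2 =
      c / 4 * X ^ 2 + γ ^ 2 * (1 / (4 * c)) * Y ^ 2 - γ / 2 * X * Y := by
      field_simp; ring
    linarith
  have k3 : εb * m * (C ^ 2 / c + γ ^ 2 * (1 / (4 * c)) + 1) ≤ γ / 2 := by
    have a1 : m * γ ^ 2 ≤ γ := by nlinarith
    have a2 : m * (C ^ 2 / c + 1) ≤ γ * (C ^ 2 / c + 1) :=
      mul_le_mul_of_nonneg_right hmγ (by positivity)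
    have a3 : m * γ ^ 2 * (1 / (4 * c)) ≤ γ * (1 / (4 * c)) :=
      mul_le_mul_of_nonneg_right a1 (by positivity)
    have a4 : m * (C ^ 2 / c + γ ^ 2 * (1 / (4 * c)) + 1) ≤ γ * D := by rw [hD]; linarith
    calc εb * m * (C ^ 2 / c + γ ^ 2 * (1 / (4 * c)) + 1) =
          εb * (m * (C ^ 2 / c + γ ^ 2 * (1 / (4 * c)) + 1)) := by ring
      _ ≤ εb * (γ * D) := mul_le_mul_of_nonneg_left a4 hεb0.le
      _ = γ / 2 := by rw [← mul_assoc, mul_right_comm, hεD]; ring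
  have k4 : lb * m ≤ εb * m * (c / 2) := by
    have := mul_le_mul_of_nonneg_right (min_le_right (1 / 2 : ℝ) (εb * c / 2)) hm0.le
    rw [← hlb] at this
    linarith
  have k5 : lb * m ≤ γ / 2 := by
    have := mul_le_mul_of_nonneg_right (min_le_left (1 / 2 : ℝ) (εb * c / 2)) hm0.le
    rw [← hlb] at this
    linarith
  have k6 := mul_le_mul_of_nonneg_right k3 (sq_nonneg Y)
  have k7 := mul_le_mul_of_nonneg_right k4 (sq_nonneg X)
  have k8 := mul_le_mul_of_nonneg_right k5 (sq_nonneg Y)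
  have k9 := mul_le_mul_of_nonneg_left (add_le_add k1 k2) (mul_pos hεb0 hm0).le
  nlinarith

/-! ## Trigonometric modes -/

theorem integral_cos_int (m : ℤ) :
    ∫ x in (0 : ℝ)..2 * π, Real.cos (m * x) = if m = 0 then 2 * π else 0 := by
  split_ifs with h
  · simp [h]
  · have hm : (m : ℝ) ≠ 0 := by exact_mod_cast h
    rw [intervalIntegral.integral_comp_mul_left (fun x => Real.cos x) hm, integral_cos]
    have : (m : ℝ) * (2 * π) = ((2 * m : ℤ) : ℝ) * π := by push_cast; ring
    rw [this, Real.sin_int_mul_pi]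
    simp

theorem integral_sin_int (m : ℤ) : ∫ x in (0 : ℝ)..2 * π, Real.sin (m * x) = 0 := by
  by_cases h : m = 0
  · simp [h]
  · have hm : (m : ℝ) ≠ 0 := by exact_mod_cast h
    rw [intervalIntegral.integral_comp_mul_left (fun x => Real.sin x) hm, integral_sin]
    rw [Real.cos_int_mul_two_pi]
    simp

/-- The unnormalized cosine modes. -/
def cm (β : ℝ) (k : ℕ) : C(Torus, ℝ) :=
  ⟨fun q => √(Z β / π) * cosMode k q * Real.exp (β * V q / 2),
    (continuous_const.mul (continuous_cosMode k)).mul (continuous_weight β)⟩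

/-- The sine modes. -/
def sm (β : ℝ) (k : ℕ) : C(Torus, ℝ) :=
  ⟨fun q => √(Z β / π) * sinMode k q * Real.exp (β * V q / 2),
    (continuous_const.mul (continuous_sinMode k)).mul (continuous_weight β)⟩

theorem cm_apply (β : ℝ) (k : ℕ) (q : Torus) :
    cm β k q = √(Z β / π) * cosMode k q * Real.exp (β * V q / 2) := rfl

theorem sm_apply (β : ℝ) (k : ℕ) (q : Torus) :
    sm β k q = √(Z β / π) * sinMode k q * Real.exp (β * V q / 2) := rfl

theorem sm_zero (β : ℝ) : sm β 0 = 0 := by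
  ext q
  induction q using QuotientAddGroup.induction_on with
  | H x => simp [sm_apply]

theorem dV_mul_cm_zero (β : ℝ) : dV * cm β 0 = sm β 1 := by
  ext q
  induction q using QuotientAddGroup.induction_on with
  | H x => simp [sm_apply, cm_apply]; ring

/-- V' = sin couples a frequency only to its neighbours. This band structure later confines the
residuals to frequency K. -/
theorem dV_mul_cm_succ (β : ℝ) (k : ℕ) :
    dV * cm β (k + 1) = (1 / 2 : ℝ) • (sm β (k + 2) - sm β k) := by
  ext q
  induction q using QuotientAddGroup.induction_on with
  | H x =>
    have h1 : ((k + 2 : ℕ) : ℝ) * x = ((k + 1 : ℕ) : ℝ) * x + x := by push_cast; ring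
    have h2 : (k : ℝ) * x = ((k + 1 : ℕ) : ℝ) * x - x := by push_cast; ring
    simp only [ContinuousMap.mul_apply, ContinuousMap.smul_apply, ContinuousMap.sub_apply,
      sm_apply, cm_apply, dV_apply, cosMode_coe, sinMode_coe, smul_eq_mul]
    rw [h1, h2, Real.sin_add, Real.sin_sub]
    simp only [Nat.cast_one, one_mul]
    ring

theorem dV_mul_sm_succ (β : ℝ) (k : ℕ) :
    dV * sm β (k + 1) = (1 / 2 : ℝ) • (cm β k - cm β (k + 2)) := by
  ext q
  induction q using QuotientAddGroup.induction_on with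
  | H x =>
    have h1 : ((k + 2 : ℕ) : ℝ) * x = ((k + 1 : ℕ) : ℝ) * x + x := by push_cast; ring
    have h2 : (k : ℝ) * x = ((k + 1 : ℕ) : ℝ) * x - x := by push_cast; ring
    simp only [ContinuousMap.mul_apply, ContinuousMap.smul_apply, ContinuousMap.sub_apply,
      sm_apply, cm_apply, dV_apply, cosMode_coe, sinMode_coe, smul_eq_mul]
    rw [h1, h2, Real.cos_add, Real.cos_sub]
    simp only [Nat.cast_one, one_mul]
    ring

/-- The derivative of the cosine modes. -/
def cmD (β : ℝ) (k : ℕ) : C(Torus, ℝ) := -((k : ℝ) • sm β k) + (β / 2) • (dV * cm β k)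

/-- The derivative of the sine modes. -/
def smD (β : ℝ) (k : ℕ) : C(Torus, ℝ) := (k : ℝ) • cm β k + (β / 2) • (dV * sm β k)

theorem hasD_cm (β : ℝ) (k : ℕ) : HasD (cm β k) (cmD β k) := fun x => by
  refine (((hasDerivAt_cosMode k x).const_mul _).mul (hasDerivAt_weight β x)).congr_deriv ?_
  simp only [cmD, ContinuousMap.add_apply, ContinuousMap.neg_apply, ContinuousMap.smul_apply,
    ContinuousMap.mul_apply, sm_apply, cm_apply, dV_apply, smul_eq_mul]
  ring

theorem hasD_sm (β : ℝ) (k : ℕ) : HasD (sm β k) (smD β k) := fun x => by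
  refine (((hasDerivAt_sinMode k x).const_mul _).mul (hasDerivAt_weight β x)).congr_deriv ?_
  simp only [smD, ContinuousMap.add_apply, ContinuousMap.smul_apply,
    ContinuousMap.mul_apply, sm_apply, cm_apply, dV_apply, smul_eq_mul]
  ring

theorem contDiff_weight (β : ℝ) {n : WithTop ℕ∞} :
    ContDiff ℝ n (fun x : ℝ => Real.exp (β * V (x : Torus) / 2)) := by
  simp only [V, cosMode_coe]; fun_prop

theorem contDiff_cm (β : ℝ) (k : ℕ) : ContDiff ℝ ∞ (fun x : ℝ => cm β k (x : Torus)) :=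
  (contDiff_const.mul (contDiff_cosMode k _)).mul (contDiff_weight β)

theorem contDiff_sm (β : ℝ) (k : ℕ) : ContDiff ℝ ∞ (fun x : ℝ => sm β k (x : Torus)) :=
  (contDiff_const.mul (contDiff_sinMode k _)).mul (contDiff_weight β)

/-- The two factors exp(βV/2) cancel the density of ν, so the modes inherit the orthogonality of the
Fourier basis. -/
theorem nuIn_weighted (β : ℝ) (η ξ : C(Torus, ℝ)) {a b : ℝ → ℝ}
    (ha : ∀ x : ℝ, η (x : Torus) = √(Z β / π) * a x * Real.exp (β * V (x : Torus) / 2))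
    (hb : ∀ x : ℝ, ξ (x : Torus) = √(Z β / π) * b x * Real.exp (β * V (x : Torus) / 2)) :
    nuIn β η ξ = π⁻¹ * ∫ x in (0 : ℝ)..2 * π, a x * b x := by
  have hZ := Z_pos β
  have hs : √(Z β / π) * √(Z β / π) = Z β / π := Real.mul_self_sqrt (by positivity)
  have e : ∀ x : ℝ, η (x : Torus) * ξ (x : Torus) * Real.exp (-β * V (x : Torus)) =
      Z β / π * (a x * b x) := by
    intro x
    have h1 : Real.exp (β * V (x : Torus) / 2) * Real.exp (β * V (x : Torus) / 2) *
        Real.exp (-β * V (x : Torus)) = 1 := by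
      rw [← Real.exp_add, ← Real.exp_add]; ring_nf; simp
    rw [ha, hb]
    linear_combination (√(Z β / π) * √(Z β / π) * a x * b x) * h1 + (a x * b x) * hs
  rw [nuIn, integral_nu]
  simp only [e]
  rw [intervalIntegral.integral_const_mul]
  field_simp

/-- The second indicator records that the mode of frequency 0 has squared norm 2; hence the factor
1/√2 in `gC_zero`. -/
theorem nuIn_cm_cm (β : ℝ) (j k : ℕ) :
    nuIn β (cm β j) (cm β k) = (if j = k then 1 else 0) + if j + k = 0 then 1 else 0 := by
  rw [nuIn_weighted β _ _ (fun x => by rw [cm_apply]) (fun x => by rw [cm_apply])]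
  have e : ∀ x : ℝ, cosMode j (x : Torus) * cosMode k (x : Torus) =
      1 / 2 * Real.cos (((j : ℤ) - k : ℤ) * x) + 1 / 2 * Real.cos (((j : ℤ) + k : ℤ) * x) := by
    intro x
    simp only [cosMode_coe]
    push_cast
    rw [sub_mul, add_mul, Real.cos_sub, Real.cos_add]
    ring
  simp only [e]
  rw [intervalIntegral.integral_add (Continuous.intervalIntegrable (by fun_prop) _ _)
    (Continuous.intervalIntegrable (by fun_prop) _ _), intervalIntegral.integral_const_mul,
    intervalIntegral.integral_const_mul, integral_cos_int, integral_cos_int]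
  have h1 : ((j : ℤ) - k = 0) ↔ j = k := by omega
  have h2 : ((j : ℤ) + k = 0) ↔ j + k = 0 := by omega
  simp only [h1, h2]
  split_ifs <;> field_simp <;> norm_num

theorem nuIn_sm_sm (β : ℝ) (j k : ℕ) :
    nuIn β (sm β j) (sm β k) = (if j = k then 1 else 0) - if j + k = 0 then 1 else 0 := by
  rw [nuIn_weighted β _ _ (fun x => by rw [sm_apply]) (fun x => by rw [sm_apply])]
  have e : ∀ x : ℝ, sinMode j (x : Torus) * sinMode k (x : Torus) =
      1 / 2 * Real.cos (((j : ℤ) - k : ℤ) * x) - 1 / 2 * Real.cos (((j : ℤ) + k : ℤ) * x) := by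
    intro x
    simp only [sinMode_coe]
    push_cast
    rw [sub_mul, add_mul, Real.cos_sub, Real.cos_add]
    ring
  simp only [e]
  rw [intervalIntegral.integral_sub (Continuous.intervalIntegrable (by fun_prop) _ _)
    (Continuous.intervalIntegrable (by fun_prop) _ _), intervalIntegral.integral_const_mul,
    intervalIntegral.integral_const_mul, integral_cos_int, integral_cos_int]
  have h1 : ((j : ℤ) - k = 0) ↔ j = k := by omega
  have h2 : ((j : ℤ) + k = 0) ↔ j + k = 0 := by omega
  simp only [h1, h2]
  split_ifs <;> field_simp <;> norm_num

theorem nuIn_cm_sm (β : ℝ) (j k : ℕ) : nuIn β (cm β j) (sm β k) = 0 := by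
  rw [nuIn_weighted β _ _ (fun x => by rw [cm_apply]) (fun x => by rw [sm_apply])]
  have e : ∀ x : ℝ, cosMode j (x : Torus) * sinMode k (x : Torus) =
      1 / 2 * Real.sin (((k : ℤ) + j : ℤ) * x) + 1 / 2 * Real.sin (((k : ℤ) - j : ℤ) * x) := by
    intro x
    simp only [sinMode_coe, cosMode_coe]
    push_cast
    rw [sub_mul, add_mul, Real.sin_sub, Real.sin_add]
    ring
  simp only [e]
  rw [intervalIntegral.integral_add (Continuous.intervalIntegrable (by fun_prop) _ _)
    (Continuous.intervalIntegrable (by fun_prop) _ _), intervalIntegral.integral_const_mul,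
    intervalIntegral.integral_const_mul, integral_sin_int, integral_sin_int]
  simp

theorem nuIn_comm (β : ℝ) (η ξ : C(Torus, ℝ)) : nuIn β η ξ = nuIn β ξ η := by
  simp only [nuIn, mul_comm]

theorem continuous_integrable_nu (β : ℝ) (η : C(Torus, ℝ)) : Integrable η (nu β) :=
  η.continuous.integrable_of_hasCompactSupport (HasCompactSupport.of_compactSpace _)

theorem nuIn_add_right (β : ℝ) (η ξ ζ : C(Torus, ℝ)) :
    nuIn β η (ξ + ζ) = nuIn β η ξ + nuIn β η ζ := by
  simp only [nuIn, ContinuousMap.add_apply, mul_add]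
  exact integral_add (continuous_integrable_nu β (η * ξ)) (continuous_integrable_nu β (η * ζ))

theorem nuIn_smul_right (β c : ℝ) (η ξ : C(Torus, ℝ)) : nuIn β η (c • ξ) = c * nuIn β η ξ := by
  simp only [nuIn, ContinuousMap.smul_apply, smul_eq_mul, mul_left_comm _ c]
  exact integral_const_mul _ _

theorem nuIn_neg_right (β : ℝ) (η ξ : C(Torus, ℝ)) : nuIn β η (-ξ) = -nuIn β η ξ := by
  simpa using nuIn_smul_right β (-1) η ξ

theorem nuIn_sub_right (β : ℝ) (η ξ ζ : C(Torus, ℝ)) :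
    nuIn β η (ξ - ζ) = nuIn β η ξ - nuIn β η ζ := by
  rw [sub_eq_add_neg, nuIn_add_right, nuIn_neg_right, sub_eq_add_neg]

theorem nuIn_smul_left (β c : ℝ) (η ξ : C(Torus, ℝ)) : nuIn β (c • η) ξ = c * nuIn β η ξ := by
  rw [nuIn_comm, nuIn_smul_right, nuIn_comm]

/-! ## The orthonormal modes -/

/-- `G_n` as a continuous function. -/
def gC (β : ℝ) (n : ℕ) : C(Torus, ℝ) := ⟨G β n, (isC1_G β n).1⟩

theorem gC_zero (β : ℝ) : gC β 0 = (√2)⁻¹ • cm β 0 := by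
  ext q
  have h : √(Z β / (2 * π)) = (√2)⁻¹ * √(Z β / π) := by
    rw [← Real.sqrt_inv, ← Real.sqrt_mul (by norm_num)]
    congr 1; field_simp
  induction q using QuotientAddGroup.induction_on with
  | H x => simp [gC, G, cm_apply, h]; ring

theorem gC_odd (β : ℝ) (j : ℕ) : gC β (2 * j + 1) = sm β (j + 1) := by
  ext q
  have h1 : ¬ Even (2 * j + 1) := by simp
  have h2 : (2 * j + 1 + 1) / 2 = j + 1 := by omega
  simp only [gC, G, ContinuousMap.coe_mk, h1, h2, sm_apply]
  simp

theorem gC_even (β : ℝ) (j : ℕ) : gC β (2 * j + 2) = cm β (j + 1) := by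
  ext q
  have h1 : Even (2 * j + 2) := ⟨j + 1, by ring⟩
  have h2 : (2 * j + 2) / 2 = j + 1 := by omega
  simp only [gC, G, ContinuousMap.coe_mk, h1, h2, cm_apply]
  simp

theorem nat_cases_mode (n : ℕ) : n = 0 ∨ (∃ j, n = 2 * j + 1) ∨ ∃ j, n = 2 * j + 2 := by
  rcases n.even_or_odd' with ⟨j, rfl | rfl⟩
  · cases j with
    | zero => simp
    | succ j => exact Or.inr (Or.inr ⟨j, by ring⟩)
  · exact Or.inr (Or.inl ⟨j, rfl⟩)

theorem nuIn_gC (β : ℝ) (m n : ℕ) : nuIn β (gC β m) (gC β n) = if m = n then 1 else 0 := by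
  have h2 : (√2)⁻¹ * ((√2)⁻¹ * 2) = (1 : ℝ) := by
    rw [← mul_assoc, ← mul_inv, Real.mul_self_sqrt (by norm_num)]; norm_num
  rcases nat_cases_mode m with rfl | ⟨j, rfl⟩ | ⟨j, rfl⟩ <;>
    rcases nat_cases_mode n with rfl | ⟨k, rfl⟩ | ⟨k, rfl⟩
  · rw [gC_zero, nuIn_smul_left, nuIn_smul_right, nuIn_cm_cm]
    norm_num
    linarith
  · rw [gC_zero, gC_odd, nuIn_smul_left, nuIn_cm_sm]
    simp
  · rw [gC_zero, gC_even, nuIn_smul_left, nuIn_cm_cm]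
    simp
  · rw [gC_zero, gC_odd, nuIn_smul_right, nuIn_comm, nuIn_cm_sm]
    simp
  · rw [gC_odd, gC_odd, nuIn_sm_sm]
    simp
  · rw [gC_even, gC_odd, nuIn_comm, nuIn_cm_sm, if_neg (by omega)]
  · rw [gC_zero, gC_even, nuIn_smul_right, nuIn_cm_cm]
    simp
  · rw [gC_even, gC_odd, nuIn_cm_sm, if_neg (by omega)]
  · rw [gC_even, gC_even, nuIn_cm_cm]
    simp

theorem contDiff_gC (β : ℝ) (n : ℕ) : ContDiff ℝ ∞ (fun x : ℝ => gC β n (x : Torus)) := by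
  rcases nat_cases_mode n with rfl | ⟨j, rfl⟩ | ⟨j, rfl⟩
  · rw [gC_zero]; exact contDiff_const.mul (contDiff_cm β 0)
  · rw [gC_odd]; exact contDiff_sm β _
  · rw [gC_even]; exact contDiff_cm β _

/-- The derivative of `G_n`. -/
def gD (β : ℝ) (n : ℕ) : C(Torus, ℝ) := ⟨torusDeriv (G β n), (isC1_G β n).2⟩

theorem HasD.unique {η η' ξ : C(Torus, ℝ)} (h : HasD η η') (h' : HasD η ξ) : η' = ξ := by
  ext q
  induction q using QuotientAddGroup.induction_on with
  | H x => exact (h x).unique (h' x)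

theorem hasD_gC (β : ℝ) (n : ℕ) : HasD (gC β n) (gD β n) := fun x => by
  have h1 := ((contDiff_gC β n).differentiable (by simp) x).hasDerivAt
  refine h1.congr_deriv ?_
  have := deriv_comp_const_add (f := fun s : ℝ => gC β n (s : Torus)) x 0
  rw [add_zero] at this
  rw [← this]
  simp [gD, torusDeriv, gC]

theorem gD_zero (β : ℝ) : gD β 0 = (√2)⁻¹ • cmD β 0 := by
  have h := hasD_gC β 0
  rw [gC_zero] at h
  exact h.unique ((hasD_cm β 0).smul _)

theorem gD_odd (β : ℝ) (j : ℕ) : gD β (2 * j + 1) = smD β (j + 1) := by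
  have h := hasD_gC β (2 * j + 1)
  rw [gC_odd] at h
  exact h.unique (hasD_sm β _)

theorem gD_even (β : ℝ) (j : ℕ) : gD β (2 * j + 2) = cmD β (j + 1) := by
  have h := hasD_gC β (2 * j + 2)
  rw [gC_even] at h
  exact h.unique (hasD_cm β _)

theorem cmD_zero (β : ℝ) : cmD β 0 = (β / 2) • sm β 1 := by
  rw [cmD, dV_mul_cm_zero]; simp

theorem cmD_succ (β : ℝ) (k : ℕ) :
    cmD β (k + 1) = -((k + 1 : ℝ) • sm β (k + 1)) + (β / 4) • (sm β (k + 2) - sm β k) := by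
  rw [cmD, dV_mul_cm_succ, smul_smul]
  push_cast
  congr 2; ring

theorem smD_succ (β : ℝ) (k : ℕ) :
    smD β (k + 1) = (k + 1 : ℝ) • cm β (k + 1) + (β / 4) • (cm β k - cm β (k + 2)) := by
  rw [smD, dV_mul_sm_succ, smul_smul]
  push_cast
  congr 2; ring

theorem norm_cm_succ (β : ℝ) (k : ℕ) : ‖tv β (cm β (k + 1)) 1‖ = 1 := by
  have : ‖tv β (cm β (k + 1)) 1‖ ^ 2 = 1 := by rw [norm_tv_one_sq, nuIn_cm_cm]; simp
  nlinarith [norm_nonneg (tv β (cm β (k + 1)) 1)]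

theorem norm_sm_succ (β : ℝ) (k : ℕ) : ‖tv β (sm β (k + 1)) 1‖ = 1 := by
  have : ‖tv β (sm β (k + 1)) 1‖ ^ 2 = 1 := by rw [norm_tv_one_sq, nuIn_sm_sm]; simp
  nlinarith [norm_nonneg (tv β (sm β (k + 1)) 1)]

theorem norm_cm_le (β : ℝ) (k : ℕ) : ‖tv β (cm β k) 1‖ ≤ 2 := by
  have : ‖tv β (cm β k) 1‖ ^ 2 ≤ 2 := by
    rw [norm_tv_one_sq, nuIn_cm_cm]; split_ifs <;> norm_num
  nlinarith [norm_nonneg (tv β (cm β k) 1)]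

theorem norm_sm_le (β : ℝ) (k : ℕ) : ‖tv β (sm β k) 1‖ ≤ 1 := by
  cases k with
  | zero => rw [sm_zero, tv_zero_left]; simp
  | succ k => exact (norm_sm_succ β k).le

/-! ## Decay along the modes -/

/-- A sequence with `(k + 1) N (k + 1) ≤ a + b (N k + N (k + 2))` satisfies
`limsup k N k ≤ a`. -/
theorem eventually_mul_le {N : ℕ → ℝ} {a b M : ℝ} (hb : 0 ≤ b) (hN : ∀ k, 0 ≤ N k)
    (hM : ∀ k, N k ≤ M) (h : ∀ k : ℕ, (k + 1) * N (k + 1) ≤ a + b * (N k + N (k + 2))) {δ : ℝ}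
    (hδ : 0 < δ) : ∃ K₀ : ℕ, ∀ K : ℕ, K₀ ≤ K → K * N K ≤ a + δ := by
  -- The recurrence is used twice: boundedness of N first gives N = O(1/k), hence N → 0, and then
  -- the neighbour terms on the right-hand side tend to 0.
  have h1 : ∀ k : ℕ, N (k + 1) ≤ (a + b * (M + M)) * (1 / ((k : ℝ) + 1)) := by
    intro k
    rw [mul_one_div, le_div_iff₀ (by positivity), mul_comm]
    exact (h k).trans (by gcongr <;> exact hM _)
  have h2 : Filter.Tendsto (fun k => N (k + 1)) Filter.atTop (nhds 0) := by
    refine squeeze_zero (fun k => hN _) h1 ?_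
    simpa using (tendsto_one_div_add_atTop_nhds_zero_nat (𝕜 := ℝ)).const_mul (a + b * (M + M))
  have h3 : Filter.Tendsto N Filter.atTop (nhds 0) := (Filter.tendsto_add_atTop_iff_nat 1).1 h2
  have h4 : Filter.Tendsto (fun k => b * (N k + N (k + 2))) Filter.atTop (nhds 0) := by
    simpa using (h3.add ((Filter.tendsto_add_atTop_iff_nat 2).2 h3)).const_mul b
  obtain ⟨K₀, hK⟩ := Filter.eventually_atTop.1 (h4.eventually_le_const hδ)
  refine ⟨K₀ + 1, fun K hKK => ?_⟩
  obtain ⟨k, rfl⟩ : ∃ k, K = k + 1 := ⟨K - 1, by omega⟩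
  have := hK k (by omega)
  push_cast
  linarith [h k]

/-- The size of the images of the `k`-th modes under `A` and its adjoint. -/
def modeSize (β : ℝ) (k : ℕ) : ℝ :=
  max (max ‖A β (tv β (cm β k) (hpoly β 1))‖ ‖A β (tv β (sm β k) (hpoly β 1))‖)
    (max ‖ContinuousLinearMap.adjoint (A β) (tv β (cm β k) 1)‖
      ‖ContinuousLinearMap.adjoint (A β) (tv β (sm β k) 1)‖)

theorem norm_tv_hpoly {β : ℝ} (hβ : 0 < β) (η : C(Torus, ℝ)) (l : ℕ) :
    ‖tv β η (hpoly β l)‖ = ‖tv β η 1‖ := by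
  rw [norm_tv, gE_hpoly_mul hβ]; simp

/-- The vector is √β T η, since T η = pη', and ‖A T‖ ≤ 1. The adjoint version below uses that βV'η -
η' is √β T*(η H₁). -/
theorem norm_A_derivative_le {β : ℝ} (hβ : 0 < β) {η η' : C(Torus, ℝ)} (h : HasD η η')
    (hη : ContDiff ℝ ∞ (fun x : ℝ => η (x : Torus))) :
    ‖A β (tv β η' (hpoly β 1))‖ ≤ √β * ‖tv β η 1‖ := by
  rw [hpoly_one hβ, tv_smul_right, map_smul, norm_smul, Real.norm_of_nonneg (Real.sqrt_nonneg _)]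
  exact mul_le_mul_of_nonneg_left (norm_A_apply_le_of_mem (tv_one_mem_hamPiGraph β h hη))
    (Real.sqrt_nonneg _)

theorem norm_adjoint_A_derivative_le {β : ℝ} (hβ : 0 < β) {η η' : C(Torus, ℝ)} (h : HasD η η') :
    ‖ContinuousLinearMap.adjoint (A β) (tv β (β • (dV * η) - η') 1)‖ ≤ √β * ‖tv β η 1‖ := by
  have h1 : ‖tv β η (hpoly β 1)‖ = ‖tv β η 1‖ := norm_tv_hpoly hβ η 1
  have h2 : √β * ‖tv β η 1‖ = ‖√β • tv β η (hpoly β 1)‖ := by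
    rw [norm_smul, Real.norm_of_nonneg (Real.sqrt_nonneg _), h1]
  rw [h2]
  refine norm_adjoint_A_apply_le_of fun ψ w hw => ?_
  rw [inner_smul_right, inner_hamPi_tv hβ hw h, gE_X_mul_hpoly hβ, if_pos rfl, ← mul_assoc,
    mul_inv_cancel₀ (Real.sqrt_pos.2 hβ).ne', one_mul]

/-- Solve the formulas for the derivatives of the modes: (k+1) times a mode is a derivative, or an
adjoint derivative, of its partner plus β/4 times the difference of two neighbours. On (adjoint)
derivatives of unit modes, A and A* have norm at most √β. -/
theorem modeSize_succ_le {β : ℝ} (hβ : 0 < β) (k : ℕ) :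
    (k + 1) * modeSize β (k + 1) ≤ √β + β / 4 * (modeSize β k + modeSize β (k + 2)) := by
  have hk : (0 : ℝ) ≤ k + 1 := by positivity
  have aux : ∀ {x d y z : L2 β} {B : L2 β →L[ℝ] L2 β}, (k + 1 : ℝ) • x = d + (β / 4) • (y - z) →
      ‖B d‖ ≤ √β → ∀ m n, ‖B y‖ ≤ m → ‖B z‖ ≤ n → (k + 1) * ‖B x‖ ≤ √β + β / 4 * (m + n) := by
    intro x d y z B e h1 m n h2 h3
    have h4 : (k + 1) * ‖B x‖ = ‖B ((k + 1 : ℝ) • x)‖ := by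
      rw [map_smul, norm_smul, Real.norm_of_nonneg hk]
    rw [h4, e, map_add, map_smul, map_sub]
    refine (norm_add_le _ _).trans (add_le_add h1 ?_)
    rw [norm_smul, Real.norm_of_nonneg (by positivity)]
    exact mul_le_mul_of_nonneg_left ((norm_sub_le _ _).trans (add_le_add h2 h3)) (by positivity)
  have n1 (j : ℕ) : ‖A β (tv β (cm β j) (hpoly β 1))‖ ≤ modeSize β j := by simp [modeSize]
  have n2 (j : ℕ) : ‖A β (tv β (sm β j) (hpoly β 1))‖ ≤ modeSize β j := by simp [modeSize]
  have n3 (j : ℕ) : ‖ContinuousLinearMap.adjoint (A β) (tv β (cm β j) 1)‖ ≤ modeSize β j := by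
    simp [modeSize]
  have n4 (j : ℕ) : ‖ContinuousLinearMap.adjoint (A β) (tv β (sm β j) 1)‖ ≤ modeSize β j := by
    simp [modeSize]
  conv_lhs => rw [modeSize, mul_max_of_nonneg _ _ hk, mul_max_of_nonneg _ _ hk,
    mul_max_of_nonneg _ _ hk]
  refine max_le (max_le ?_ ?_) (max_le ?_ ?_)
  · rw [add_comm (modeSize β k)]
    refine aux (d := tv β (smD β (k + 1)) (hpoly β 1)) ?_ ?_ _ _ (n1 _) (n1 _)
    · rw [← tv_smul_left, ← tv_sub_left, ← tv_smul_left, ← tv_add_left, smD_succ]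
      congr 1
      module
    · have := norm_A_derivative_le hβ (hasD_sm β (k + 1)) (contDiff_sm β _)
      rwa [norm_sm_succ, mul_one] at this
  · rw [add_comm (modeSize β k)]
    refine aux (d := -tv β (cmD β (k + 1)) (hpoly β 1)) (y := tv β (sm β (k + 2)) (hpoly β 1))
      (z := tv β (sm β k) (hpoly β 1)) ?_ ?_ _ _ (n2 _) (n2 _)
    · rw [← tv_neg_left, ← tv_smul_left, ← tv_sub_left, ← tv_smul_left, ← tv_add_left, cmD_succ]
      congr 1
      module
    · have := norm_A_derivative_le hβ (hasD_cm β (k + 1)) (contDiff_cm β _)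
      rwa [norm_cm_succ, mul_one, ← norm_neg, ← map_neg] at this
  · refine aux (d := -tv β (β • (dV * sm β (k + 1)) - smD β (k + 1)) 1) (y := tv β (cm β k) 1)
      (z := tv β (cm β (k + 2)) 1) ?_ ?_ _ _ (n3 _) (n3 _)
    · rw [← tv_neg_left, ← tv_smul_left, ← tv_sub_left, ← tv_smul_left, ← tv_add_left, smD_succ,
        dV_mul_sm_succ]
      congr 1
      module
    · have := norm_adjoint_A_derivative_le hβ (hasD_sm β (k + 1))
      rwa [norm_sm_succ, mul_one, ← norm_neg, ← map_neg] at this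
  · refine aux (d := tv β (β • (dV * cm β (k + 1)) - cmD β (k + 1)) 1) (y := tv β (sm β k) 1)
      (z := tv β (sm β (k + 2)) 1) ?_ ?_ _ _ (n4 _) (n4 _)
    · rw [← tv_smul_left, ← tv_sub_left, ← tv_smul_left, ← tv_add_left, cmD_succ, dV_mul_cm_succ]
      congr 1
      module
    · have := norm_adjoint_A_derivative_le hβ (hasD_cm β (k + 1))
      rwa [norm_cm_succ, mul_one] at this

theorem modeSize_nonneg (β : ℝ) (k : ℕ) : 0 ≤ modeSize β k := by
  unfold modeSize
  exact le_max_of_le_left (le_max_of_le_left (norm_nonneg _))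

theorem modeSize_le_one {β : ℝ} (hβ : 0 < β) (k : ℕ) : modeSize β k ≤ 1 := by
  have h1 := norm_cm_le β k
  have h2 := norm_sm_le β k
  refine max_le (max_le ?_ ?_) (max_le ?_ ?_)
  · refine (norm_A_apply_le β _).trans ?_
    rw [norm_tv_hpoly hβ]; linarith
  · refine (norm_A_apply_le β _).trans ?_
    rw [norm_tv_hpoly hβ]; linarith
  · exact (norm_adjoint_A_apply_le β _).trans (by linarith)
  · exact (norm_adjoint_A_apply_le β _).trans (by linarith)

theorem eventually_modeSize_le {β : ℝ} (hβ : 0 < β) {δ : ℝ} (hδ : 0 < δ) :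
    ∃ K₀ : ℕ, ∀ K : ℕ, K₀ ≤ K → K * modeSize β K ≤ √β + δ :=
  eventually_mul_le (by positivity) (modeSize_nonneg β) (modeSize_le_one hβ)
    (modeSize_succ_le hβ) hδ

/-! ### Overlaps of the constant function with the modes -/

theorem nuIn_adjoint_derivative (β : ℝ) {η η' : C(Torus, ℝ)} (h : HasD η η') :
    nuIn β 1 (β • (dV * η) - η') = 0 := by
  rw [nuIn_sub_right, nuIn_smul_right]
  have := integral_nu_deriv β η'.continuous h
  simp only [nuIn, ContinuousMap.one_apply, one_mul, ContinuousMap.mul_apply, dV_apply]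
  rw [this, sub_self]

/-- Integration by parts against the cosine modes is a two-step recurrence for these overlaps, with
zero initial values. -/
theorem nuIn_one_sm {β : ℝ} (hβ : 0 < β) (k : ℕ) : nuIn β 1 (sm β k) = 0 := by
  have h0 : nuIn β 1 (sm β 0) = 0 := by rw [sm_zero]; simp [nuIn]
  have h1 : nuIn β 1 (sm β 1) = 0 := by
    have := nuIn_adjoint_derivative β (hasD_cm β 0)
    rw [dV_mul_cm_zero, cmD_zero, ← sub_smul, nuIn_smul_right] at this
    have hne : β - β / 2 ≠ 0 := by linarith
    exact (mul_eq_zero.1 this).resolve_left hne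
  have h2 : ∀ k, nuIn β 1 (sm β k) = 0 ∧ nuIn β 1 (sm β (k + 1)) = 0 := by
    intro k
    induction k with
    | zero => exact ⟨h0, h1⟩
    | succ k ih =>
      refine ⟨ih.2, ?_⟩
      have := nuIn_adjoint_derivative β (hasD_cm β (k + 1))
      rw [dV_mul_cm_succ, cmD_succ] at this
      simp only [nuIn_sub_right, nuIn_add_right, nuIn_smul_right, nuIn_neg_right, ih.1, ih.2] at this
      have h3 : β / 4 * nuIn β 1 (sm β (k + 2)) = 0 := by linarith
      exact (mul_eq_zero.1 h3).resolve_left (by positivity)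
  exact (h2 k).1

theorem nuIn_one_cm_succ (β : ℝ) (k : ℕ) : (k + 1) * nuIn β 1 (cm β (k + 1)) =
    β / 4 * (nuIn β 1 (cm β k) - nuIn β 1 (cm β (k + 2))) := by
  have := nuIn_adjoint_derivative β (hasD_sm β (k + 1))
  rw [dV_mul_sm_succ, smD_succ] at this
  simp only [nuIn_sub_right, nuIn_add_right, nuIn_smul_right] at this
  linarith

theorem abs_nuIn_one_le (β : ℝ) (η : C(Torus, ℝ)) : |nuIn β 1 η| ≤ ‖tv β η 1‖ := by
  have h1 := abs_real_inner_le_norm (one β) (tv β η 1)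
  rwa [norm_one, one_mul, one_eq_tv, inner_tv, mul_one, gE_one, mul_one] at h1

/-- The recurrence of `nuIn_one_cm_succ` has no source term (a = 0), so the overlaps are o(1/K). -/
theorem eventually_abs_nuIn_cm_le {β : ℝ} (hβ : 0 < β) {δ : ℝ} (hδ : 0 < δ) :
    ∃ K₀ : ℕ, ∀ K : ℕ, K₀ ≤ K → K * |nuIn β 1 (cm β K)| ≤ δ := by
  have := eventually_mul_le (N := fun k => |nuIn β 1 (cm β k)|) (a := 0) (b := β / 4) (M := 2)
    (by positivity) (fun k => abs_nonneg _)
    (fun k => (abs_nuIn_one_le β _).trans (norm_cm_le β k)) (fun k => ?_) hδ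
  · simpa using this
  · have hk : (0 : ℝ) ≤ k + 1 := by positivity
    rw [← abs_of_nonneg hk, ← abs_mul, nuIn_one_cm_succ, abs_mul, abs_of_pos (by positivity),
      zero_add]
    exact mul_le_mul_of_nonneg_left (abs_sub _ _) (by positivity)

/-- This is the derivative of the truncated expansion of 1. The function 1 has zero derivative, and
accordingly the recurrence of the overlaps cancels everything except a boundary term at the top
frequencies. -/
theorem sum_nuIn_gD {β : ℝ} (hβ : 0 < β) (n : ℕ) :
    ∑ k ∈ Finset.range (2 * n + 1), nuIn β 1 (gC β k) • gD β k =
      (β / 4) • (nuIn β 1 (cm β n) • sm β (n + 1) + nuIn β 1 (cm β (n + 1)) • sm β n) := by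
  induction n with
  | zero =>
    simp only [mul_zero, zero_add, Finset.sum_range_one]
    rw [gC_zero, gD_zero, cmD_zero, nuIn_smul_right, sm_zero, smul_zero, add_zero, smul_smul,
      smul_smul, smul_smul]
    congr 1
    have h2 : (√2)⁻¹ * (√2)⁻¹ = (1 / 2 : ℝ) := by
      rw [← mul_inv, Real.mul_self_sqrt (by norm_num)]; norm_num
    linear_combination (nuIn β 1 (cm β 0) * β / 2) * h2
  | succ n ih =>
    have e : 2 * (n + 1) + 1 = 2 * n + 1 + 1 + 1 := by ring
    rw [e, Finset.sum_range_succ, Finset.sum_range_succ, ih, gC_odd, nuIn_one_sm hβ, zero_smul,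
      add_zero, show 2 * n + 1 + 1 = 2 * n + 2 from rfl, gC_even, gD_even, cmD_succ]
    have h := nuIn_one_cm_succ β n
    set y0 := nuIn β 1 (cm β n)
    set y1 := nuIn β 1 (cm β (n + 1))
    set y2 := nuIn β 1 (cm β (n + 2))
    have h' : y0 * (β / 4) = (n + 1) * y1 + β / 4 * y2 := by linarith
    have : (β / 4) • (y0 • sm β (n + 1) + y1 • sm β n) =
        ((n + 1) * y1 + β / 4 * y2) • sm β (n + 1) + (β / 4 * y1) • sm β n := by
      rw [← h']; module
    rw [this]
    module

/-! ## The tensor basis and the Galerkin projector -/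

theorem eVec_eq_tv (β : ℝ) {K L : ℕ} (i : Idx K L) :
    eVec β i = tv β (gC β i.1) (hpoly β i.2) :=
  toLp_eq_iff _ _ fun x => by simp [e, gC, H_eq_hpoly]

theorem genVec_eq_genTv (β γ : ℝ) {K L : ℕ} (i : Idx K L) :
    genVec β γ i = genTv β γ (gC β i.1) (gD β i.1) (hpoly β i.2) := by
  unfold genVec genTv hamTv tv
  rw [← MemLp.toLp_sub, ← MemLp.toLp_const_smul, ← MemLp.toLp_add]
  refine toLp_eq_iff _ _ fun x => ?_
  have h := congrFun (gen_poly β γ (hasD_gC β i.1) (hpoly β i.2)) x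
  have e : e β i.1 i.2 = fun x => gC β i.1 x.1 * (hpoly β i.2).eval x.2 := by
    funext x; simp [e, gC, H_eq_hpoly]
  rw [e, h]
  simp

theorem genAdjVec_eq_genTv (β γ : ℝ) {K L : ℕ} (i : Idx K L) :
    genAdjVec β γ i = -genTv β (-γ) (gC β i.1) (gD β i.1) (hpoly β i.2) := by
  rw [← genVec_eq_genTv]
  unfold genVec genAdjVec
  rw [← MemLp.toLp_neg]
  refine toLp_eq_iff _ _ fun x => ?_
  simp [gen, genAdj]
  ring

theorem orthonormal_eVec {β : ℝ} (hβ : 0 < β) (K L : ℕ) :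
    Orthonormal ℝ (eVec β (K := K) (L := L)) := by
  rw [orthonormal_iff_ite]
  rintro ⟨k, l⟩ ⟨k', l'⟩
  rw [eVec_eq_tv, eVec_eq_tv, inner_tv, nuIn_gC, gE_hpoly_mul hβ]
  simp only [Prod.mk.injEq, Fin.val_inj]
  split_ifs <;> simp_all

theorem projKL_apply (β : ℝ) (K L : ℕ) (φ : L2 β) :
    projKL β K L φ = ∑ i : Idx K L, ⟪eVec β i, φ⟫_ℝ • eVec β i := by
  simp [projKL]

theorem genPi_apply (β γ : ℝ) (K L : ℕ) (φ : L2 β) :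
    genPi β γ K L φ = ∑ i : Idx K L, ⟪eVec β i, φ⟫_ℝ • genVec β γ i := by
  simp [genPi]

theorem genAdjPi_apply (β γ : ℝ) (K L : ℕ) (φ : L2 β) :
    genAdjPi β γ K L φ = ∑ i : Idx K L, ⟪eVec β i, φ⟫_ℝ • genAdjVec β γ i := by
  simp [genAdjPi]

theorem inner_eVec_projKL {β : ℝ} (hβ : 0 < β) {K L : ℕ} (i : Idx K L) (φ : L2 β) :
    ⟪eVec β i, projKL β K L φ⟫_ℝ = ⟪eVec β i, φ⟫_ℝ := by
  rw [projKL_apply]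
  exact (orthonormal_eVec hβ K L).inner_right_fintype _ i

theorem projKL_mem (β : ℝ) (K L : ℕ) (φ : L2 β) : projKL β K L φ ∈ galerkin β K L := by
  rw [projKL_apply]
  exact Submodule.sum_mem _ fun i _ => Submodule.smul_mem _ _ (Submodule.subset_span ⟨i, rfl⟩)

theorem projKL_eq_self {β : ℝ} (hβ : 0 < β) {K L : ℕ} {φ : L2 β} (h : φ ∈ galerkin β K L) :
    projKL β K L φ = φ := by
  induction h using Submodule.span_induction with
  | mem x hx =>
    obtain ⟨i, rfl⟩ := hx
    rw [projKL_apply]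
    simp [orthonormal_iff_ite.1 (orthonormal_eVec hβ K L)]
  | zero => simp
  | add x y _ _ hx hy => rw [map_add, hx, hy]
  | smul c x _ hx => rw [map_smul, hx]

theorem inner_projKL_left {β : ℝ} (K L : ℕ) (φ ψ : L2 β) :
    ⟪projKL β K L φ, ψ⟫_ℝ = ⟪φ, projKL β K L ψ⟫_ℝ := by
  simp only [projKL_apply, sum_inner, inner_sum, inner_smul_left, inner_smul_right,
    RCLike.conj_to_real]
  refine Finset.sum_congr rfl fun i _ => ?_
  rw [real_inner_comm φ]
  ring

/-- Finite-rank operators on an orthonormal family are bounded by the Hilbert-Schmidt norm. -/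
theorem norm_sum_smulRight_le {E ι : Type*} [NormedAddCommGroup E] [InnerProductSpace ℝ E]
    [Fintype ι] {v : ι → E} (hv : Orthonormal ℝ v) (w : ι → E) {c : ℝ} (hc : 0 ≤ c)
    (h : ∑ i, ‖w i‖ ^ 2 ≤ c ^ 2) (φ : E) : ‖∑ i, ⟪v i, φ⟫_ℝ • w i‖ ≤ c * ‖φ‖ := by
  have h1 : ‖∑ i, ⟪v i, φ⟫_ℝ • w i‖ ≤ ∑ i, |⟪v i, φ⟫_ℝ| * ‖w i‖ :=
    (norm_sum_le _ _).trans (Finset.sum_le_sum fun i _ => (norm_smul _ _).le)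
  have h2 := Finset.sum_mul_sq_le_sq_mul_sq Finset.univ (fun i => |⟪v i, φ⟫_ℝ|) (fun i => ‖w i‖)
  have h3 : ∑ i, |⟪v i, φ⟫_ℝ| ^ 2 ≤ ‖φ‖ ^ 2 := by
    simpa using hv.sum_inner_products_le φ (s := Finset.univ)
  refine h1.trans (abs_le_of_sq_le_sq' (h2.trans ?_) (by positivity)).2
  rw [mul_pow, mul_comm (c ^ 2)]
  exact mul_le_mul h3 h (by positivity) (by positivity)

/-! ## Residuals of the projection in the position -/

/-- The residual of the projection onto the first `n` position modes. -/
def qRes (β : ℝ) (n : ℕ) : C(Torus, ℝ) →ₗ[ℝ] C(Torus, ℝ) where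
  toFun η := η - ∑ k : Fin n, nuIn β (gC β k) η • gC β k
  map_add' η ξ := by
    simp only [nuIn_add_right, add_smul, Finset.sum_add_distrib]; abel
  map_smul' c η := by
    simp only [nuIn_smul_right, mul_smul, smul_sub, Finset.smul_sum, RingHom.id_apply]

theorem qRes_apply (β : ℝ) (n : ℕ) (η : C(Torus, ℝ)) :
    qRes β n η = η - ∑ k : Fin n, nuIn β (gC β k) η • gC β k := rfl

theorem qRes_gC_lt (β : ℝ) {n k : ℕ} (h : k < n) : qRes β n (gC β k) = 0 := by
  rw [qRes_apply, Finset.sum_eq_single (⟨k, h⟩ : Fin n)]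
  · simp [nuIn_gC]
  · intro b _ hb
    rw [nuIn_gC, if_neg (fun e => hb (Fin.ext e)), zero_smul]
  · simp

theorem qRes_gC_ge (β : ℝ) {n k : ℕ} (h : n ≤ k) : qRes β n (gC β k) = gC β k := by
  rw [qRes_apply, Finset.sum_eq_zero, sub_zero]
  intro b _
  rw [nuIn_gC, if_neg (by have := b.2; omega), zero_smul]

theorem qRes_sm_lt (β : ℝ) {K k : ℕ} (h : k < K) : qRes β (2 * K - 1) (sm β k) = 0 := by
  cases k with
  | zero => rw [sm_zero, map_zero]
  | succ k => rw [← gC_odd, qRes_gC_lt]; omega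

theorem qRes_sm_self (β : ℝ) {K : ℕ} (h : 0 < K) : qRes β (2 * K - 1) (sm β K) = sm β K := by
  obtain ⟨k, rfl⟩ : ∃ k, K = k + 1 := ⟨K - 1, by omega⟩
  rw [← gC_odd, qRes_gC_ge]; omega

theorem qRes_cm_lt (β : ℝ) {K k : ℕ} (h : k < K) : qRes β (2 * K - 1) (cm β k) = 0 := by
  cases k with
  | zero =>
    have h2 : cm β 0 = √2 • gC β 0 := by
      rw [gC_zero, smul_smul, mul_inv_cancel₀ (by positivity), one_smul]
    rw [h2, map_smul, qRes_gC_lt β (by omega), smul_zero]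
  | succ k => rw [← gC_even, qRes_gC_lt]; omega

theorem qRes_cm_self (β : ℝ) {K : ℕ} (h : 0 < K) : qRes β (2 * K - 1) (cm β K) = cm β K := by
  obtain ⟨k, rfl⟩ : ∃ k, K = k + 1 := ⟨K - 1, by omega⟩
  rw [← gC_even, qRes_gC_ge]; omega

/-- The derivatives of the position modes leave the Galerkin space only for the last two modes. -/
theorem qRes_gD (β : ℝ) {K k : ℕ} (hK : 2 ≤ K) (hk : k < 2 * K - 1) :
    qRes β (2 * K - 1) (gD β k) = 0 ∨
      (k = 2 * K - 2 ∧ qRes β (2 * K - 1) (gD β k) = (β / 4) • sm β K) ∨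
      (k = 2 * K - 3 ∧ qRes β (2 * K - 1) (gD β k) = -((β / 4) • cm β K)) := by
  rcases nat_cases_mode k with rfl | ⟨j, rfl⟩ | ⟨j, rfl⟩
  · left
    rw [gD_zero, cmD_zero, map_smul, map_smul, qRes_sm_lt β (by omega), smul_zero, smul_zero]
  · rw [gD_odd, smD_succ, map_add, map_smul, map_smul, map_sub, qRes_cm_lt β (by omega),
      qRes_cm_lt β (by omega), smul_zero, zero_add, zero_sub]
    by_cases h : j + 2 = K
    · right; right
      refine ⟨by omega, ?_⟩
      rw [h, qRes_cm_self β (by omega), smul_neg]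
    · left
      rw [qRes_cm_lt β (by omega), neg_zero, smul_zero]
  · rw [gD_even, cmD_succ, map_add, map_neg, map_smul, map_smul, map_sub,
      qRes_sm_lt β (K := K) (k := j) (by omega), qRes_sm_lt β (K := K) (k := j + 1) (by omega),
      smul_zero, neg_zero, zero_add, sub_zero]
    by_cases h : j + 2 = K
    · right; left
      refine ⟨by omega, ?_⟩
      rw [h, qRes_sm_self β (by omega)]
    · left
      rw [qRes_sm_lt β (by omega), smul_zero]

/-- For a mode g, the combination 2g' - βV'g has the same frequency, hence no residual. So lowering
in l leaves the same residual as raising, up to the sign. -/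
theorem qRes_gD_sub (β : ℝ) {K k : ℕ} (hk : k < 2 * K - 1) :
    qRes β (2 * K - 1) (gD β k - β • (dV * gC β k)) = -qRes β (2 * K - 1) (gD β k) := by
  have h : qRes β (2 * K - 1) ((2 : ℝ) • gD β k - β • (dV * gC β k)) = 0 := by
    rcases nat_cases_mode k with rfl | ⟨j, rfl⟩ | ⟨j, rfl⟩
    · have : (2 : ℝ) • gD β 0 - β • (dV * gC β 0) = 0 := by
        rw [gD_zero, gC_zero, mul_smul_comm, dV_mul_cm_zero, cmD_zero]
        module
      rw [this, map_zero]
    · have : (2 : ℝ) • gD β (2 * j + 1) - β • (dV * gC β (2 * j + 1)) =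
          (2 * (j + 1 : ℝ)) • cm β (j + 1) := by
        rw [gD_odd, gC_odd, smD]
        push_cast
        module
      rw [this, map_smul, qRes_cm_lt β (by omega), smul_zero]
    · have : (2 : ℝ) • gD β (2 * j + 2) - β • (dV * gC β (2 * j + 2)) =
          (-(2 * (j + 1 : ℝ))) • sm β (j + 1) := by
        rw [gD_even, gC_even, cmD]
        push_cast
        module
      rw [this, map_smul, qRes_sm_lt β (by omega), smul_zero]
  rw [eq_neg_iff_add_eq_zero, ← map_add, ← h]
  congr 1
  module

/-- The continuously differentiable functions on the torus. -/
def diffSub : Submodule ℝ C(Torus, ℝ) where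
  carrier := {η | ∃ η', HasD η η'}
  add_mem' := fun ⟨_, h⟩ ⟨_, h'⟩ => ⟨_, h.add h'⟩
  zero_mem' := ⟨0, fun x => hasDerivAt_const x 0⟩
  smul_mem' := fun c _ ⟨_, h⟩ => ⟨_, h.smul c⟩

theorem cm_mem_diffSub (β : ℝ) (k : ℕ) : cm β k ∈ diffSub := ⟨_, hasD_cm β k⟩

theorem sm_mem_diffSub (β : ℝ) (k : ℕ) : sm β k ∈ diffSub := ⟨_, hasD_sm β k⟩

theorem gC_mem_diffSub (β : ℝ) (k : ℕ) : gC β k ∈ diffSub := ⟨_, hasD_gC β k⟩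

/-- A is shown to vanish on tensors by integrating by parts, so every position factor met below must
be differentiable; all of them are finite combinations of modes. -/
theorem dV_mul_gC_mem_diffSub (β : ℝ) (k : ℕ) : dV * gC β k ∈ diffSub := by
  rcases nat_cases_mode k with rfl | ⟨j, rfl⟩ | ⟨j, rfl⟩
  · rw [gC_zero, mul_smul_comm, dV_mul_cm_zero]
    exact Submodule.smul_mem _ _ (sm_mem_diffSub β _)
  · rw [gC_odd, dV_mul_sm_succ]
    exact Submodule.smul_mem _ _ (Submodule.sub_mem _ (cm_mem_diffSub β _) (cm_mem_diffSub β _))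
  · rw [gC_even, dV_mul_cm_succ]
    exact Submodule.smul_mem _ _ (Submodule.sub_mem _ (sm_mem_diffSub β _) (sm_mem_diffSub β _))

theorem gD_mem_diffSub (β : ℝ) (k : ℕ) : gD β k ∈ diffSub := by
  rcases nat_cases_mode k with rfl | ⟨j, rfl⟩ | ⟨j, rfl⟩
  · rw [gD_zero, cmD_zero]
    exact Submodule.smul_mem _ _ (Submodule.smul_mem _ _ (sm_mem_diffSub β _))
  · rw [gD_odd, smD, ← gC_odd]
    exact Submodule.add_mem _ (Submodule.smul_mem _ _ (cm_mem_diffSub β _))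
      (Submodule.smul_mem _ _ (dV_mul_gC_mem_diffSub β _))
  · rw [gD_even, cmD, ← gC_even]
    exact Submodule.add_mem _ (Submodule.neg_mem _ (Submodule.smul_mem _ _ (sm_mem_diffSub β _)))
      (Submodule.smul_mem _ _ (dV_mul_gC_mem_diffSub β _))

theorem qRes_mem_diffSub (β : ℝ) (n : ℕ) {η : C(Torus, ℝ)} (h : η ∈ diffSub) :
    qRes β n η ∈ diffSub := by
  rw [qRes_apply]
  exact Submodule.sub_mem _ h (Submodule.sum_mem _ fun k _ =>
    Submodule.smul_mem _ _ (gC_mem_diffSub β k))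

theorem sub_projKL_tv {β : ℝ} (hβ : 0 < β) {K L l : ℕ} (hl : l < L) (η : C(Torus, ℝ)) :
    tv β η (hpoly β l) - projKL β K L (tv β η (hpoly β l)) =
      tv β (qRes β (2 * K - 1) η) (hpoly β l) := by
  rw [projKL_apply, qRes_apply, tv_sub_left]
  congr 1
  rw [Fintype.sum_prod_type]
  have : ∀ s : Finset (Fin (2 * K - 1)), tv β (∑ k ∈ s, nuIn β (gC β k) η • gC β k)
      (hpoly β l) = ∑ k ∈ s, nuIn β (gC β k) η • tv β (gC β k) (hpoly β l) := by
    intro s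
    induction s using Finset.induction_on with
    | empty => simp [tv_zero_left]
    | insert a s ha ih => rw [Finset.sum_insert ha, Finset.sum_insert ha, tv_add_left, ih,
        tv_smul_left]
  rw [this]
  refine Finset.sum_congr rfl fun k _ => ?_
  rw [Finset.sum_eq_single (⟨l, hl⟩ : Fin L)]
  · rw [eVec_eq_tv, inner_tv, gE_hpoly_mul hβ, if_pos rfl, mul_one]
  · intro m _ hm
    rw [eVec_eq_tv, inner_tv, gE_hpoly_mul hβ, if_neg (fun e => hm (Fin.ext e)), mul_zero,
      zero_smul]
  · simp

theorem sub_projKL_tv_ge {β : ℝ} (hβ : 0 < β) {K L l : ℕ} (hl : L ≤ l) (η : C(Torus, ℝ)) :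
    tv β η (hpoly β l) - projKL β K L (tv β η (hpoly β l)) = tv β η (hpoly β l) := by
  rw [projKL_apply, Finset.sum_eq_zero, sub_zero]
  intro i _
  rw [eVec_eq_tv, inner_tv, gE_hpoly_mul hβ, if_neg (by have := i.2.2; omega), mul_zero, zero_smul]

/-! ## The consistency error -/

theorem X_mul_hpoly_zero {β : ℝ} (hβ : 0 < β) :
    Polynomial.X * hpoly β 0 = (√β)⁻¹ • hpoly β 1 := by
  rw [hpoly_zero, hpoly_one hβ, smul_smul, inv_mul_cancel₀ (Real.sqrt_pos.2 hβ).ne', one_smul,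
    mul_one]

theorem X_mul_hpoly_succ {β : ℝ} (hβ : 0 < β) (l : ℕ) :
    Polynomial.X * hpoly β (l + 1) =
      ((√β)⁻¹ * √(l + 2 : ℝ)) • hpoly β (l + 2) + ((√β)⁻¹ * √(l + 1 : ℝ)) • hpoly β l := by
  have hb : √β ≠ 0 := (Real.sqrt_pos.2 hβ).ne'
  have h := hpoly_succ hβ (l + 1)
  rw [derivative_hpoly_succ] at h
  have e : ((l + 1 : ℕ) : ℝ) + 1 = l + 2 := by push_cast; ring
  rw [e] at h
  have e2 : (√β)⁻¹ * (√β)⁻¹ * (√β * √(l + 1 : ℝ)) = (√β)⁻¹ * √(l + 1 : ℝ) := by field_simp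
  rw [mul_smul, h, smul_sub, smul_smul, smul_smul, smul_smul, inv_mul_cancel₀ hb, one_smul, e2,
    sub_add_cancel]

theorem ouPoly_hpoly {β : ℝ} (hβ : 0 < β) (l : ℕ) : ouPoly β (hpoly β l) = -(l : ℝ) • hpoly β l := by
  have hb : √β ≠ 0 := (Real.sqrt_pos.2 hβ).ne'
  have hb2 : √β * √β = β := Real.mul_self_sqrt hβ.le
  cases l with
  | zero => simp [ouPoly, derivative_hpoly_zero]
  | succ l =>
    have h := hpoly_succ hβ l
    have hl : √(l + 1 : ℝ) * √(l + 1 : ℝ) = l + 1 := Real.mul_self_sqrt (by positivity)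
    have h1 : Polynomial.X * hpoly β l = (√β)⁻¹ • (√(l + 1 : ℝ) • hpoly β (l + 1) +
        (√β)⁻¹ • (hpoly β l).derivative) := by
      rw [h, sub_add_cancel, smul_smul, inv_mul_cancel₀ hb, one_smul]
    rw [ouPoly, derivative_hpoly_succ, mul_smul_comm, h1, Polynomial.derivative_smul]
    have hi : β⁻¹ = (√β)⁻¹ * (√β)⁻¹ := by rw [← mul_inv, hb2]
    rw [hi]
    push_cast
    simp only [smul_add, smul_smul]
    have e1 : √β * √(l + 1 : ℝ) * ((√β)⁻¹ * √(l + 1 : ℝ)) = l + 1 :=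
      (by field_simp : _ = √(l + 1 : ℝ) * √(l + 1 : ℝ)).trans hl
    have e2 : √β * √(l + 1 : ℝ) * ((√β)⁻¹ * (√β)⁻¹) = (√β)⁻¹ * (√β)⁻¹ * (√β * √(l + 1 : ℝ)) := by
      ring
    rw [e1, e2]
    module

theorem hamTv_hpoly_zero {β : ℝ} (hβ : 0 < β) (η η' : C(Torus, ℝ)) :
    hamTv β η η' (hpoly β 0) = (√β)⁻¹ • tv β η' (hpoly β 1) := by
  rw [hamTv, derivative_hpoly_zero, tv_zero_right, sub_zero, X_mul_hpoly_zero hβ, tv_smul_right]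

/-- In the Hermite basis L_ham raises l through ∂_q and lowers it through ∂_q - βV'. -/
theorem hamTv_hpoly_succ {β : ℝ} (hβ : 0 < β) (η η' : C(Torus, ℝ)) (l : ℕ) :
    hamTv β η η' (hpoly β (l + 1)) =
      ((√β)⁻¹ * √(l + 2 : ℝ)) • tv β η' (hpoly β (l + 2)) +
        ((√β)⁻¹ * √(l + 1 : ℝ)) • tv β (η' - β • (dV * η)) (hpoly β l) := by
  have hb : √β ≠ 0 := (Real.sqrt_pos.2 hβ).ne'
  have hb2 : √β * √β = β := Real.mul_self_sqrt hβ.le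
  rw [hamTv, derivative_hpoly_succ, X_mul_hpoly_succ hβ, tv_add_right, tv_smul_right,
    tv_smul_right, tv_smul_right, tv_sub_left, tv_smul_left, smul_sub, smul_smul _ β]
  have e : (√β)⁻¹ * √(l + 1 : ℝ) * β = √β * √(l + 1 : ℝ) := by
    nth_rewrite 2 [← hb2]; field_simp
  rw [e]
  abel

theorem A_tv_hpoly_eq_zero {β : ℝ} (hβ : 0 < β) {η : C(Torus, ℝ)} (h : η ∈ diffSub) {l : ℕ}
    (hl : l ≠ 1) : A β (tv β η (hpoly β l)) = 0 := by
  obtain ⟨η', hη⟩ := h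
  exact A_tv_eq_zero hβ hη (by rw [gE_X_mul_hpoly hβ, if_neg hl])

theorem adjoint_A_tv_hpoly_eq_zero {β : ℝ} (hβ : 0 < β) (η : C(Torus, ℝ)) {l : ℕ}
    (hl : l ≠ 0) : ContinuousLinearMap.adjoint (A β) (tv β η (hpoly β l)) = 0 := by
  refine adjoint_A_tv_eq_zero ?_
  have := gE_hpoly_mul hβ l 0
  rwa [hpoly_zero, mul_one, if_neg hl] at this

/-- The operator whose norm enters the discrete rate. -/
def symErr (β : ℝ) (K L : ℕ) : L2 β →L[ℝ] L2 β :=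
  (A β + ContinuousLinearMap.adjoint (A β)) ∘L
    (ContinuousLinearMap.id ℝ (L2 β) - projKL β K L)

theorem symErr_apply (β : ℝ) (K L : ℕ) (φ : L2 β) : symErr β K L φ =
    A β (φ - projKL β K L φ) + ContinuousLinearMap.adjoint (A β) (φ - projKL β K L φ) := by
  simp [symErr]
  abel

theorem symErr_tv_eq_zero {β : ℝ} (hβ : 0 < β) {K L l : ℕ} {η : C(Torus, ℝ)} (h : η ∈ diffSub)
    (hl : 2 ≤ l) : symErr β K L (tv β η (hpoly β l)) = 0 := by
  rw [symErr_apply]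
  rcases lt_or_ge l L with h1 | h1
  · rw [sub_projKL_tv hβ h1, A_tv_hpoly_eq_zero hβ (qRes_mem_diffSub β _ h) (by omega),
      adjoint_A_tv_hpoly_eq_zero hβ _ (by omega), add_zero]
  · rw [sub_projKL_tv_ge hβ h1, A_tv_hpoly_eq_zero hβ h (by omega),
      adjoint_A_tv_hpoly_eq_zero hβ _ (by omega), add_zero]

theorem symErr_tv_one {β : ℝ} (hβ : 0 < β) {K L : ℕ} (hL : 2 ≤ L) (η : C(Torus, ℝ)) :
    symErr β K L (tv β η (hpoly β 1)) = A β (tv β (qRes β (2 * K - 1) η) (hpoly β 1)) := by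
  rw [symErr_apply, sub_projKL_tv hβ (by omega), adjoint_A_tv_hpoly_eq_zero hβ _ one_ne_zero,
    add_zero]

theorem symErr_tv_zero {β : ℝ} (hβ : 0 < β) {K L : ℕ} (hL : 2 ≤ L) {η : C(Torus, ℝ)}
    (h : η ∈ diffSub) : symErr β K L (tv β η (hpoly β 0)) =
      ContinuousLinearMap.adjoint (A β) (tv β (qRes β (2 * K - 1) η) 1) := by
  rw [symErr_apply, sub_projKL_tv hβ (by omega),
    A_tv_hpoly_eq_zero hβ (qRes_mem_diffSub β _ h) zero_ne_one, zero_add, hpoly_zero]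

/-- L_FD multiplies e_kl by -l and stays in the Galerkin space, so the consistency error does not
depend on γ. -/
theorem symErr_genVec {β : ℝ} (hβ : 0 < β) (γ : ℝ) {K L : ℕ} (i : Idx K L) :
    symErr β K L (genVec β γ i) = symErr β K L (hamTv β (gC β i.1) (gD β i.1) (hpoly β i.2)) := by
  have h : symErr β K L (tv β (gC β i.1) (hpoly β i.2)) = 0 := by
    rw [← eVec_eq_tv, symErr_apply, projKL_eq_self hβ (Submodule.subset_span ⟨i, rfl⟩), sub_self,
      map_zero, map_zero, add_zero]
  rw [genVec_eq_genTv, genTv, map_add, map_smul, ouPoly_hpoly hβ, tv_smul_right, map_smul, h,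
    smul_zero, smul_zero, add_zero]

/-- Here c is the indicator of the two modes of frequency K - 1, the only ones whose derivative
leaves the span; the residual is ± β/4 times a mode of frequency K. -/
theorem norm_qRes_le {β : ℝ} (hβ : 0 < β) {K k : ℕ} (hK : 2 ≤ K) (hk : k < 2 * K - 1) {c : ℝ}
    (hc : c = (if k = 2 * K - 2 then 1 else 0) + if k = 2 * K - 3 then 1 else 0) :
    ‖A β (tv β (qRes β (2 * K - 1) (gD β k)) (hpoly β 1))‖ ^ 2 ≤ c * (β / 4 * modeSize β K) ^ 2 ∧
    ‖ContinuousLinearMap.adjoint (A β) (tv β (qRes β (2 * K - 1) (gD β k)) 1)‖ ^ 2 ≤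
      c * (β / 4 * modeSize β K) ^ 2 := by
  have aux : ∀ (B : L2 β →L[ℝ] L2 β) (x : L2 β), ‖B x‖ ≤ modeSize β K →
      ‖B ((β / 4) • x)‖ ^ 2 ≤ (β / 4 * modeSize β K) ^ 2 := by
    intro B x h
    rw [map_smul, norm_smul, Real.norm_of_nonneg (by positivity)]
    gcongr
  have hc0 : 0 ≤ c := by rw [hc]; positivity
  rcases qRes_gD β hK hk with h | ⟨h1, h⟩ | ⟨h1, h⟩
  · rw [h, tv_zero_left, tv_zero_left, map_zero, map_zero, norm_zero]
    simp only [ne_eq, OfNat.ofNat_ne_zero, not_false_eq_true, zero_pow]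
    exact ⟨by positivity, by positivity⟩
  · have : c = 1 := by rw [hc, if_pos h1, if_neg (by omega), add_zero]
    rw [h, this, one_mul, tv_smul_left, tv_smul_left]
    exact ⟨aux _ _ (by simp [modeSize]), aux _ _ (by simp [modeSize])⟩
  · have : c = 1 := by rw [hc, if_neg (by omega), if_pos h1, zero_add]
    rw [h, this, one_mul, tv_neg_left, tv_neg_left, map_neg, map_neg, norm_neg, norm_neg,
      tv_smul_left, tv_smul_left]
    exact ⟨aux _ _ (by simp [modeSize]), aux _ _ (by simp [modeSize])⟩

/-- Weights in l: from l = 0 raising reaches l = 1, seen by A; from l = 1 lowering reaches l = 0,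
seen by A*; from l = 2 lowering reaches l = 1 with amplitude √2, whence the weight 2. All other
images have l ≥ 2 and are invisible. -/
theorem norm_symErr_genVec_le {β : ℝ} (hβ : 0 < β) (γ : ℝ) {K L : ℕ} (hK : 2 ≤ K) (hL : 2 ≤ L)
    (i : Idx K L) : ‖symErr β K L (genVec β γ i)‖ ^ 2 ≤
      (((if (i.1 : ℕ) = 2 * K - 2 then 1 else 0) + if (i.1 : ℕ) = 2 * K - 3 then 1 else 0) *
        ((if (i.2 : ℕ) = 0 then 1 else 0) + (if (i.2 : ℕ) = 1 then 1 else 0) +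
          if (i.2 : ℕ) = 2 then 2 else 0)) * (β / 16 * modeSize β K ^ 2) := by
  obtain ⟨⟨k, hk⟩, ⟨l, hl⟩⟩ := i
  rw [symErr_genVec hβ]
  simp only
  set c : ℝ := (if k = 2 * K - 2 then 1 else 0) + if k = 2 * K - 3 then 1 else 0 with hc
  obtain ⟨h1, h2⟩ := norm_qRes_le hβ hK hk hc
  have hb : 0 < √β := Real.sqrt_pos.2 hβ
  have hb2 : (√β)⁻¹ ^ 2 = β⁻¹ := by rw [inv_pow, Real.sq_sqrt hβ.le]
  have hc0 : 0 ≤ c := by rw [hc]; positivity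
  have hD := gD_mem_diffSub β k
  have hD' : gD β k - β • (dV * gC β k) ∈ diffSub :=
    Submodule.sub_mem _ hD (Submodule.smul_mem _ _ (dV_mul_gC_mem_diffSub β k))
  have e : c * (β / 4 * modeSize β K) ^ 2 = β * (c * (β / 16 * modeSize β K ^ 2)) := by ring
  rw [e] at h1 h2
  have key : ∀ x : L2 β, ‖x‖ ^ 2 ≤ β * (c * (β / 16 * modeSize β K ^ 2)) →
      ‖(√β)⁻¹ • x‖ ^ 2 ≤ c * (β / 16 * modeSize β K ^ 2) := by
    intro x hx
    rw [norm_smul, mul_pow, Real.norm_of_nonneg (by positivity), hb2, inv_mul_le_iff₀ hβ]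
    exact hx
  match l with
  | 0 =>
    rw [hamTv_hpoly_zero hβ, map_smul, symErr_tv_one hβ hL]
    simpa using key _ h1
  | 1 =>
    rw [hamTv_hpoly_succ hβ, map_add, map_smul, map_smul,
      symErr_tv_eq_zero hβ hD le_rfl, symErr_tv_zero hβ hL hD', qRes_gD_sub β hk, tv_neg_left,
      map_neg, smul_zero, zero_add, smul_neg, norm_neg]
    simpa using key _ h2
  | 2 =>
    rw [hamTv_hpoly_succ hβ, map_add, map_smul, map_smul,
      symErr_tv_eq_zero hβ hD (by omega), symErr_tv_one hβ hL, qRes_gD_sub β hk, tv_neg_left,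
      map_neg, smul_zero, zero_add, smul_neg, norm_neg, mul_comm (√β)⁻¹, mul_smul, norm_smul, mul_pow]
    have := key _ h1
    have e2 : ‖√((1 : ℕ) + 1 : ℝ)‖ ^ 2 = 2 := by
      rw [Real.norm_of_nonneg (Real.sqrt_nonneg _), Real.sq_sqrt (by positivity)]; norm_num
    rw [e2]
    norm_num
    linarith
  | l + 3 =>
    rw [hamTv_hpoly_succ hβ, map_add, map_smul, map_smul,
      symErr_tv_eq_zero hβ hD (by omega), symErr_tv_eq_zero hβ hD' (by omega)]
    simp

/-- Hilbert-Schmidt bound: two modes in q times 1 + 1 + 2 in l gives 8, and 8 β/16 = β/2 is the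
square of √2/2 √β. -/
theorem norm_symErr_genPi_le {β : ℝ} (hβ : 0 < β) (γ : ℝ) {K L : ℕ} (hK : 2 ≤ K) (hL : 2 ≤ L) :
    ‖symErr β K L ∘L genPi β γ K L‖ ≤ √2 / 2 * √β * modeSize β K := by
  have hN := modeSize_nonneg β K
  refine ContinuousLinearMap.opNorm_le_bound _ (by positivity) fun φ => ?_
  have h : (symErr β K L ∘L genPi β γ K L) φ =
      ∑ i : Idx K L, ⟪eVec β i, φ⟫_ℝ • symErr β K L (genVec β γ i) := by
    simp [genPi_apply, map_sum]
  rw [h]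
  refine norm_sum_smulRight_le (orthonormal_eVec hβ K L) _ (by positivity) ?_ φ
  refine (Finset.sum_le_sum fun i _ => norm_symErr_genVec_le hβ γ hK hL i).trans ?_
  rw [← Finset.sum_mul]
  have e : (√2 / 2 * √β * modeSize β K) ^ 2 = 8 * (β / 16 * modeSize β K ^ 2) := by
    rw [mul_pow, mul_pow, div_pow, Real.sq_sqrt (by norm_num), Real.sq_sqrt hβ.le]; ring
  rw [e]
  refine mul_le_mul_of_nonneg_right ?_ (by positivity)
  rw [Fintype.sum_prod_type]
  refine (Finset.sum_mul_sum Finset.univ Finset.univ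
    (fun k : Fin (2 * K - 1) => (if (k : ℕ) = 2 * K - 2 then (1 : ℝ) else 0) +
      if (k : ℕ) = 2 * K - 3 then 1 else 0)
    (fun l : Fin L => (if (l : ℕ) = 0 then (1 : ℝ) else 0) + (if (l : ℕ) = 1 then 1 else 0) +
      if (l : ℕ) = 2 then 2 else 0)).symm.trans_le ?_
  have hv : ∑ l : Fin L, ((if (l : ℕ) = 0 then (1 : ℝ) else 0) + (if (l : ℕ) = 1 then 1 else 0) +
      if (l : ℕ) = 2 then 2 else 0) ≤ 4 := by
    rw [Fin.sum_univ_eq_sum_range (fun l : ℕ => (if l = 0 then (1 : ℝ) else 0) +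
      (if l = 1 then 1 else 0) + if l = 2 then 2 else 0) L, Finset.sum_add_distrib,
      Finset.sum_add_distrib, Finset.sum_ite_eq', Finset.sum_ite_eq', Finset.sum_ite_eq']
    split_ifs <;> norm_num
  have hw : ∑ k : Fin (2 * K - 1), ((if (k : ℕ) = 2 * K - 2 then (1 : ℝ) else 0) +
      if (k : ℕ) = 2 * K - 3 then 1 else 0) ≤ 2 := by
    rw [Fin.sum_univ_eq_sum_range (fun k : ℕ => (if k = 2 * K - 2 then (1 : ℝ) else 0) +
      if k = 2 * K - 3 then 1 else 0) (2 * K - 1), Finset.sum_add_distrib,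
      Finset.sum_ite_eq', Finset.sum_ite_eq']
    split_ifs <;> norm_num
  have := mul_le_mul hw hv (Finset.sum_nonneg fun l _ => by positivity) (by norm_num)
  linarith

/-! ## The approximation of the constant function -/

theorem inner_eVec_one {β : ℝ} (hβ : 0 < β) {K L : ℕ} (i : Idx K L) :
    ⟪eVec β i, one β⟫_ℝ = nuIn β 1 (gC β i.1) * if (i.2 : ℕ) = 0 then 1 else 0 := by
  have := gE_hpoly_mul hβ i.2 0
  rw [eVec_eq_tv, one_eq_tv, inner_tv, ← hpoly_zero β, this, nuIn_comm]

theorem nuIn_one_gC_zero_pos (β : ℝ) : 0 < nuIn β 1 (gC β 0) := by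
  have h : ∀ q, 0 < gC β 0 q := by
    intro q
    have := Z_pos β
    simp only [gC, G, ContinuousMap.coe_mk, if_true]
    positivity
  simp only [nuIn, ContinuousMap.one_apply, one_mul]
  rw [integral_pos_iff_support_of_nonneg (fun q => (h q).le) (continuous_integrable_nu β _)]
  have : Function.support (gC β 0) = Set.univ := by
    ext q; simp [(h q).ne']
  rw [this, measure_univ]
  exact one_pos

/-- A single coefficient gives a lower bound independent of K and L, as needed to normalise u. -/
theorem norm_projKL_one_ge {β : ℝ} (hβ : 0 < β) {K L : ℕ} (hK : 1 ≤ K) (hL : 1 ≤ L) :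
    nuIn β 1 (gC β 0) ≤ ‖projKL β K L (one β)‖ := by
  let i : Idx K L := (⟨0, by omega⟩, ⟨0, by omega⟩)
  have h1 := real_inner_le_norm (eVec β i) (projKL β K L (one β))
  rw [inner_eVec_projKL hβ, inner_eVec_one hβ, (orthonormal_eVec hβ K L).1 i, one_mul, if_pos rfl,
    mul_one] at h1
  exact h1

/-- The projection of 1 has only l = 0, where L* reduces to -L_ham and raises to l = 1; the sum over
the modes is that of `sum_nuIn_gD`. -/
theorem genAdjPi_projKL_one {β : ℝ} (hβ : 0 < β) (γ : ℝ) {K L : ℕ} (hK : 1 ≤ K) (hL : 1 ≤ L) :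
    genAdjPi β γ K L (projKL β K L (one β)) = -((√β)⁻¹ •
      tv β ((β / 4) • (nuIn β 1 (cm β (K - 1)) • sm β K + nuIn β 1 (cm β K) • sm β (K - 1)))
        (hpoly β 1)) := by
  obtain ⟨n, rfl⟩ : ∃ n, K = n + 1 := ⟨K - 1, by omega⟩
  obtain ⟨L', rfl⟩ : ∃ n, L = n + 1 := ⟨L - 1, by omega⟩
  rw [Nat.add_sub_cancel, ← sum_nuIn_gD hβ, genAdjPi_apply, Fintype.sum_prod_type]
  have h1 : ∀ s : Finset ℕ, tv β (∑ k ∈ s, nuIn β 1 (gC β k) • gD β k) (hpoly β 1) =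
      ∑ k ∈ s, nuIn β 1 (gC β k) • tv β (gD β k) (hpoly β 1) := by
    intro s
    induction s using Finset.induction_on with
    | empty => simp [tv_zero_left]
    | insert a s ha ih => rw [Finset.sum_insert ha, Finset.sum_insert ha, tv_add_left, ih,
        tv_smul_left]
  rw [h1, ← smul_neg, ← Finset.sum_neg_distrib, Finset.smul_sum,
    show 2 * n + 1 = 2 * (n + 1) - 1 by omega,
    ← Fin.sum_univ_eq_sum_range (fun k => (√β)⁻¹ • -(nuIn β 1 (gC β k) •
      tv β (gD β k) (hpoly β 1)))]
  refine Finset.sum_congr rfl fun k _ => ?_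
  rw [Finset.sum_eq_single (0 : Fin (L' + 1))]
  · rw [inner_eVec_projKL hβ, inner_eVec_one hβ, genAdjVec_eq_genTv]
    simp only [Fin.val_zero, if_true, mul_one]
    rw [genTv, hamTv_hpoly_zero hβ, ouPoly_hpoly hβ]
    simp only [Nat.cast_zero, neg_zero, zero_smul, tv_zero_right, smul_zero, add_zero]
    module
  · intro l _ hl
    rw [inner_eVec_projKL hβ, inner_eVec_one hβ, if_neg, mul_zero, zero_smul]
    exact fun e => hl (Fin.ext e)
  · simp

theorem norm_genAdjPi_uVec_le {β : ℝ} (hβ : 0 < β) (γ : ℝ) {K L : ℕ} (hK : 1 ≤ K) (hL : 1 ≤ L) :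
    ‖genAdjPi β γ K L (uVec β K L)‖ ≤ (nuIn β 1 (gC β 0))⁻¹ * ((√β)⁻¹ *
      (β / 4 * (|nuIn β 1 (cm β (K - 1))| + |nuIn β 1 (cm β K)|))) := by
  have h0 := nuIn_one_gC_zero_pos β
  have h1 := norm_projKL_one_ge hβ hK hL
  rw [uVec, map_smul, norm_smul, genAdjPi_projKL_one hβ γ hK hL, norm_neg, norm_smul,
    norm_tv_hpoly hβ, tv_smul_left, norm_smul, norm_inv, norm_norm,
    Real.norm_of_nonneg (by positivity), Real.norm_of_nonneg (by positivity)]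
  gcongr
  rw [tv_add_left, tv_smul_left, tv_smul_left]
  refine (norm_add_le _ _).trans (add_le_add ?_ ?_)
  · rw [norm_smul, Real.norm_eq_abs]
    exact mul_le_of_le_one_right (abs_nonneg _) (norm_sm_le β _)
  · rw [norm_smul, Real.norm_eq_abs]
    exact mul_le_of_le_one_right (abs_nonneg _) (norm_sm_le β _)

/-- The consistency error of the discretization. -/
def consErr (β γ : ℝ) (K L : ℕ) : ℝ :=
  ‖symErr β K L ∘L genPi β γ K L‖ + ‖genAdjPi β γ K L (uVec β K L)‖

theorem discreteRate_eq (β γ ε lt : ℝ) (K L : ℕ) :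
    discreteRate β γ ε lt K L = rate ε lt - ε / (1 + ε) * consErr β γ K L := rfl

theorem exists_consErr_le {β : ℝ} (hβ : 0 < β) : ∃ K₁ : ℕ, 2 ≤ K₁ ∧ ∀ γ : ℝ, ∀ K L : ℕ,
    K₁ ≤ K → 2 ≤ L → consErr β γ K L ≤ (1 + √2) * β / (2 * K) := by
  have hb : 0 < √β := Real.sqrt_pos.2 hβ
  have hb2 : √β * √β = β := Real.mul_self_sqrt hβ.le
  have h0 := nuIn_one_gC_zero_pos β
  -- The slack β/2 beyond √2 β/2 is shared equally. This δ costs √2 β/8 ≤ β/4 in the operator norm;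
  -- the next one leaves β/4 for L* u.
  obtain ⟨K₁, h1⟩ := eventually_modeSize_le hβ (δ := √β / 4) (by positivity)
  obtain ⟨K₂, h2⟩ := eventually_abs_nuIn_cm_le hβ
    (δ := nuIn β 1 (gC β 0) * √β / 3) (by positivity)
  refine ⟨K₁ + K₂ + 2, by omega, fun γ K L hK hL => ?_⟩
  have hK0 : (2 : ℝ) ≤ K := by exact_mod_cast (by omega : 2 ≤ K)
  have a1 := h1 K (by omega)
  have a2 := h2 K (by omega)
  have a3 := h2 (K - 1) (by omega)
  rw [Nat.cast_sub (by omega), Nat.cast_one] at a3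
  have n3 := abs_nonneg (nuIn β 1 (cm β (K - 1)))
  have b1 := norm_symErr_genPi_le hβ γ (K := K) (L := L) (by omega) hL
  have b2 := norm_genAdjPi_uVec_le hβ γ (K := K) (L := L) (by omega) (by omega)
  -- As K ≤ 2(K - 1), the overlap at K - 1 costs two thirds and the one at K one third.
  have c2 : K * (|nuIn β 1 (cm β (K - 1))| + |nuIn β 1 (cm β K)|) ≤
      nuIn β 1 (gC β 0) * √β := by nlinarith
  have c3 : K * ((nuIn β 1 (gC β 0))⁻¹ * ((√β)⁻¹ *
      (β / 4 * (|nuIn β 1 (cm β (K - 1))| + |nuIn β 1 (cm β K)|)))) ≤ β / 4 := by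
    calc _ = (nuIn β 1 (gC β 0))⁻¹ * ((√β)⁻¹ * (β / 4)) *
          (K * (|nuIn β 1 (cm β (K - 1))| + |nuIn β 1 (cm β K)|)) := by ring
      _ ≤ (nuIn β 1 (gC β 0))⁻¹ * ((√β)⁻¹ * (β / 4)) * (nuIn β 1 (gC β 0) * √β) := by gcongr
      _ = β / 4 := by field_simp
  have c1 : K * (√2 / 2 * √β * modeSize β K) ≤ √2 / 2 * β + β / 4 := by
    have h2' : √2 ≤ 2 := by
      rw [Real.sqrt_le_left (by norm_num)]; norm_num
    calc _ = √2 / 2 * √β * (K * modeSize β K) := by ring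
      _ ≤ √2 / 2 * √β * (√β + √β / 4) := by gcongr
      _ = √2 / 2 * β + √2 / 2 * β / 4 
          := by linear_combination (√2 / 2 * (5 / 4)) * hb2
      _ ≤ _ := by nlinarith
  rw [consErr, le_div_iff₀ (by positivity)]
  have d1 := mul_le_mul_of_nonneg_left b1 (by positivity : (0 : ℝ) ≤ K)
  have d2 := mul_le_mul_of_nonneg_left b2 (by positivity : (0 : ℝ) ≤ K)
  nlinarith

/-! ## The defect of the constant function in the position -/

theorem orthonormal_gVec (β : ℝ) (n : ℕ) : Orthonormal ℝ (fun k : Fin n => gVec β k) := by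
  rw [orthonormal_iff_ite]
  intro i j
  have h : ⟪gVec β i, gVec β j⟫_ℝ = nuIn β (gC β i) (gC β j) := by
    rw [L2.inner_def, nuIn]
    refine integral_congr_ae ?_
    filter_upwards [(memLp_G β i).coeFn_toLp, (memLp_G β j).coeFn_toLp] with x hx hx'
    simp only [gVec, hx, hx', gC, ContinuousMap.coe_mk]
    simp [mul_comm]
  rw [h, nuIn_gC]
  simp only [Fin.val_inj]

/-- Pythagoras, the subtracted sum being an orthogonal projection of 1. Its role is to make the
denominator of the defect term nonnegative. -/
theorem qDefect_sq_le_one (β : ℝ) (K : ℕ) : qDefect β K ^ 2 ≤ 1 := by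
  have hn : ‖oneNu β‖ ≤ 1 := by
    refine (Lp.norm_const_le (p := 2) (μ := nu β) (c := (1 : ℝ))).trans ?_
    simp
  have ho := orthonormal_gVec β (2 * K - 1)
  set s := ∑ k : Fin (2 * K - 1), ⟪gVec β k, oneNu β⟫_ℝ • gVec β k with hs
  have h1 : ⟪oneNu β, s⟫_ℝ = ⟪s, s⟫_ℝ := by
    conv_rhs => rw [hs, sum_inner]
    rw [hs, inner_sum]
    refine Finset.sum_congr rfl fun i _ => ?_
    rw [inner_smul_right, inner_smul_left, ho.inner_right_fintype _ i, real_inner_comm]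
    simp
  have h2 : qDefect β K ^ 2 = ‖oneNu β‖ ^ 2 - ‖s‖ ^ 2 := by
    rw [qDefect, ← hs, norm_sub_sq_real, h1, real_inner_self_eq_norm_sq]; ring
  rw [h2]
  nlinarith [norm_nonneg (oneNu β), sq_nonneg ‖s‖]

/-! ## Coercivity on the domain of the generator -/

theorem inner_snd_one_of_mem {β γ : ℝ} (hβ : 0 < β) {φ g : L2 β}
    (h : WithLp.toLp 2 (φ, g) ∈ genGraph β γ) : ⟪g, one β⟫_ℝ = 0 := by
  refine genGraph_induction (p := fun z => ⟪z.snd, one β⟫_ℝ = 0) ?_ (fun f hf => ?_) _ h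
  · exact isClosed_eq (by fun_prop) (by fun_prop)
  · show ⟪((hf.gen β γ).memLp β).toLp (gen β γ f), one β⟫_ℝ = 0
    rw [toLp_gen _ hf, inner_add_left, inner_smul_left, inner_ham_one hβ hf, inner_fd_one hβ hf]
    simp

/-- The inequality is closed once written for φ minus its mean, so it extends from the core to the
graph, which contains the Galerkin functions and the orbits starting in the domain. -/
theorem Coercive.of_mem {β γ ε lam : ℝ} (h : Coercive β γ ε lam) {φ g : L2 β}
    (hm : WithLp.toLp 2 (φ, g) ∈ genGraph β γ) (h0 : ⟪φ, one β⟫_ℝ = 0) :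
    lam * ‖φ‖ ^ 2 ≤ modInner β ε (-g) φ := by
  have key := genGraph_induction (p := fun z => lam * ‖z.fst - ⟪z.fst, one β⟫_ℝ • one β‖ ^ 2 ≤
    modInner β ε (-z.snd) (z.fst - ⟪z.fst, one β⟫_ℝ • one β)) ?_ (fun f hf => ?_) _ hm
  · simpa [h0] using key
  · unfold modInner
    exact isClosed_le (by fun_prop) (by fun_prop)
  · refine h f hf _ _ ?_ ?_
    · show (hf.memLp β).toLp f - ⟪(hf.memLp β).toLp f, one β⟫_ℝ • one β =ᵐ[mu β] _
      rw [← integral_eq_inner_one]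
      filter_upwards [Lp.coeFn_sub ((hf.memLp β).toLp f) ((∫ x, f x ∂(mu β)) • one β),
        (hf.memLp β).coeFn_toLp, Lp.coeFn_smul (∫ x, f x ∂(mu β)) (one β),
        one_coe β] with x h1 h2 h3 h4
      rw [h1]
      simp only [Pi.sub_apply, h2, h3, Pi.smul_apply, h4]
      simp
    · rw [gen_sub_const]
      exact ((hf.gen β γ).memLp β).coeFn_toLp

/-- Since ‖A‖ ≤ 1/2, the two terms in A cost ε together. With `modInner_self_ge` this is the norm
equivalence with constants 1 ± ε. -/
theorem abs_modInner_le (β : ℝ) {ε : ℝ} (hε : 0 ≤ ε) (φ ψ : L2 β) :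
    |modInner β ε φ ψ| ≤ (1 + ε) * (‖φ‖ * ‖ψ‖) := by
  have h0 := abs_real_inner_le_norm φ ψ
  have h1 : |⟪A β φ, ψ⟫_ℝ| ≤ 1 / 2 * (‖φ‖ * ‖ψ‖) := by
    refine (abs_real_inner_le_norm _ _).trans ?_
    rw [← mul_assoc]
    exact mul_le_mul_of_nonneg_right (norm_A_apply_le β φ) (norm_nonneg _)
  have h2 : |⟪A β ψ, φ⟫_ℝ| ≤ 1 / 2 * (‖φ‖ * ‖ψ‖) := by
    refine (abs_real_inner_le_norm _ _).trans ?_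
    rw [mul_comm ‖φ‖, ← mul_assoc]
    exact mul_le_mul_of_nonneg_right (norm_A_apply_le β ψ) (norm_nonneg _)
  rw [abs_le] at h0 h1 h2 ⊢
  unfold modInner
  constructor <;> nlinarith

theorem modInner_self_ge (β : ℝ) {ε : ℝ} (hε : 0 ≤ ε) (φ : L2 β) :
    (1 - ε) * ‖φ‖ ^ 2 ≤ modInner β ε φ φ := by
  have h1 := real_inner_le_norm (A β φ) φ
  have h2 := mul_le_mul_of_nonneg_right (norm_A_apply_le β φ) (norm_nonneg φ)
  rw [modInner, real_inner_self_eq_norm_sq]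
  nlinarith

theorem modInner_neg_left (β ε : ℝ) (φ ψ : L2 β) : modInner β ε (-φ) ψ = -modInner β ε φ ψ := by
  simp only [modInner, map_neg, inner_neg_left, inner_neg_right]; ring

theorem modInner_add_left (β ε : ℝ) (φ φ' ψ : L2 β) :
    modInner β ε (φ + φ') ψ = modInner β ε φ ψ + modInner β ε φ' ψ := by
  simp only [modInner, map_add, inner_add_left, inner_add_right]; ring

theorem hasDerivWithinAt_modInner (β ε : ℝ) {f : ℝ → L2 β} {f' : L2 β} {s : Set ℝ} {x : ℝ}
    (h : HasDerivWithinAt f f' s x) :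
    HasDerivWithinAt (fun t => modInner β ε (f t) (f t)) (2 * modInner β ε f' (f x)) s x := by
  have hA : HasDerivWithinAt (fun t => A β (f t)) (A β f') s x :=
    (A β).hasFDerivAt.comp_hasDerivWithinAt x h
  have h1 := h.inner ℝ h
  have h2 := (hA.inner ℝ h).const_mul ε
  refine ((h1.sub h2).sub h2).congr_deriv ?_
  rw [modInner, real_inner_comm f' (f x)]
  ring

/-! ## Semigroups -/

namespace IsSemigroupOf

variable {E : Type*} [NormedAddCommGroup E] [InnerProductSpace ℝ E]
  {Γ : Submodule ℝ (WithLp 2 (E × E))} {S : ℝ → E →L[ℝ] E}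

theorem apply_add (h : IsSemigroupOf Γ S) {s t : ℝ} (hs : 0 ≤ s) (ht : 0 ≤ t) (φ : E) :
    S (s + t) φ = S s (S t φ) := by rw [h.add s t hs ht]; rfl

theorem apply_zero (h : IsSemigroupOf Γ S) (φ : E) : S 0 φ = φ := by rw [h.zero]; rfl

theorem apply_mem (h : IsSemigroupOf Γ S) {φ g : E} (hm : WithLp.toLp 2 (φ, g) ∈ Γ) {t : ℝ}
    (ht : 0 ≤ t) : WithLp.toLp 2 (S t φ, S t g) ∈ Γ := by
  rw [h.generator] at hm ⊢
  refine ((S t).hasFDerivAt.comp_hasDerivWithinAt 0 hm).congr (fun s hs => ?_) ?_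
  · rw [Function.comp_apply, ← h.apply_add hs ht, ← h.apply_add ht hs, add_comm]
  · rw [Function.comp_apply, h.apply_zero, h.apply_zero]

theorem hasDerivWithinAt (h : IsSemigroupOf Γ S) {φ g : E} (hm : WithLp.toLp 2 (φ, g) ∈ Γ)
    {t : ℝ} (ht : 0 ≤ t) : HasDerivWithinAt (fun s => S s φ) (S t g) (Set.Ici t) t := by
  have h1 := (h.generator _ _).1 (h.apply_mem hm ht)
  have h2 : HasDerivWithinAt (fun s : ℝ => s - t) 1 (Set.Ici t) t :=
    (hasDerivAt_id t).hasDerivWithinAt.sub_const t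
  have h3 : HasDerivWithinAt (fun s => S s (S t φ)) (S t g) (Set.Ici 0) (t - t) := by
    rwa [sub_self]
  have h4 := HasDerivWithinAt.scomp (h := fun s => s - t) t h3 h2
    (fun s (hs : t ≤ s) => Set.mem_Ici.2 (sub_nonneg.2 hs))
  rw [one_smul] at h4
  have e : ∀ s ∈ Set.Ici t, S s φ = S (s - t) (S t φ) := fun s hs => by
    rw [← h.apply_add (sub_nonneg.2 hs) ht, sub_add_cancel]
  exact h4.congr e (e t (Set.mem_Ici.2 le_rfl))

/-- The domain of the generator is dense. -/
theorem exists_tendsto [CompleteSpace E] (h : IsSemigroupOf Γ S) (φ : E) :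
    ∃ ψ : ℝ → E, Filter.Tendsto ψ (nhdsWithin 0 (Set.Ioi 0)) (nhds φ) ∧
      ∀ r, 0 < r → ∃ g, WithLp.toLp 2 (ψ r, g) ∈ Γ := by
  -- The maximum extends the orbit continuously to negative times. The approximants are the means of
  -- the orbit over [0, r], and S_t F(r) = F(t + r) - F(t) shows that they lie in the domain.
  set u : ℝ → E := fun s => S (max s 0) φ with hu
  have hc : Continuous u :=
    (h.cont φ).comp_continuous (by fun_prop) (fun s => Set.mem_Ici.2 (le_max_right _ _))
  set F : ℝ → E := fun x => ∫ s in (0 : ℝ)..x, u s with hF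
  have hFd : ∀ x, HasDerivAt F (u x) x := fun x => (hc.integral_hasStrictDerivAt 0 x).hasDerivAt
  have hu0 : u 0 = φ := by rw [hu]; simp [h.apply_zero]
  have hshift : ∀ t r, 0 ≤ t → 0 ≤ r → S t (F r) = F (t + r) - F t := by
    intro t r ht hr
    rw [hF]
    simp only
    rw [← ContinuousLinearMap.intervalIntegral_comp_comm _ (hc.intervalIntegrable _ _),
      intervalIntegral.integral_interval_sub_left (hc.intervalIntegrable _ _)
        (hc.intervalIntegrable _ _)]
    have e := intervalIntegral.integral_comp_add_left u t (a := 0) (b := r)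
    rw [add_zero] at e
    rw [← e]
    refine intervalIntegral.integral_congr fun s hs => ?_
    rw [Set.uIcc_of_le hr] at hs
    simp only [hu]
    rw [max_eq_left hs.1, max_eq_left (add_nonneg ht hs.1), h.apply_add ht hs.1]
  refine ⟨fun r => r⁻¹ • F r, ?_, fun r hr => ⟨r⁻¹ • (u r - u 0), ?_⟩⟩
  · have h1 := (hasDerivAt_iff_tendsto_slope.1 (hFd 0)).mono_left
      (nhdsWithin_mono 0 (fun x (hx : 0 < x) => hx.ne'))
    rw [hu0] at h1
    refine h1.congr fun r => ?_
    rw [slope_def_module, sub_zero, hF]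
    simp
  · have h1 : WithLp.toLp 2 (F r, u r - u 0) ∈ Γ := by
      rw [h.generator]
      have h2 : HasDerivAt (fun t => F (t + r) - F t) (u r - u 0) 0 := by
        refine HasDerivAt.sub ?_ (hFd 0)
        refine HasDerivAt.comp_add_const 0 r ?_
        rw [zero_add]; exact hFd r
      exact h2.hasDerivWithinAt.congr (fun t ht => hshift t r ht hr.le) (hshift 0 r le_rfl hr.le)
    exact Γ.smul_mem r⁻¹ h1

end IsSemigroupOf

theorem one_mem_genGraph (β γ : ℝ) : WithLp.toLp 2 (one β, 0) ∈ genGraph β γ := by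
  have h := tv_mem_genGraph β γ (hasD_const 1) contDiff_const 1
  have e : genTv β γ (ContinuousMap.const Torus 1) 0 1 = 0 := by
    simp [genTv, hamTv, ouPoly, tv_zero_left, tv_zero_right]
  rw [e] at h
  rw [one_eq_tv]
  exact h

/-- Gronwall: exp(2rt) times the modified square norm is nonincreasing, as its derivative is
controlled by coercivity and the upper norm equivalence. The graph only gives right derivatives,
which suffice. -/
theorem norm_semigroup_le_of_mem {β γ ε lam : ℝ} (hβ : 0 < β) (hε : 0 ≤ ε)
    (hlam : 0 ≤ lam) (hco : Coercive β γ ε lam) {S : ℝ → L2 β →L[ℝ] L2 β}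
    (hS : IsSemigroupOf (genGraph β γ) S) {φ g : L2 β}
    (hm : WithLp.toLp 2 (φ, g) ∈ genGraph β γ) (h0 : ⟪φ, one β⟫_ℝ = 0) {t : ℝ} (ht : 0 ≤ t) :
    (1 - ε) * ‖S t φ‖ ^ 2 ≤ (1 + ε) * (Real.exp (-(rate ε lam) * t) * ‖φ‖) ^ 2 := by
  have hc : ContinuousOn (fun s => S s φ) (Set.Icc 0 t) :=
    (hS.cont φ).mono fun s hs => hs.1
  -- Coercivity holds for mean-zero functions, so the mean must be conserved along the orbit.
  have hmean : ∀ s ∈ Set.Icc 0 t, ⟪S s φ, one β⟫_ℝ = 0 := by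
    intro s hs
    have := constant_of_has_deriv_right_zero (f := fun s => ⟪S s φ, one β⟫_ℝ) (a := 0) (b := t)
      (hc.inner continuousOn_const) (fun x hx => ?_) s hs
    · rw [this, hS.apply_zero, h0]
    · have h1 := (hS.hasDerivWithinAt hm hx.1).inner ℝ
        (hasDerivWithinAt_const x (Set.Ici x) (one β))
      refine h1.congr_deriv ?_
      rw [inner_zero_right, zero_add, inner_snd_one_of_mem hβ (hS.apply_mem hm hx.1)]
  set r := rate ε lam with hr
  have hexp : ∀ s, HasDerivAt (fun s => Real.exp (2 * r * s)) (Real.exp (2 * r * s) * (2 * r)) s :=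
    fun s => (((hasDerivAt_id s).const_mul (2 * r)).exp).congr_deriv (by simp)
  have hmc : ContinuousOn (fun s => modInner β ε (S s φ) (S s φ)) (Set.Icc 0 t) := by
    unfold modInner
    have hA : ContinuousOn (fun s => A β (S s φ)) (Set.Icc 0 t) := (A β).continuous.comp_continuousOn hc
    exact ((hc.inner hc).sub (continuousOn_const.mul (hA.inner hc))).sub
      (continuousOn_const.mul (hA.inner hc))
  have key := image_le_of_deriv_right_le_deriv_boundary
    (f := fun s => Real.exp (2 * r * s) * modInner β ε (S s φ) (S s φ))
    (f' := fun s => Real.exp (2 * r * s) * (2 * r) * modInner β ε (S s φ) (S s φ) +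
      Real.exp (2 * r * s) * (2 * modInner β ε (S s g) (S s φ))) (a := 0) (b := t)
    (ContinuousOn.mul (by fun_prop) hmc)
    (fun s hs => (hexp s).hasDerivWithinAt.mul
      (hasDerivWithinAt_modInner β ε (hS.hasDerivWithinAt hm hs.1)))
    (B := fun _ => modInner β ε φ φ) (B' := fun _ => 0) (by simp [hS.apply_zero])
    continuousOn_const (fun s _ => hasDerivWithinAt_const _ _ _) (fun s hs => ?_)
    (Set.right_mem_Icc.2 ht)
  · have h1 := modInner_self_ge β hε (S t φ)
    have h2 := (le_abs_self _).trans (abs_modInner_le β hε φ φ)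
    have h3 : Real.exp (2 * r * t) * Real.exp (-r * t) ^ 2 = 1 := by
      rw [← Real.exp_nat_mul, ← Real.exp_add, Real.exp_eq_one_iff]; push_cast; ring
    have h4 : Real.exp (2 * r * t) * ((1 - ε) * ‖S t φ‖ ^ 2) ≤
        Real.exp (2 * r * t) * ((1 + ε) * (Real.exp (-r * t) * ‖φ‖) ^ 2) := by
      calc _ ≤ Real.exp (2 * r * t) * modInner β ε (S t φ) (S t φ) := by gcongr
        _ ≤ _ := key
        _ ≤ _ := h2
        _ = _ := by linear_combination (-(1 + ε) * ‖φ‖ ^ 2) * h3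
    exact le_of_mul_le_mul_left h4 (Real.exp_pos _)
  · have h1 := hco.of_mem (hS.apply_mem hm hs.1) (hmean s ⟨hs.1, hs.2.le⟩)
    rw [modInner_neg_left] at h1
    have h2 := (le_abs_self _).trans (abs_modInner_le β hε (S s φ) (S s φ))
    have hr0 : 0 ≤ r := div_nonneg hlam (by linarith)
    have h3 : r * (1 + ε) = lam := div_mul_cancel₀ _ (by linarith)
    have h4 : r * modInner β ε (S s φ) (S s φ) ≤ lam * ‖S s φ‖ ^ 2 := by
      calc _ ≤ r * ((1 + ε) * (‖S s φ‖ * ‖S s φ‖)) := by gcongr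
        _ = _ := by rw [← mul_assoc, h3, sq]
    have h5 : r * modInner β ε (S s φ) (S s φ) + modInner β ε (S s g) (S s φ) ≤ 0 := by linarith
    have h6 := mul_nonpos_of_nonneg_of_nonpos (Real.exp_pos (2 * r * s)).le h5
    linarith

/-- Density of the domain; the approximants are recentred to mean zero, which is possible as
constants belong to the domain. -/
theorem norm_semigroup_le {β γ ε lam : ℝ} (hβ : 0 < β) (hε : 0 ≤ ε)
    (hlam : 0 ≤ lam) (hco : Coercive β γ ε lam) {S : ℝ → L2 β →L[ℝ] L2 β}
    (hS : IsSemigroupOf (genGraph β γ) S) {φ : L2 β} (h0 : ⟪φ, one β⟫_ℝ = 0) {t : ℝ}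
    (ht : 0 ≤ t) :
    (1 - ε) * ‖S t φ‖ ^ 2 ≤ (1 + ε) * (Real.exp (-(rate ε lam) * t) * ‖φ‖) ^ 2 := by
  obtain ⟨ψ, hψ, hd⟩ := hS.exists_tendsto φ
  have h1 : Filter.Tendsto (fun r => ψ r - ⟪ψ r, one β⟫_ℝ • one β)
      (nhdsWithin 0 (Set.Ioi 0)) (nhds φ) := by
    have := hψ.sub ((hψ.inner (𝕜 := ℝ) (tendsto_const_nhds (x := one β))).smul_const (one β))
    rwa [h0, zero_smul, sub_zero] at this
  have h2 := ((((S t).continuous.tendsto φ).comp h1).norm.pow 2).const_mul (1 - ε)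
  have h3 := (((h1.norm).const_mul (Real.exp (-(rate ε lam) * t))).pow 2).const_mul (1 + ε)
  refine le_of_tendsto_of_tendsto h2 h3 ?_
  filter_upwards [self_mem_nhdsWithin] with r hr
  obtain ⟨g, hg⟩ := hd r hr
  have hm : WithLp.toLp 2 (ψ r - ⟪ψ r, one β⟫_ℝ • one β, g - ⟪ψ r, one β⟫_ℝ • 0) ∈
      genGraph β γ := (genGraph β γ).sub_mem hg
    ((genGraph β γ).smul_mem ⟪ψ r, one β⟫_ℝ (one_mem_genGraph β γ))
  refine norm_semigroup_le_of_mem hβ hε hlam hco hS hm ?_ ht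
  rw [inner_sub_left, inner_smul_left, real_inner_self_eq_norm_sq, norm_one]
  simp

theorem Admissible.semigroup_decay {β εbar lbar : ℝ} {ltil : ℝ → ℝ} (hβ : 0 < β)
    (had : Admissible β εbar lbar ltil) {γ : ℝ} (hγ : 0 < γ) {S : ℝ → L2 β →L[ℝ] L2 β}
    (hS : IsSemigroupOf (genGraph β γ) S) {φ : L2 β} (h0 : ∫ x, φ x ∂(mu β) = 0) {t : ℝ}
    (ht : 0 ≤ t) : ‖S t φ‖ ≤ (1 + εbar) / (1 - εbar) *
      Real.exp (-(rate (εbar * min γ γ⁻¹) (ltil γ)) * t) * ‖φ‖ := by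
  have e0 := had.eps_pos
  have e1 := had.eps_lt_one
  have hm0 : 0 < min γ γ⁻¹ := lt_min hγ (inv_pos.2 hγ)
  have hm1 : min γ γ⁻¹ ≤ 1 := by
    rcases le_total γ 1 with h | h
    · exact (min_le_left _ _).trans h
    · exact (min_le_right _ _).trans (inv_le_one_of_one_le₀ h)
  have hε : εbar * min γ γ⁻¹ ≤ εbar := mul_le_of_le_one_right e0.le hm1
  have hmean : ⟪φ, one β⟫_ℝ = 0 := by
    rw [← Lp.toLp_coeFn φ (Lp.memLp φ), ← integral_eq_inner_one, h0]
  have h1 := norm_semigroup_le hβ (by positivity)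
    ((mul_pos had.lbar_pos hm0).le.trans (had.lower γ hγ)) (had.coercive γ hγ) hS hmean ht
  set X := Real.exp (-(rate (εbar * min γ γ⁻¹) (ltil γ)) * t) * ‖φ‖
  have hX : 0 ≤ X := by positivity
  have h2 : (1 - εbar) * ‖S t φ‖ ^ 2 ≤ (1 + εbar) * X ^ 2 := by
    calc _ ≤ (1 - εbar * min γ γ⁻¹) * ‖S t φ‖ ^ 2 := by gcongr
      _ ≤ _ := h1
      _ ≤ _ := by gcongr
  -- The ratio is at least 1, so it dominates its square root, the constant given by the norm
  -- equivalence.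
  have hC1 : 1 ≤ (1 + εbar) / (1 - εbar) := by rw [le_div_iff₀ (by linarith)]; linarith
  rw [mul_assoc]
  refine (abs_le_of_sq_le_sq' ?_ (by positivity)).2
  have h3 : ‖S t φ‖ ^ 2 ≤ (1 + εbar) / (1 - εbar) * X ^ 2 := by
    rw [div_mul_eq_mul_div, le_div_iff₀ (by linarith)]; linarith
  calc _ ≤ _ := h3
    _ ≤ ((1 + εbar) / (1 - εbar)) ^ 2 * X ^ 2 := by
      gcongr
      exact le_self_pow₀ hC1 two_ne_zero
    _ = _ := by ring

/-! ## The discrete generator -/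

theorem inner_genVec {β : ℝ} (hβ : 0 < β) (γ : ℝ) {K L : ℕ} (i j : Idx K L) :
    ⟪eVec β i, genVec β γ j⟫_ℝ = ⟪genAdjVec β γ i, eVec β j⟫_ℝ := by
  have h1 := weak_ham_tv hβ (tv_mem_hamGraph β (hasD_gC β j.1) (contDiff_gC β j.1) (hpoly β j.2))
    (hasD_gC β i.1) (hpoly β i.2)
  have h2 : ⟪tv β (gC β i.1) (hpoly β i.2), tv β (gC β j.1) (ouPoly β (hpoly β j.2))⟫_ℝ =
      ⟪tv β (gC β i.1) (ouPoly β (hpoly β i.2)), tv β (gC β j.1) (hpoly β j.2)⟫_ℝ := by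
    rw [ouPoly_hpoly hβ, ouPoly_hpoly hβ, tv_smul_right, tv_smul_right, inner_smul_left,
      inner_smul_right, inner_tv, gE_hpoly_mul hβ, RCLike.conj_to_real]
    split_ifs with h
    · rw [h]
    · simp
  rw [genVec_eq_genTv, genAdjVec_eq_genTv, eVec_eq_tv, eVec_eq_tv, genTv, genTv, inner_neg_left,
    inner_add_left, inner_add_right, inner_smul_left, inner_smul_right, h2, real_inner_comm, h1,
    real_inner_comm (hamTv β (gC β i.1) (gD β i.1) (hpoly β i.2)), RCLike.conj_to_real]
  ring

theorem inner_genPi {β : ℝ} (hβ : 0 < β) (γ : ℝ) {K L : ℕ} {φ u : L2 β}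
    (hφ : φ ∈ galerkin β K L) (hu : u ∈ galerkin β K L) :
    ⟪u, genPi β γ K L φ⟫_ℝ = ⟪genAdjPi β γ K L u, φ⟫_ℝ := by
  conv_lhs => rw [← projKL_eq_self hβ hu]
  conv_rhs => rw [← projKL_eq_self hβ hφ]
  rw [projKL_apply, projKL_apply, genPi_apply, genAdjPi_apply]
  simp only [sum_inner, inner_sum, inner_smul_left, inner_smul_right, RCLike.conj_to_real]
  simp only [inner_genVec hβ]

theorem mem_genGraph_genPi {β : ℝ} (hβ : 0 < β) (γ : ℝ) {K L : ℕ} {φ : L2 β}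
    (hφ : φ ∈ galerkin β K L) : WithLp.toLp 2 (φ, genPi β γ K L φ) ∈ genGraph β γ := by
  induction hφ using Submodule.span_induction with
  | mem x hx =>
    obtain ⟨i, rfl⟩ := hx
    have : genPi β γ K L (eVec β i) = genVec β γ i := by
      rw [genPi_apply]
      simp [orthonormal_iff_ite.1 (orthonormal_eVec hβ K L)]
    rw [this, eVec_eq_tv, genVec_eq_genTv]
    exact tv_mem_genGraph β γ (hasD_gC β i.1) (contDiff_gC β i.1) _
  | zero => rw [map_zero]; exact Submodule.zero_mem _
  | add x y _ _ hx hy => rw [map_add]; exact Submodule.add_mem _ hx hy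
  | smul c x _ hx => rw [map_smul]; exact Submodule.smul_mem _ c hx

section

variable {β : ℝ} {K L : ℕ}

theorem norm_projKL_one_pos (hβ : 0 < β) (hK : 1 ≤ K) (hL : 1 ≤ L) :
    0 < ‖projKL β K L (one β)‖ :=
  (nuIn_one_gC_zero_pos β).trans_le (norm_projKL_one_ge hβ hK hL)

theorem norm_uVec (hβ : 0 < β) (hK : 1 ≤ K) (hL : 1 ≤ L) : ‖uVec β K L‖ = 1 := by
  rw [uVec, norm_smul, norm_inv, norm_norm, inv_mul_cancel₀ (norm_projKL_one_pos hβ hK hL).ne']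

theorem uVec_mem : uVec β K L ∈ galerkin β K L :=
  Submodule.smul_mem _ _ (projKL_mem β K L _)

theorem inner_uVec (hβ : 0 < β) {φ : L2 β} (hφ : φ ∈ galerkin β K L) :
    ⟪uVec β K L, φ⟫_ℝ = ‖projKL β K L (one β)‖⁻¹ * ⟪one β, φ⟫_ℝ := by
  rw [uVec, inner_smul_left, inner_projKL_left, projKL_eq_self hβ hφ, RCLike.conj_to_real]

/-- Inside the Galerkin space, mean zero means orthogonal to u, though u is not constant. Hence the
projector onto the mean-zero part is Π_KL minus the component along u. -/
theorem inner_uVec_eq_zero_iff (hβ : 0 < β) (hK : 1 ≤ K) (hL : 1 ≤ L) {φ : L2 β}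
    (hφ : φ ∈ galerkin β K L) : ⟪uVec β K L, φ⟫_ℝ = 0 ↔ ⟪one β, φ⟫_ℝ = 0 := by
  rw [inner_uVec hβ hφ, mul_eq_zero, or_iff_right]
  exact inv_ne_zero (norm_projKL_one_pos hβ hK hL).ne'

theorem mem_galerkin0_iff {φ : L2 β} :
    φ ∈ galerkin0 β K L ↔ φ ∈ galerkin β K L ∧ ⟪one β, φ⟫_ℝ = 0 := by
  rw [galerkin0, Submodule.mem_inf, Submodule.mem_orthogonal_singleton_iff_inner_right]

theorem coe_discreteGen (hβ : 0 < β) (γ : ℝ) (hK : 1 ≤ K) (hL : 1 ≤ L) (φ : galerkin0 β K L) :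
    (discreteGen β γ K L φ : L2 β) = projKL β K L (genPi β γ K L φ) -
      ⟪uVec β K L, genPi β γ K L φ⟫_ℝ • uVec β K L := by
  set g := genPi β γ K L φ with hg
  have h1 : (discreteGen β γ K L φ : L2 β) = (galerkin0 β K L).starProjection g := rfl
  have hm : projKL β K L g - ⟪uVec β K L, g⟫_ℝ • uVec β K L ∈ galerkin β K L :=
    Submodule.sub_mem _ (projKL_mem β K L g) (Submodule.smul_mem _ _ uVec_mem)
  rw [h1]
  refine Submodule.eq_starProjection_of_mem_of_inner_eq_zero ?_ fun w hw => ?_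
  · rw [mem_galerkin0_iff]
    refine ⟨hm, (inner_uVec_eq_zero_iff hβ hK hL hm).1 ?_⟩
    rw [inner_sub_right, ← inner_projKL_left, projKL_eq_self hβ uVec_mem, inner_smul_right,
      real_inner_self_eq_norm_sq, norm_uVec hβ hK hL]
    ring
  · obtain ⟨hw1, hw2⟩ := mem_galerkin0_iff.1 hw
    rw [inner_sub_left, inner_sub_left, inner_projKL_left, projKL_eq_self hβ hw1, inner_smul_left,
      (inner_uVec_eq_zero_iff hβ hK hL hw1).2 hw2]
    simp

/-! ### Stability of the discrete generator and of the saddle-point system -/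

/-- The continuous coercivity is tested on φ in the mean-zero Galerkin space, and the two parts of L
φ absent from the discrete generator are treated as perturbations. Both are orthogonal to φ, so only
the A terms of the modified product see them. -/
theorem discreteRate_mul_norm_le (hβ : 0 < β) {γ ε lt : ℝ} (hε : 0 ≤ ε)
    (hco : Coercive β γ ε lt) (hK : 1 ≤ K) (hL : 1 ≤ L) (φ : galerkin0 β K L) :
    discreteRate β γ ε lt K L * ‖φ‖ ≤ ‖discreteGen β γ K L φ‖ := by
  obtain ⟨φ, hφ⟩ := φ
  have hψ := coe_discreteGen hβ γ hK hL ⟨φ, hφ⟩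
  obtain ⟨h1, h2⟩ := mem_galerkin0_iff.1 hφ
  rw [Submodule.coe_norm, Submodule.coe_norm]
  generalize ((discreteGen β γ K L ⟨φ, hφ⟩ : galerkin0 β K L) : L2 β) = ψ at hψ ⊢
  simp only at hψ ⊢
  set g := genPi β γ K L φ with hg
  set u := uVec β K L with hu
  have hu1 : ‖u‖ = 1 := norm_uVec hβ hK hL
  have huφ : ⟪u, φ⟫_ℝ = 0 := (inner_uVec_eq_zero_iff hβ hK hL h1).2 h2
  have c1 := hco.of_mem (mem_genGraph_genPi hβ γ h1) (by rw [real_inner_comm]; exact h2)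
  rw [← hg, modInner_neg_left] at c1
  have hdec : g = ψ + ((g - projKL β K L g) + ⟪u, g⟫_ℝ • u) := by rw [hψ]; abel
  have c2 : -(ε * ‖symErr β K L ∘L genPi β γ K L‖ * ‖φ‖ ^ 2) ≤
      modInner β ε (g - projKL β K L g) φ := by
    have e1 : ⟪g - projKL β K L g, φ⟫_ℝ = 0 := by
      rw [inner_sub_left, inner_projKL_left, projKL_eq_self hβ h1, sub_self]
    have e2 : modInner β ε (g - projKL β K L g) φ = -(ε * ⟪symErr β K L g, φ⟫_ℝ) := by
      rw [modInner, e1, symErr_apply, inner_add_left, ContinuousLinearMap.adjoint_inner_left,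
        real_inner_comm (A β φ)]
      ring
    have e3 : ⟪symErr β K L g, φ⟫_ℝ ≤ ‖symErr β K L ∘L genPi β γ K L‖ * ‖φ‖ ^ 2 := by
      refine (real_inner_le_norm _ _).trans ?_
      rw [sq, ← mul_assoc]
      exact mul_le_mul_of_nonneg_right ((symErr β K L ∘L genPi β γ K L).le_opNorm φ)
        (norm_nonneg _)
    rw [e2, mul_assoc]
    exact neg_le_neg (mul_le_mul_of_nonneg_left e3 hε)
  -- ⟨u, L φ⟩ is bounded through L* u; the two terms in A contribute 1/2 + 1/2, as u is a unit
  -- vector.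
  have c3 : -(ε * ‖genAdjPi β γ K L u‖ * ‖φ‖ ^ 2) ≤ modInner β ε (⟪u, g⟫_ℝ • u) φ := by
    have e1 : |⟪u, g⟫_ℝ| ≤ ‖genAdjPi β γ K L u‖ * ‖φ‖ := by
      rw [hg, inner_genPi hβ γ h1 uVec_mem]
      exact abs_real_inner_le_norm _ _
    have e2 : |⟪A β u, φ⟫_ℝ + ⟪A β φ, u⟫_ℝ| ≤ ‖φ‖ := by
      have a1 := (abs_real_inner_le_norm (A β u) φ).trans
        (mul_le_mul_of_nonneg_right (norm_A_apply_le β u) (norm_nonneg φ))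
      have a2 := (abs_real_inner_le_norm (A β φ) u).trans
        (mul_le_mul_of_nonneg_right (norm_A_apply_le β φ) (norm_nonneg u))
      rw [hu1] at a1 a2
      refine (abs_add_le _ _).trans ?_
      linarith
    have e3 : modInner β ε (⟪u, g⟫_ℝ • u) φ =
        -(ε * (⟪u, g⟫_ℝ * (⟪A β u, φ⟫_ℝ + ⟪A β φ, u⟫_ℝ))) := by
      rw [modInner, map_smul, inner_smul_left, inner_smul_left, inner_smul_right, huφ,
        RCLike.conj_to_real]
      ring
    have e4 : ⟪u, g⟫_ℝ * (⟪A β u, φ⟫_ℝ + ⟪A β φ, u⟫_ℝ) ≤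
        ‖genAdjPi β γ K L u‖ * ‖φ‖ * ‖φ‖ := by
      refine (le_abs_self _).trans ?_
      rw [abs_mul]
      exact mul_le_mul e1 e2 (abs_nonneg _) (by positivity)
    rw [e3, mul_assoc, sq, ← mul_assoc ‖genAdjPi β γ K L u‖]
    exact neg_le_neg (mul_le_mul_of_nonneg_left e4 hε)
  have c4 := (neg_le_abs _).trans (abs_modInner_le β hε ψ φ)
  rw [hdec, modInner_add_left, modInner_add_left] at c1
  have hr : (1 + ε) * discreteRate β γ ε lt K L = lt - ε * consErr β γ K L := by
    rw [discreteRate_eq, rate]; field_simp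
  have c5 : (1 + ε) * (discreteRate β γ ε lt K L * ‖φ‖ * ‖φ‖) ≤ (1 + ε) * (‖ψ‖ * ‖φ‖) := by
    have : (1 + ε) * (discreteRate β γ ε lt K L * ‖φ‖ * ‖φ‖) =
        (lt - ε * consErr β γ K L) * ‖φ‖ ^ 2 := by rw [← hr]; ring
    rw [this, consErr]
    linarith
  have c6 := le_of_mul_le_mul_left c5 (by linarith)
  rcases (norm_nonneg φ).eq_or_lt with h0 | h0
  · rw [← h0, mul_zero]; exact norm_nonneg _
  · exact le_of_mul_le_mul_right c6 h0

theorem exists_discreteGen_inverse {γ c : ℝ} (hc : 0 < c)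
    (h : ∀ φ : galerkin0 β K L, c * ‖φ‖ ≤ ‖discreteGen β γ K L φ‖) :
    ∃ R : galerkin0 β K L →L[ℝ] galerkin0 β K L,
      R ∘L discreteGen β γ K L = ContinuousLinearMap.id ℝ (galerkin0 β K L) ∧
      discreteGen β γ K L ∘L R = ContinuousLinearMap.id ℝ (galerkin0 β K L) ∧
      ‖R‖ ≤ 1 / c := by
  have hinj : Function.Injective (discreteGen β γ K L).toLinearMap := by
    refine (injective_iff_map_eq_zero _).2 fun φ hφ => ?_
    have h1 := h φ
    have h2 : discreteGen β γ K L φ = 0 := hφ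
    rw [h2, norm_zero] at h1
    have h3 : ‖φ‖ ≤ 0 := by
      by_contra! h4
      nlinarith [mul_pos hc h4]
    exact norm_le_zero_iff.1 h3
  let Λ := LinearEquiv.ofInjectiveEndo _ hinj
  have hΛ : ∀ y, discreteGen β γ K L (Λ.symm y) = y := fun y => Λ.apply_symm_apply y
  refine ⟨LinearMap.toContinuousLinearMap Λ.symm.toLinearMap, ?_, ?_, ?_⟩
  · ext1 φ
    exact Λ.symm_apply_apply φ
  · ext1 φ
    exact hΛ φ
  · refine ContinuousLinearMap.opNorm_le_bound _ (by positivity) fun y => ?_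
    have h1 := h (Λ.symm y)
    rw [hΛ] at h1
    rw [one_div_mul_eq_div, le_div_iff₀ hc, mul_comm]
    exact h1

/-- A kernel vector (x, s) gives φ = ∑ x_j e_j. The last row puts φ in the mean-zero space, the
others say Π_KL L φ = s u. So the discrete generator kills φ, whence φ = 0 and then s = 0. -/
theorem isUnit_saddle (hβ : 0 < β) {γ c : ℝ} (hK : 1 ≤ K) (hL : 1 ≤ L) (hc : 0 < c)
    (h : ∀ φ : galerkin0 β K L, c * ‖φ‖ ≤ ‖discreteGen β γ K L φ‖) :
    IsUnit (saddle β γ K L) := by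
  have ho := orthonormal_eVec hβ K L
  rw [← Matrix.mulVec_injective_iff_isUnit]
  refine (injective_iff_map_eq_zero (saddle β γ K L).mulVecLin).2 fun v hv => ?_
  rw [Matrix.mulVecLin_apply, saddle, Matrix.fromBlocks_mulVec] at hv
  set x := v ∘ Sum.inl with hx
  set s := v (Sum.inr ()) with hs
  set φ : L2 β := ∑ j, x j • eVec β j with hφ
  have hx' : ∀ j, ⟪eVec β j, φ⟫_ℝ = x j := fun j => ho.inner_right_fintype x j
  -- The rigidity matrix carries -L, so row i reads -⟨e_i, L φ⟩ + s ⟨u, e_i⟩ = 0.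
  have h1 : ∀ i : Idx K L, ⟪eVec β i, genPi β γ K L φ⟫_ℝ = s * ⟪uVec β K L, eVec β i⟫_ℝ := by
    intro i
    have := congrFun hv (Sum.inl i)
    simp only [Sum.elim_inl, Pi.add_apply, Matrix.mulVec, dotProduct, rigidity, Matrix.of_apply,
      Matrix.replicateCol_apply, uCoord, Pi.zero_apply, Finset.univ_unique, Finset.sum_singleton,
      inner_neg_right, neg_mul, Finset.sum_neg_distrib] at this
    rw [genPi_apply, inner_sum]
    simp only [inner_smul_right, hx']
    have e : ∑ j, ⟪eVec β i, genVec β γ j⟫_ℝ * x j = ⟪uVec β K L, eVec β i⟫_ℝ * s := by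
      have h3 : (v ∘ Sum.inr) (default : Unit) = s := rfl
      rw [h3] at this
      linarith
    rw [mul_comm s, ← e]
    exact Finset.sum_congr rfl fun j _ => mul_comm _ _
  have h2 : ⟪uVec β K L, φ⟫_ℝ = 0 := by
    have := congrFun hv (Sum.inr ())
    simp only [Sum.elim_inr, Pi.add_apply, Matrix.mulVec, dotProduct,
      Matrix.replicateRow_apply, uCoord, Pi.zero_apply, Matrix.zero_apply, zero_mul,
      Finset.sum_const_zero, add_zero] at this
    rw [hφ, inner_sum, ← this]
    simp only [inner_smul_right]
    exact Finset.sum_congr rfl fun j _ => mul_comm _ _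
  have hg : φ ∈ galerkin β K L :=
    Submodule.sum_mem _ fun j _ => Submodule.smul_mem _ _ (Submodule.subset_span ⟨j, rfl⟩)
  have hg0 : φ ∈ galerkin0 β K L :=
    mem_galerkin0_iff.2 ⟨hg, (inner_uVec_eq_zero_iff hβ hK hL hg).1 h2⟩
  have h3 : projKL β K L (genPi β γ K L φ) = s • uVec β K L := by
    conv_rhs => rw [← projKL_eq_self hβ (uVec_mem (β := β) (K := K) (L := L))]
    rw [projKL_apply, projKL_apply, Finset.smul_sum]
    refine Finset.sum_congr rfl fun i _ => ?_
    rw [h1, smul_smul, real_inner_comm]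
  have h4 : (discreteGen β γ K L ⟨φ, hg0⟩ : L2 β) = 0 := by
    rw [coe_discreteGen hβ γ hK hL]
    have : ⟪uVec β K L, genPi β γ K L φ⟫_ℝ = s := by
      rw [← projKL_eq_self hβ (uVec_mem (β := β) (K := K) (L := L)), inner_projKL_left, h3,
        inner_smul_right, real_inner_self_eq_norm_sq, norm_uVec hβ hK hL]
      ring
    simp only [this, h3, sub_self]
  have h5 : φ = 0 := by
    have h6 := h ⟨φ, hg0⟩
    rw [Submodule.coe_norm (discreteGen β γ K L ⟨φ, hg0⟩), h4, norm_zero,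
      Submodule.coe_norm] at h6
    have h7 : ‖φ‖ ≤ 0 := by
      by_contra! h8
      have := mul_pos hc h8
      simp only at h6
      linarith
    exact norm_le_zero_iff.1 h7
  have h6 : s = 0 := by
    rw [h5, map_zero, map_zero] at h3
    rcases smul_eq_zero.1 h3.symm with h7 | h7
    · exact h7
    · have := norm_uVec hβ hK hL
      rw [h7, norm_zero] at this
      norm_num at this
  funext i
  rcases i with j | ⟨⟩
  · show x j = 0
    rw [← hx', h5, inner_zero_right]
  · exact h6

end

/-- The coercivity constant and ε are both proportional to min(γ, 1/γ), up to a lower bound for the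
former. This factor drops out of the comparison with the consistency error, so the threshold on K is
uniform in γ. -/
theorem Admissible.exists_discreteRate_pos {β εbar lbar : ℝ} {ltil : ℝ → ℝ} (hβ : 0 < β)
    (had : Admissible β εbar lbar ltil) : ∃ K₀ : ℕ, 1 ≤ K₀ ∧ ∀ γ : ℝ, 0 < γ → ∀ K L : ℕ,
      K₀ ≤ K → 2 ≤ L → 0 < discreteRate β γ (εbar * min γ γ⁻¹) (ltil γ) K L := by
  obtain ⟨K₁, h1, h⟩ := exists_consErr_le hβ
  have e0 := had.eps_pos
  have l0 := had.lbar_pos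
  obtain ⟨N, hN⟩ := exists_nat_gt (εbar * ((1 + √2) * β / 2) / lbar)
  refine ⟨max K₁ (N + 1), by omega, fun γ hγ K L hK hL => ?_⟩
  have hm0 : 0 < min γ γ⁻¹ := lt_min hγ (inv_pos.2 hγ)
  have a1 := h γ K L ((le_max_left _ _).trans hK) hL
  have hKN : (N : ℝ) ≤ K := by exact_mod_cast (by omega : N ≤ K)
  have hK0 : (0 : ℝ) < K := by exact_mod_cast (by omega : 0 < K)
  have a2 : εbar * ((1 + √2) * β / (2 * K)) < lbar := by
    have := (div_lt_iff₀ l0).1 (hN.trans_le hKN)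
    have e : εbar * ((1 + √2) * β / (2 * K)) = εbar * ((1 + √2) * β / 2) / K := by field_simp
    rw [e, div_lt_iff₀ hK0]
    linarith
  have a3 := had.lower γ hγ
  set m := min γ γ⁻¹
  rw [discreteRate_eq, rate, div_mul_eq_mul_div, ← sub_div]
  refine div_pos ?_ (by positivity)
  have a4 : εbar * consErr β γ K L < lbar := (mul_le_mul_of_nonneg_left a1 e0.le).trans_lt a2
  have a5 := mul_lt_mul_of_pos_right a4 hm0
  linarith

end

end Langevin

theorem mainTheorem7 (β : ℝ) (hβ : 0 < β) :
    ∃ K₁ L₁ : ℕ,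
      -- the saddle-point matrix is invertible
      (∀ γ : ℝ, 0 < γ → ∀ K L : ℕ, K₁ ≤ K → L₁ ≤ L → IsUnit (Langevin.saddle β γ K L)) ∧
      -- there are admissible hypocoercivity parameters
      (∃ (εbar lbar : ℝ) (ltil : ℝ → ℝ), Langevin.Admissible β εbar lbar ltil) ∧
      -- for all such parameters
      ∀ (εbar lbar : ℝ) (ltil : ℝ → ℝ), Langevin.Admissible β εbar lbar ltil →
        (∃ C : ℝ, 1 ≤ C ∧
          -- the continuous rate governs the decay of the Langevin semigroup
          (∀ γ : ℝ, 0 < γ → ∀ S : ℝ → Langevin.L2 β →L[ℝ] Langevin.L2 β,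
            Langevin.IsSemigroupOf (Langevin.genGraph β γ) S →
            ∀ φ : Langevin.L2 β, ∫ x, φ x ∂(Langevin.mu β) = 0 → ∀ t : ℝ, 0 ≤ t →
              ‖S t φ‖ ≤
                C * Real.exp (-(Langevin.rate (εbar * min γ γ⁻¹) (ltil γ)) * t) * ‖φ‖) ∧
          -- the discrete rate is positive and gives the discrete resolvent bound
          ∃ K₀ L₀ : ℕ, ∀ γ : ℝ, 0 < γ → ∀ K L : ℕ, K₀ ≤ K → L₀ ≤ L →
            0 < Langevin.discreteRate β γ (εbar * min γ γ⁻¹) (ltil γ) K L ∧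
            ∃ R : Langevin.galerkin0 β K L →L[ℝ] Langevin.galerkin0 β K L,
              R ∘L Langevin.discreteGen β γ K L =
                ContinuousLinearMap.id ℝ (Langevin.galerkin0 β K L) ∧
              Langevin.discreteGen β γ K L ∘L R =
                ContinuousLinearMap.id ℝ (Langevin.galerkin0 β K L) ∧
              ‖R‖ ≤ C / Langevin.discreteRate β γ (εbar * min γ γ⁻¹) (ltil γ) K L) ∧
        -- the explicit lower bound on the discrete rate
        ∀ γ : ℝ, 0 < γ → ∀ K L : ℕ, K₁ ≤ K → L₁ ≤ L →
          Langevin.rate (εbar * min γ γ⁻¹) (ltil γ) -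
              εbar * min γ γ⁻¹ / (1 + εbar * min γ γ⁻¹) *
                ((1 + √2) * β / (2 * K) +
                  β ^ 3 / 16 * (Langevin.qDefect β (K - 1) ^ 2 /
                    (1 - Langevin.qDefect β K ^ 2))) ≤
            Langevin.discreteRate β γ (εbar * min γ γ⁻¹) (ltil γ) K L := by
  obtain ⟨K₁, hK₁, hcons⟩ := Langevin.exists_consErr_le hβ
  -- The saddle-point matrix contains no hypocoercivity parameter. One triple fixed here proves its
  -- invertibility, with a threshold independent of the triples quantified later.
  obtain ⟨ε₀, l₀, lt₀, had₀⟩ := Langevin.exists_admissible hβ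
  obtain ⟨K₂, hK₂, hpos₀⟩ := had₀.exists_discreteRate_pos hβ
  have hm (γ : ℝ) (hγ : 0 < γ) : 0 < min γ γ⁻¹ := lt_min hγ (inv_pos.2 hγ)
  refine ⟨max K₁ K₂, 2, fun γ hγ K L hK hL => ?_, ⟨ε₀, l₀, lt₀, had₀⟩,
    fun εbar lbar ltil had => ⟨⟨(1 + εbar) / (1 - εbar), ?_, ?_, ?_⟩, ?_⟩⟩
  · have hK' : 1 ≤ K := hK₂.trans ((le_max_right _ _).trans hK)
    exact Langevin.isUnit_saddle hβ hK' (by omega)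
      (hpos₀ γ hγ K L ((le_max_right _ _).trans hK) hL)
      (Langevin.discreteRate_mul_norm_le hβ (mul_pos had₀.eps_pos (hm γ hγ)).le
        (had₀.coercive γ hγ) hK' (by omega))
  · rw [le_div_iff₀ (by linarith [had.eps_lt_one])]
    linarith [had.eps_pos]
  · intro γ hγ S hS φ hφ t ht
    exact had.semigroup_decay hβ hγ hS hφ ht
  · obtain ⟨K₀, hK₀, hpos⟩ := had.exists_discreteRate_pos hβ
    refine ⟨K₀, 2, fun γ hγ K L hK hL => ?_⟩
    have h0 := hpos γ hγ K L hK hL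
    obtain ⟨R, h1, h2, h3⟩ := Langevin.exists_discreteGen_inverse h0
      (Langevin.discreteRate_mul_norm_le hβ (mul_pos had.eps_pos (hm γ hγ)).le
        (had.coercive γ hγ) (hK₀.trans hK) (by omega))
    -- The resolvent bound holds with constant 1; the larger constant comes from the semigroup.
    refine ⟨h0, R, h1, h2, h3.trans (div_le_div_of_nonneg_right ?_ h0.le)⟩
    rw [le_div_iff₀ (by linarith [had.eps_lt_one])]
    linarith [had.eps_pos]
  · intro γ hγ K L hK hL
    have h1 := hcons γ K L ((le_max_left _ _).trans hK) hL
    have h2 := mul_pos had.eps_pos (hm γ hγ)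
    -- The first term of the bracket already bounds the consistency error; of the defect term only
    -- the sign matters.
    have h3 : 0 ≤ β ^ 3 / 16 * (Langevin.qDefect β (K - 1) ^ 2 /
        (1 - Langevin.qDefect β K ^ 2)) :=
      mul_nonneg (by positivity) (div_nonneg (sq_nonneg _)
        (sub_nonneg.2 (Langevin.qDefect_sq_le_one β K)))
    rw [Langevin.discreteRate_eq]
    exact sub_le_sub_left (mul_le_mul_of_nonneg_left (by linarith) (by positivity)) _
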